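/- Let $M$ be a smooth $n$-dimensional manifold, $\pi:T^*M\to M$ its cotangent bundle, $\vartheta=p_i\,dx^i$ the tautological one-form and $\omega=-d\vartheta$ the canonical symplectic form on $T^*M$; the Hamiltonian vector field $X_H$ of a function $H$ is given by $i_{X_H}\omega=dH$. **Hybrid systems and invariance.** A hybrid system on a manifold $N$ consists of a guard $S\subset N$, a vector field $X$ on $N$ and a reset $\Delta:S\to N$. Its executions follow $X$ until they meet $S$, are then moved by $\Delta$, and continue from there; $\varphi_t$ denotes the time-$t$ map of this hybrid flow, defined at the points whose execution exists up to time $t$ with finitely many resets (at the instant of a reset the state is the one before the reset; for $t<0$, $\varphi_t$ is a local inverse branch of $\varphi_{-t}$, i.e. the execution that starts at $\varphi_t(y)$ is at $y$ after time $-t$). The system preserves a differential form $\alpha$ if $(\varphi_t^*\alpha)_x=\alpha_x$ for all $t\in\mathbb R$ and all $x\notin S$ with $\varphi_t(x)\notin S$ such that $\varphi_t$ is defined and smooth on an open neighbourhood of $x$ disjoint from $S$. **Time-independent problem.** Let $\mathcal U\subset\mathbb R^m$ be closed, $V\supset\mathcal U$ open, $f:M\times V\to TM$ a smooth controlled vector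 field, $\ell:M\times V\to\mathbb R$ a smooth running cost, $S=\{x\in W: h(x)=0\}$, where $W\subset M$ is open, $h:W\to\mathbb R$ is smooth and $dh\neq0$ on $S$, and let $\Delta:S\to M$ be smooth with $S\cap\Delta(S)=\emptyset$. Assume that for all $(x,p)\in T^*M$ the minimum $$H(x,p)=\min_{u\in\mathcal U}\bigl(\ell(x,u)+\langle p,f(x,u)\rangle\bigr)$$ is attained and that $H$ is smooth. Let $S^*=\{z\in T^*M:\pi(z)\in S,\ (\pi^*dh)(X_H(z))>0\}$, and let $\vartheta_H=p_i\,dx^i-H\,dt$ on $\mathbb R\times T^*M$. Let $\tilde\Delta:S^*\to T^*M$ be an extended reset: a smooth map with $\pi\circ\tilde\Delta=\Delta\circ\pi$ and $(\mathrm{Id}\times\tilde\Delta)^*\vartheta_H=\iota^*\vartheta_H$, where $\iota:\mathbb R\times S^*\hookrightarrow\mathbb R\times T^*M$ is the inclusion. Then the hybrid system $(T^*M,S^*,X_H,\tilde\Delta)$ preserves $\omega$. Moreover $\omega^n$ is a volume form (of top degree and nowhere zero), and the system preserves it. **Time-dependent problem.** Let $\mathcal U\subset V$ be as above, let $f$ and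 $\ell$ depend smoothly also on $t\in\mathbb R$, let $S=\{(t,x)\in W:h(t,x)=0\}$, where $W\subset\mathbb R\times M$ is open, $h:W\to\mathbb R$ is smooth and $dh\ne0$ on $S$, and let $\Delta:S\to M$ be smooth with $(t,\Delta(t,x))\notin S$ for $(t,x)\in S$. Assume that the minimum $H(t,x,p)=\min_{u\in\mathcal U}(\ell(t,x,u)+\langle p,f(t,x,u)\rangle)$ is attained everywhere and that $H$ is smooth on $\mathbb R\times T^*M$. Let $X=\partial_t+X_{H(t,\cdot)}$ on $\mathbb R\times T^*M$ and $S^*=\{q\in\mathbb R\times T^*M:(\mathrm{Id}\times\pi)(q)\in S,\ ((\mathrm{Id}\times\pi)^*dh)(X(q))>0\}$. Let $\tilde\Delta:S^*\to T^*M$ be smooth with $\pi(\tilde\Delta(q))=\Delta((\mathrm{Id}\times\pi)(q))$ and such that $\bar\Delta(t,z)=(t,\tilde\Delta(t,z))$ satisfies $\bar\Delta^*\vartheta_H=\iota^*\vartheta_H$ on $S^*$, where $\vartheta_H=p_i\,dx^i-H\,dt$ and $\iota:S^*\hookrightarrow\mathbb R\times T^*M$ is the inclusion. Then the hybrid system $(\mathbb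 R\times T^*M,S^*,X,\bar\Delta)$ preserves $\omega_H=-d\vartheta_H$. Moreover $dt\wedge\omega_H^n$ is a volume form (of top degree and nowhere zero), and the system preserves it. -/

import Mathlib

open scoped Manifold ContDiff Bundle

noncomputable section

/-! ### Exterior algebra on a real vector space -/

/-- The wedge product of two scalar alternating forms (a signed sum over shuffles). -/
def wedge {V : Type*} [AddCommGroup V] [Module ℝ V] {k l : ℕ}
    (a : V [⋀^Fin k]→ₗ[ℝ] ℝ) (b : V [⋀^Fin l]→ₗ[ℝ] ℝ) : V [⋀^Fin (k + l)]→ₗ[ℝ] ℝ :=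
  ((LinearMap.mul' ℝ ℝ).compAlternatingMap (a.domCoprod b)).domDomCongr finSumFinEquiv

/-- The `k`-fold wedge power of a two-form. -/
def wedgePow {V : Type*} [AddCommGroup V] [Module ℝ V] (a : V [⋀^Fin 2]→ₗ[ℝ] ℝ) :
    (k : ℕ) → V [⋀^Fin (2 * k)]→ₗ[ℝ] ℝ
  | 0 => AlternatingMap.constOfIsEmpty ℝ V (Fin 0) (1 : ℝ)
  | k + 1 => wedge (wedgePow a k) a

/-! ### Differential forms and hybrid dynamics on a manifold `N` -/

section General

variable {F : Type*} [NormedAddCommGroup F] [NormedSpace ℝ F] {K : Type*} [TopologicalSpace K]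
  (J : ModelWithCorners ℝ F K) {N : Type*} [TopologicalSpace N] [ChartedSpace K N]

/-- The expression of a `k`-form `α` in the preferred chart at `z₀`: the pullback of `α` by the
inverse of the chart. -/
def formInChart {k : ℕ} (α : (z : N) → TangentSpace J z [⋀^Fin k]→L[ℝ] ℝ) (z₀ : N) (e : F) :
    F [⋀^Fin k]→L[ℝ] ℝ :=
  (α ((extChartAt J z₀).symm e)).compContinuousLinearMap
    (mfderivWithin 𝓘(ℝ, F) J (extChartAt J z₀).symm (Set.range J) e)

/-- The exterior derivative of a `k`-form on a manifold, computed at each point in the preferred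
chart there. -/
def mextDeriv {k : ℕ} (α : (z : N) → TangentSpace J z [⋀^Fin k]→L[ℝ] ℝ) (z₀ : N) :
    TangentSpace J z₀ [⋀^Fin (k + 1)]→L[ℝ] ℝ :=
  (extDerivWithin (formInChart J α z₀) (Set.range J)
      (extChartAt J z₀ z₀)).compContinuousLinearMap
    (mfderiv J 𝓘(ℝ, F) (extChartAt J z₀) z₀)

/-- The exterior derivative of a one-form given as a field of covectors. -/
def mextDerivOne (α : (z : N) → TangentSpace J z →L[ℝ] ℝ) (z : N) :
    TangentSpace J z [⋀^Fin 2]→L[ℝ] ℝ :=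
  mextDeriv J
    (fun y => ContinuousAlternatingMap.ofSubsingleton ℝ (TangentSpace J y) ℝ (0 : Fin 1) (α y)) z

/-- A nowhere vanishing form of top degree. -/
def IsVolumeForm {k : ℕ} (α : (z : N) → TangentSpace J z [⋀^Fin k]→ₗ[ℝ] ℝ) : Prop :=
  Module.finrank ℝ F = k ∧ ∀ z, α z ≠ 0

variable (N) in
/-- The data `(S, X, Δ)` of a hybrid dynamical system on `N`. Only the values of `reset` on the
guard matter. -/
structure HybridSystem where
  guard : Set N
  field : (z : N) → TangentSpace J z
  reset : N → N

variable {J}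

/-- `Y.Reaches t z w`: the execution of `Y` starting at `z` is at `w` after time `t ≥ 0`, having
undergone finitely many resets. It follows the vector field until it meets the guard, is then moved
by the reset, and goes on from there. At the instant of a reset the state is the one before the
reset. -/
inductive HybridSystem.Reaches (Y : HybridSystem J N) : ℝ → N → N → Prop
  | flow (t : ℝ) (γ : ℝ → N) (ht : 0 ≤ t) (hγ : IsMIntegralCurveOn γ Y.field (Set.Icc 0 t))
      (hS : ∀ s ∈ Set.Ico 0 t, γ s ∉ Y.guard) : Y.Reaches t (γ 0) (γ t)
  | reset (τ t : ℝ) (γ : ℝ → N) (w : N) (hτ : 0 ≤ τ) (ht : 0 < t)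
      (hγ : IsMIntegralCurveOn γ Y.field (Set.Icc 0 τ))
      (hS : ∀ s ∈ Set.Ico 0 τ, γ s ∉ Y.guard) (hτS : γ τ ∈ Y.guard)
      (hw : Y.Reaches t (Y.reset (γ τ)) w) : Y.Reaches (τ + t) (γ 0) w

/-- `Φ` is, on `U`, the time-`t` map of the hybrid flow. For `t < 0` this means that the execution
starting at `Φ y` is at `y` after time `-t`. -/
def HybridSystem.IsFlowMapOn (Y : HybridSystem J N) (t : ℝ) (Φ : N → N) (U : Set N) : Prop :=
  ∀ y ∈ U, (0 ≤ t → Y.Reaches t y (Φ y)) ∧ (t < 0 → Y.Reaches (-t) (Φ y) y)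

/-- The form `α` is preserved along the hybrid flow: `(φ_t)^* α = α` at every point `x` off the
guard with `φ_t x` off the guard, near which the time-`t` map `φ_t` of the hybrid flow is defined
and smooth. -/
def HybridSystem.Preserves (Y : HybridSystem J N) {k : ℕ}
    (α : (z : N) → TangentSpace J z [⋀^Fin k]→ₗ[ℝ] ℝ) : Prop :=
  ∀ (t : ℝ) (U : Set N) (Φ : N → N), IsOpen U → Disjoint U Y.guard → Y.IsFlowMapOn t Φ U →
    ContMDiffOn J J ∞ Φ U → ∀ x ∈ U, Φ x ∉ Y.guard →
      (α (Φ x)).compLinearMap (mfderiv J J Φ x).toLinearMap = α x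

end General

/-! ### The cotangent bundle -/

/-- The cotangent bundle `T^*M` of an `n`-dimensional manifold. -/
abbrev Cotangent (n : ℕ) (M : Type*) [TopologicalSpace M]
    [ChartedSpace (EuclideanSpace ℝ (Fin n)) M] :=
  Bundle.TotalSpace (EuclideanSpace ℝ (Fin n) →L[ℝ] ℝ)
    (fun x : M => TangentSpace (𝓡 n) x →L[ℝ] Bundle.Trivial M ℝ x)

/-- The model of `T^*M`. -/
abbrev cotModel (n : ℕ) :=
  (𝓡 n).prod 𝓘(ℝ, EuclideanSpace ℝ (Fin n) →L[ℝ] ℝ)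

/-- The model of `ℝ × T^*M`. -/
abbrev extModel (n : ℕ) := 𝓘(ℝ, ℝ).prod (cotModel n)

section Cotangent

variable {n : ℕ} {M : Type*} [TopologicalSpace M] [ChartedSpace (EuclideanSpace ℝ (Fin n)) M]
  [IsManifold (𝓡 n) ∞ M]

/-- The projection `π : T^*M → M`. -/
def cotProj (z : Cotangent n M) : M := z.proj

/-- The projection `id × π : ℝ × T^*M → ℝ × M`. -/
def extProj (q : ℝ × Cotangent n M) : ℝ × M := (q.1, q.2.proj)

/-- The covector `p` of a point `z = (x, p)` of `T^*M`. -/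
def covector (z : Cotangent n M) : TangentSpace (𝓡 n) (cotProj z) →L[ℝ] ℝ := z.snd

/-- The tautological one-form `ϑ = p_i dx^i`. -/
def tautologicalForm (z : Cotangent n M) : TangentSpace (cotModel n) z →L[ℝ] ℝ :=
  (covector z).comp (mfderiv (cotModel n) (𝓡 n) cotProj z)

/-- The canonical symplectic form `ω = -dϑ = dx^i ∧ dp_i`. -/
def symplecticForm (z : Cotangent n M) : TangentSpace (cotModel n) z [⋀^Fin 2]→L[ℝ] ℝ :=
  -mextDerivOne (cotModel n) tautologicalForm z

/-- The Hamiltonian vector field of `H`, that is, the vector field `X` with `ω(X, ·) = dH`. -/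
def hamiltonianField (H : Cotangent n M → ℝ) (z : Cotangent n M) : TangentSpace (cotModel n) z :=
  Classical.epsilon fun v => ∀ w, symplecticForm z ![v, w] = mvfderiv (cotModel n) H z w

/-- The one-form `dt` on `ℝ × T^*M`. -/
def dtForm (q : ℝ × Cotangent n M) : TangentSpace (extModel n) q →L[ℝ] ℝ :=
  mvfderiv (extModel n) Prod.fst q

/-- The action form `ϑ_H = p_i dx^i - H dt` on `ℝ × T^*M`. -/
def actionForm (H : ℝ × Cotangent n M → ℝ) (q : ℝ × Cotangent n M) :
    TangentSpace (extModel n) q →L[ℝ] ℝ :=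
  (tautologicalForm q.2).comp (mfderiv (extModel n) (cotModel n) Prod.snd q) - H q • dtForm q

/-- The two-form `ω_H = -dϑ_H` on `ℝ × T^*M`. -/
def actionTwoForm (H : ℝ × Cotangent n M → ℝ) (q : ℝ × Cotangent n M) :
    TangentSpace (extModel n) q [⋀^Fin 2]→L[ℝ] ℝ :=
  -mextDerivOne (extModel n) (actionForm H) q

/-- The form `ω^n` on `T^*M`. -/
def liouvilleForm (z : Cotangent n M) :
    TangentSpace (cotModel n) z [⋀^Fin (2 * n)]→ₗ[ℝ] ℝ :=
  wedgePow (symplecticForm z).toAlternatingMap n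

/-- The form `dt ∧ ω_H^n` on `ℝ × T^*M`. -/
def extLiouvilleForm (H : ℝ × Cotangent n M → ℝ) (q : ℝ × Cotangent n M) :
    TangentSpace (extModel n) q [⋀^Fin (1 + 2 * n)]→ₗ[ℝ] ℝ :=
  wedge (AlternatingMap.ofSubsingleton ℝ (TangentSpace (extModel n) q) ℝ (0 : Fin 1)
      (dtForm q).toLinearMap)
    (wedgePow (actionTwoForm H q).toAlternatingMap n)

/-- The suspended Hamiltonian vector field `∂/∂t + X_{H_t}` on `ℝ × T^*M`. -/
def extHamiltonianField (H : ℝ × Cotangent n M → ℝ) (q : ℝ × Cotangent n M) :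
    TangentSpace (extModel n) q :=
  ((1 : ℝ), hamiltonianField (fun z => H (q.1, z)) q.2)

end Cotangent

/-! ### Time-independent hybrid optimal control problems -/

/-- A time-independent hybrid control system on `M` together with a running cost. The guard is the
zero set `S` of a smooth function `h`, defined on an open set `W`, whose differential does not
vanish on `S`; so `S` is an embedded hypersurface. Only the values of `f`, `cost` at controls in `V`,
of `h` on `W` and of `Δ` on `S` matter. -/
structure HybridControlSystem (n m : ℕ) (M : Type*) [TopologicalSpace M]
    [ChartedSpace (EuclideanSpace ℝ (Fin n)) M] [IsManifold (𝓡 n) ∞ M] where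
  /-- admissible controls -/
  U : Set (EuclideanSpace ℝ (Fin m))
  isClosed_U : IsClosed U
  V : Set (EuclideanSpace ℝ (Fin m))
  isOpen_V : IsOpen V
  U_subset_V : U ⊆ V
  /-- controlled vector field -/
  f : (x : M) → EuclideanSpace ℝ (Fin m) → TangentSpace (𝓡 n) x
  smooth_f : ContMDiffOn ((𝓡 n).prod (𝓡 m)) (𝓡 n).tangent ∞
    (fun q : M × EuclideanSpace ℝ (Fin m) => (⟨q.1, f q.1 q.2⟩ : TangentBundle (𝓡 n) M))
    (Set.univ ×ˢ V)
  /-- running cost -/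
  cost : M → EuclideanSpace ℝ (Fin m) → ℝ
  smooth_cost : ContMDiffOn ((𝓡 n).prod (𝓡 m)) 𝓘(ℝ, ℝ) ∞
    (fun q : M × EuclideanSpace ℝ (Fin m) => cost q.1 q.2) (Set.univ ×ˢ V)
  W : Set M
  isOpen_W : IsOpen W
  h : M → ℝ
  smooth_h : ContMDiffOn (𝓡 n) 𝓘(ℝ, ℝ) ∞ h W
  dh_ne_zero : ∀ x ∈ W, h x = 0 → mvfderiv (𝓡 n) h x ≠ 0
  /-- reset -/
  Δ : M → M
  smooth_Δ : ContMDiffOn (𝓡 n) (𝓡 n) ∞ Δ {x ∈ W | h x = 0}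
  Δ_notMem : ∀ x ∈ W, h x = 0 → Δ x ∉ {x ∈ W | h x = 0}

namespace HybridControlSystem

variable {n m : ℕ} {M : Type*} [TopologicalSpace M] [ChartedSpace (EuclideanSpace ℝ (Fin n)) M]
  [IsManifold (𝓡 n) ∞ M] (C : HybridControlSystem n m M)

/-- The guard `S = h⁻¹(0)`. -/
def S : Set M := {x ∈ C.W | C.h x = 0}

/-- The control Hamiltonian `Ĥ(x, p, u) = ℓ(x, u) + ⟨p, f(x, u)⟩`. -/
def controlHamiltonian (z : Cotangent n M) (u : EuclideanSpace ℝ (Fin m)) : ℝ :=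
  C.cost (cotProj z) u + covector z (C.f (cotProj z) u)

/-- The optimal Hamiltonian `H(x, p) = min_u Ĥ(x, p, u)`. -/
def H (z : Cotangent n M) : ℝ := sInf (C.controlHamiltonian z '' C.U)

/-- The minimum that defines the optimal Hamiltonian is attained, and the optimal Hamiltonian is
smooth. -/
structure IsRegular : Prop where
  exists_min : ∀ z : Cotangent n M, ∃ u ∈ C.U, IsMinOn (C.controlHamiltonian z) C.U u
  smooth_H : ContMDiff (cotModel n) 𝓘(ℝ, ℝ) ∞ C.H

/-- `π^* dh` as a covector at `z ∈ T^*M`. -/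
def dhPull (z : Cotangent n M) : TangentSpace (cotModel n) z →L[ℝ] ℝ :=
  (mvfderiv (𝓡 n) C.h (cotProj z)).comp (mfderiv (cotModel n) (𝓡 n) cotProj z)

/-- The extended guard `S^*` of outward pointing momenta. -/
def extendedGuard : Set (Cotangent n M) :=
  {z | cotProj z ∈ C.S ∧ 0 < C.dhPull z (hamiltonianField C.H z)}

/-- `R : S^* → T^*M` is smooth, covers `Δ`, and satisfies `(id × R)^* ϑ_H = ι^* ϑ_H` on
`ℝ × S^*`. The tangent space of `ℝ × S^*` at `(t, z)` consists of the vectors whose `T^*M`-component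
is annihilated by `π^* dh`. -/
structure IsExtendedReset (R : Cotangent n M → Cotangent n M) : Prop where
  smooth : ContMDiffOn (cotModel n) (cotModel n) ∞ R C.extendedGuard
  proj : ∀ z ∈ C.extendedGuard, cotProj (R z) = C.Δ (cotProj z)
  action : ∀ (t : ℝ), ∀ z ∈ C.extendedGuard, ∀ v : TangentSpace (extModel n) (t, z),
    C.dhPull z (mfderiv (extModel n) (cotModel n) Prod.snd (t, z) v) = 0 →
    actionForm (fun q => C.H q.2) (t, R z)
        (mfderivWithin (extModel n) (extModel n) (Prod.map id R)
          (Set.univ ×ˢ C.extendedGuard) (t, z) v) =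
      actionForm (fun q => C.H q.2) (t, z) v

/-- The lifted hybrid Hamiltonian system `(T^*M, S^*, X_H, R)`. -/
def lift (R : Cotangent n M → Cotangent n M) : HybridSystem (cotModel n) (Cotangent n M) where
  guard := C.extendedGuard
  field := hamiltonianField C.H
  reset := R

end HybridControlSystem

/-! ### Time-dependent hybrid optimal control problems -/

/-- A time-dependent hybrid control system on `M` together with a running cost. The guard is the
zero set `S ⊆ ℝ × M` of a smooth function `h`, defined on an open set `W ⊆ ℝ × M`, whose
differential does not vanish on `S`. At `(t, x) ∈ S` the state `x` is reset to `Δ (t, x)`. -/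
structure TimeHybridControlSystem (n m : ℕ) (M : Type*) [TopologicalSpace M]
    [ChartedSpace (EuclideanSpace ℝ (Fin n)) M] [IsManifold (𝓡 n) ∞ M] where
  /-- admissible controls -/
  U : Set (EuclideanSpace ℝ (Fin m))
  isClosed_U : IsClosed U
  V : Set (EuclideanSpace ℝ (Fin m))
  isOpen_V : IsOpen V
  U_subset_V : U ⊆ V
  /-- controlled vector field -/
  f : ℝ → (x : M) → EuclideanSpace ℝ (Fin m) → TangentSpace (𝓡 n) x
  smooth_f : ContMDiffOn ((𝓘(ℝ, ℝ).prod (𝓡 n)).prod (𝓡 m)) (𝓡 n).tangent ∞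
    (fun q : (ℝ × M) × EuclideanSpace ℝ (Fin m) =>
      (⟨q.1.2, f q.1.1 q.1.2 q.2⟩ : TangentBundle (𝓡 n) M))
    (Set.univ ×ˢ V)
  /-- running cost -/
  cost : ℝ → M → EuclideanSpace ℝ (Fin m) → ℝ
  smooth_cost : ContMDiffOn ((𝓘(ℝ, ℝ).prod (𝓡 n)).prod (𝓡 m)) 𝓘(ℝ, ℝ) ∞
    (fun q : (ℝ × M) × EuclideanSpace ℝ (Fin m) => cost q.1.1 q.1.2 q.2) (Set.univ ×ˢ V)
  W : Set (ℝ × M)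
  isOpen_W : IsOpen W
  h : ℝ × M → ℝ
  smooth_h : ContMDiffOn (𝓘(ℝ, ℝ).prod (𝓡 n)) 𝓘(ℝ, ℝ) ∞ h W
  dh_ne_zero : ∀ y ∈ W, h y = 0 → mvfderiv (𝓘(ℝ, ℝ).prod (𝓡 n)) h y ≠ 0
  /-- reset -/
  Δ : ℝ × M → M
  smooth_Δ : ContMDiffOn (𝓘(ℝ, ℝ).prod (𝓡 n)) (𝓡 n) ∞ Δ {y ∈ W | h y = 0}
  Δ_notMem : ∀ y ∈ W, h y = 0 → (y.1, Δ y) ∉ {y ∈ W | h y = 0}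

namespace TimeHybridControlSystem

variable {n m : ℕ} {M : Type*} [TopologicalSpace M] [ChartedSpace (EuclideanSpace ℝ (Fin n)) M]
  [IsManifold (𝓡 n) ∞ M] (C : TimeHybridControlSystem n m M)

/-- The guard `S = h⁻¹(0) ⊆ ℝ × M`. -/
def S : Set (ℝ × M) := {y ∈ C.W | C.h y = 0}

/-- The control Hamiltonian `Ĥ(t, x, p, u) = ℓ(t, x, u) + ⟨p, f(t, x, u)⟩`. -/
def controlHamiltonian (q : ℝ × Cotangent n M) (u : EuclideanSpace ℝ (Fin m)) : ℝ :=
  C.cost q.1 (cotProj q.2) u + covector q.2 (C.f q.1 (cotProj q.2) u)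

/-- The optimal Hamiltonian `H(t, x, p) = min_u Ĥ(t, x, p, u)`. -/
def H (q : ℝ × Cotangent n M) : ℝ := sInf (C.controlHamiltonian q '' C.U)

/-- The minimum that defines the optimal Hamiltonian is attained, and the optimal Hamiltonian is
smooth. -/
structure IsRegular : Prop where
  exists_min : ∀ q : ℝ × Cotangent n M, ∃ u ∈ C.U, IsMinOn (C.controlHamiltonian q) C.U u
  smooth_H : ContMDiff (extModel n) 𝓘(ℝ, ℝ) ∞ C.H

/-- `(id × π)^* dh` as a covector at `q ∈ ℝ × T^*M`. -/
def dhPull (q : ℝ × Cotangent n M) : TangentSpace (extModel n) q →L[ℝ] ℝ :=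
  (mvfderiv (𝓘(ℝ, ℝ).prod (𝓡 n)) C.h (extProj q)).comp
    (mfderiv (extModel n) (𝓘(ℝ, ℝ).prod (𝓡 n)) extProj q)

/-- The extended guard `S^* ⊆ ℝ × T^*M`, where `h` increases along the suspended Hamiltonian
vector field. -/
def extendedGuard : Set (ℝ × Cotangent n M) :=
  {q | extProj q ∈ C.S ∧ 0 < C.dhPull q (extHamiltonianField C.H q)}

/-- The map `(t, z) ↦ (t, R (t, z))`. -/
def timeReset (R : ℝ × Cotangent n M → Cotangent n M) (q : ℝ × Cotangent n M) :
    ℝ × Cotangent n M := (q.1, R q)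

/-- `R : S^* → T^*M` is smooth, covers `Δ`, and the map `(t, z) ↦ (t, R (t, z))` from `S^*` to
`ℝ × T^*M` pulls `ϑ_H` back to `ι^* ϑ_H`. The tangent space of `S^*` at `q` is the kernel of
`(id × π)^* dh`. -/
structure IsExtendedReset (R : ℝ × Cotangent n M → Cotangent n M) : Prop where
  smooth : ContMDiffOn (extModel n) (cotModel n) ∞ R C.extendedGuard
  proj : ∀ q ∈ C.extendedGuard, cotProj (R q) = C.Δ (extProj q)
  action : ∀ q ∈ C.extendedGuard, ∀ v : TangentSpace (extModel n) q, C.dhPull q v = 0 →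
    actionForm C.H (timeReset R q)
        (mfderivWithin (extModel n) (extModel n) (timeReset R) C.extendedGuard q v) =
      actionForm C.H q v

/-- The lifted hybrid Hamiltonian system on `ℝ × T^*M`. -/
def lift (R : ℝ × Cotangent n M → Cotangent n M) :
    HybridSystem (extModel n) (ℝ × Cotangent n M) where
  guard := C.extendedGuard
  field := extHamiltonianField C.H
  reset := timeReset R

end TimeHybridControlSystem

end

/-! Everything rests on one fact about a one-form `θ`. Suppose a vector field `X` lies in the kernel
of `dθ`, and the reset pulls `θ` back to its restriction to a hypersurface that `X` crosses
transversally. Then the hybrid flow preserves `dθ`. Here `θ` is the action form `ϑ_H` on `ℝ × T^*M`,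
and `X = ∂_t + X_{H_t}` spans its characteristic direction (`isCharacteristic_actionForm`).

Flowing preserves `dθ` by Cartan's formula (`curl_flow`). Since `X` is in the kernel, this stays
true when the flow time varies with the point (`IsLocalFlow.curl_fderiv`). In particular the map `σ`
that flows each point until it hits the guard preserves `dθ`. Its image lies in the guard, where the
reset preserves `θ`; hence "flow to the guard, then reset" preserves `dθ` as well
(`IsActionReset.exists_hitBox`).

An execution is a finite chain of such local maps. The time-`t` map `Φ` near a point need not agree
with the chain found at that point, since neighbouring executions may meet the guard in a different
pattern. By the Lindelöf property and rational flow times, countably many chains suffice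
(`HybridSystem.Reaches.exists_wordFlow_eq`). Baire's theorem then shows that `Φ` agrees with one of
them near points arbitrarily close to any given point (`frequently_exists_mem_nhds`). There `Φ`
preserves `dθ`, and continuity of the derivative of `Φ` carries this over to every point
(`PullsBackAt.of_frequently`, `HybridSystem.IsFlowMapOn.pullsBackAt`). For negative times the chain
is a local left inverse of `Φ`.

The time-independent system is handled through its suspension on `ℝ × T^*M`; on vectors without time
component `ω_H` is `ω`. Preservation of the volume forms follows because wedge products commute with
pullback and `Φ` only translates time. They vanish nowhere because in a Darboux basis every term of
the alternating sum is nonnegative and one is positive (`wedge_wedgePow_ne_zero`). -/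

noncomputable section

/-! ### Wedge powers: pullback and nonvanishing in a Darboux basis. -/

section Exterior

variable {V V' : Type*} [AddCommGroup V] [Module ℝ V] [AddCommGroup V'] [Module ℝ V']

theorem AlternatingMap.compLinearMap_domCoprod {ιa ιb : Type*} [Fintype ιa] [Fintype ιb]
    [DecidableEq ιa] [DecidableEq ιb]
    (a : V [⋀^ιa]→ₗ[ℝ] ℝ) (b : V [⋀^ιb]→ₗ[ℝ] ℝ) (L : V' →ₗ[ℝ] V) :
    (a.domCoprod b).compLinearMap L = (a.compLinearMap L).domCoprod (b.compLinearMap L) := by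
  ext v
  simp only [AlternatingMap.compLinearMap_apply, AlternatingMap.domCoprod_apply, sum_apply]
  refine Finset.sum_congr rfl fun σ _ => ?_
  induction σ using Quotient.inductionOn' with
  | h σ => rfl

theorem wedge_compLinearMap {k l : ℕ} (a : V [⋀^Fin k]→ₗ[ℝ] ℝ) (b : V [⋀^Fin l]→ₗ[ℝ] ℝ)
    (L : V' →ₗ[ℝ] V) :
    (wedge a b).compLinearMap L = wedge (a.compLinearMap L) (b.compLinearMap L) := by
  ext v
  simp only [wedge, ← AlternatingMap.compLinearMap_domCoprod]
  rfl

theorem wedgePow_compLinearMap (a : V [⋀^Fin 2]→ₗ[ℝ] ℝ) (L : V' →ₗ[ℝ] V) (k : ℕ) :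
    (wedgePow a k).compLinearMap L = wedgePow (a.compLinearMap L) k := by
  induction k with
  | zero => rfl
  | succ k ih => exact (wedge_compLinearMap _ _ _).trans (by rw [ih]; rfl)

/-- The tensor product of two scalar multilinear maps, in consecutive variables. -/
def MultilinearMap.tensor {k l : ℕ} (A : MultilinearMap ℝ (fun _ : Fin k => V) ℝ)
    (B : MultilinearMap ℝ (fun _ : Fin l => V) ℝ) :
    MultilinearMap ℝ (fun _ : Fin (k + l) => V) ℝ :=
  ((LinearMap.mul' ℝ ℝ).compMultilinearMap (A.domCoprod B)).domDomCongr finSumFinEquiv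

theorem MultilinearMap.tensor_apply {k l : ℕ} (A : MultilinearMap ℝ (fun _ : Fin k => V) ℝ)
    (B : MultilinearMap ℝ (fun _ : Fin l => V) ℝ) (v : Fin (k + l) → V) :
    A.tensor B v = A (fun i => v (Fin.castAdd l i)) * B (fun i => v (Fin.natAdd k i)) := by
  simp [MultilinearMap.tensor]

theorem MultilinearMap.alternatization_domDomCongr {ι ι' : Type*} [Fintype ι] [Fintype ι']
    [DecidableEq ι] [DecidableEq ι'] (A : MultilinearMap ℝ (fun _ : ι => V) ℝ) (e : ι ≃ ι') :
    (A.domDomCongr e).alternatization = A.alternatization.domDomCongr e := by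
  ext v
  simp only [MultilinearMap.alternatization_apply, AlternatingMap.domDomCongr_apply,
    MultilinearMap.domDomCongr_apply]
  refine (Fintype.sum_equiv e.permCongr _ _ fun σ => ?_).symm
  simp [Equiv.Perm.sign_permCongr]

/-- Replaces the quotient sum over shuffles by a sum over all permutations without any factorial, so
that a wedge product can be evaluated term by term. -/
theorem wedge_alternatization {k l : ℕ} (A : MultilinearMap ℝ (fun _ : Fin k => V) ℝ)
    (B : MultilinearMap ℝ (fun _ : Fin l => V) ℝ) :
    wedge A.alternatization B.alternatization = (A.tensor B).alternatization := by
  rw [MultilinearMap.tensor, MultilinearMap.alternatization_domDomCongr,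
    LinearMap.compMultilinearMap_alternatization, MultilinearMap.domCoprod_alternization]
  rfl

/-- The tensor powers of a bilinear map given as a multilinear map of two variables. -/
def MultilinearMap.tensorPow (B : MultilinearMap ℝ (fun _ : Fin 2 => V) ℝ) :
    (k : ℕ) → MultilinearMap ℝ (fun _ : Fin (2 * k) => V) ℝ
  | 0 => MultilinearMap.constOfIsEmpty ℝ (fun _ : Fin 0 => V) 1
  | k + 1 => (MultilinearMap.tensorPow B k).tensor B

theorem wedgePow_alternatization (B : MultilinearMap ℝ (fun _ : Fin 2 => V) ℝ) (k : ℕ) :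
    wedgePow B.alternatization k = (B.tensorPow k).alternatization := by
  induction k with
  | zero =>
    ext v
    have : Unique (Equiv.Perm (Fin (2 * 0))) := inferInstanceAs (Unique (Equiv.Perm (Fin 0)))
    rw [MultilinearMap.alternatization_apply, Fintype.sum_unique]
    rw [Unique.eq_default (1 : Equiv.Perm (Fin (2 * 0))) |>.symm]
    simp [wedgePow, MultilinearMap.tensorPow]
  | succ k ih =>
    rw [MultilinearMap.tensorPow, ← wedge_alternatization, ← ih]
    rfl

/-- The index `2 i + j` of the `j`-th member of the `i`-th pair. -/
def pairIndex {k : ℕ} (i : Fin k) (j : Fin 2) : Fin (2 * k) := ⟨2 * i + j, by omega⟩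

theorem MultilinearMap.tensorPow_apply (B : MultilinearMap ℝ (fun _ : Fin 2 => V) ℝ) (k : ℕ)
    (v : Fin (2 * k) → V) :
    B.tensorPow k v = ∏ i : Fin k, B (fun j => v (pairIndex i j)) := by
  induction k with
  | zero => rfl
  | succ k ih =>
    rw [MultilinearMap.tensorPow, MultilinearMap.tensor_apply, ih, Fin.prod_univ_castSucc]
    rfl

/-- The enumeration of `1 + 2 k` indices as one index followed by `k` pairs. -/
def pairEquiv (k : ℕ) : Fin 1 ⊕ (Fin k × Fin 2) ≃ Fin (1 + 2 * k) :=
  (Equiv.sumCongr (Equiv.refl _) (finProdFinEquiv.trans (finCongr (mul_comm k 2)))).trans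
    finSumFinEquiv

theorem pairEquiv_inr {k : ℕ} (i : Fin k) (j : Fin 2) :
    pairEquiv k (Sum.inr (i, j)) = Fin.natAdd 1 (pairIndex i j) := by
  ext
  simp [pairEquiv, pairIndex, add_comm]

theorem pairEquiv_inl {k : ℕ} (i : Fin 1) :
    pairEquiv k (Sum.inl i) = Fin.castAdd (2 * k) i := by
  simp [pairEquiv]

/-- If a permutation fixes the first index and permutes the ordered pairs, it is even. -/
theorem sign_eq_one_of_permutes_pairs {k : ℕ} (σ : Equiv.Perm (Fin 1 ⊕ (Fin k × Fin 2)))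
    (h₀ : ∀ i, σ (Sum.inl i) = Sum.inl i)
    (h : ∀ i, ∃ i', ∀ j, σ (Sum.inr (i, j)) = Sum.inr (i', j)) : Equiv.Perm.sign σ = 1 := by
  choose p hp using h
  have hinj : Function.Injective p := by
    intro i i' hii
    have : σ (Sum.inr (i, 0)) = σ (Sum.inr (i', 0)) := by rw [hp, hp, hii]
    simpa using σ.injective this
  let q : Equiv.Perm (Fin k) := Equiv.ofBijective p (Finite.injective_iff_bijective.1 hinj)
  have : σ = Equiv.Perm.sumCongr (1 : Equiv.Perm (Fin 1))
      (Equiv.prodCongrLeft fun _ : Fin 2 => q) := by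
    ext x
    rcases x with i | ⟨i, j⟩
    · simp [h₀]
    · simp [hp, q, Equiv.prodCongrLeft]
  -- The permutation `q` of the pairs acts once on the first members and once on the second members,
  -- so its sign enters squared.
  rw [this, Equiv.Perm.sign_sumCongr, Equiv.Perm.sign_prodCongrLeft]
  simp [← pow_two, Int.units_sq]

/-- A one-form times the top power of a two-form does not vanish, if there is a Darboux basis. -/
theorem wedge_wedgePow_ne_zero {k : ℕ} (a : V →ₗ[ℝ] ℝ) (W : V [⋀^Fin 2]→ₗ[ℝ] ℝ)
    (β : V →ₗ[ℝ] V →ₗ[ℝ] ℝ) (hW : ∀ v w, W ![v, w] = β v w - β w v)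
    (T : V) (e f : Fin k → V) (hT : a T = 1) (he : ∀ i, a (e i) = 0) (hf : ∀ i, a (f i) = 0)
    (hef : ∀ i j, β (e i) (f j) = if i = j then 1 else 0) (hee : ∀ i j, β (e i) (e j) = 0)
    (hff : ∀ i j, β (f i) (f j) = 0) (hfe : ∀ i j, β (f i) (e j) = 0) :
    wedge (AlternatingMap.ofSubsingleton ℝ V ℝ (0 : Fin 1) a) (wedgePow W k) ≠ 0 := by
  classical
  let A : MultilinearMap ℝ (fun _ : Fin 1 => V) ℝ :=
    MultilinearMap.ofSubsingleton ℝ V ℝ (0 : Fin 1) a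
  -- `W` is the antisymmetrization of `β`. Working with `β` rather than `W` makes the order inside
  -- each pair matter: `β (f i) (e i) = 0` rules out swapped pairs.
  let B : MultilinearMap ℝ (fun _ : Fin 2 => V) ℝ :=
    { toFun := fun v => β (v 0) (v 1)
      map_update_add' := by
        intro inst m i x y
        rw [Subsingleton.elim inst (instDecidableEqFin 2)]
        fin_cases i <;> simp
      map_update_smul' := by
        intro inst m i c x
        rw [Subsingleton.elim inst (instDecidableEqFin 2)]
        fin_cases i <;> simp }
  have hA : A.alternatization = AlternatingMap.ofSubsingleton ℝ V ℝ (0 : Fin 1) a := by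
    ext v
    simp [MultilinearMap.alternatization_apply, A]
  have hB : B.alternatization = W := by
    ext v
    have hv : v = ![v 0, v 1] := by ext i; fin_cases i <;> rfl
    rw [hv, hW, MultilinearMap.alternatization_apply]
    have hu : (Finset.univ : Finset (Equiv.Perm (Fin 2))) = {1, Equiv.swap 0 1} := by decide
    rw [hu, Finset.sum_pair (by decide)]
    simp [B, sub_eq_add_neg]
  rw [← hA, ← hB, wedgePow_alternatization, wedge_alternatization]
  let c : Fin 1 ⊕ (Fin k × Fin 2) → V := Sum.elim (fun _ => T) fun x => ![e x.1, f x.1] x.2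
  let ε := pairEquiv k
  intro h0
  have h1 := congrArg (fun F : V [⋀^Fin (1 + 2 * k)]→ₗ[ℝ] ℝ => F (c ∘ ε.symm)) h0
  simp only [MultilinearMap.alternatization_apply, AlternatingMap.zero_apply,
    MultilinearMap.domDomCongr_apply] at h1
  have heval : ∀ τ : Equiv.Perm (Fin 1 ⊕ (Fin k × Fin 2)),
      (A.tensor (B.tensorPow k)) (fun i => (c ∘ ε.symm) (ε.permCongr τ i)) =
        a (c (τ (Sum.inl 0))) * ∏ i, β (c (τ (Sum.inr (i, 0)))) (c (τ (Sum.inr (i, 1)))) := by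
    intro τ
    rw [MultilinearMap.tensor_apply, MultilinearMap.tensorPow_apply]
    simp only [← pairEquiv_inr, ← pairEquiv_inl, Equiv.permCongr_apply, Function.comp_apply,
      ε, Equiv.symm_apply_apply]
    rfl
  -- A nonzero factor of `a` forces `τ` to fix the index of `T`, and nonzero factors of `β` force it
  -- to send each ordered pair `(e i, f i)` to such a pair. So `τ` is even and the product is
  -- nonnegative.
  have hterm : ∀ σ : Equiv.Perm (Fin (1 + 2 * k)),
      0 ≤ Equiv.Perm.sign σ • (A.tensor (B.tensorPow k)) fun i => (c ∘ ε.symm) (σ i) := by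
    intro σ
    obtain ⟨τ, rfl⟩ := ε.permCongr.surjective σ
    rw [heval]
    by_cases hz : a (c (τ (Sum.inl 0))) *
        ∏ i, β (c (τ (Sum.inr (i, 0)))) (c (τ (Sum.inr (i, 1)))) = 0
    · rw [hz, smul_zero]
    obtain ⟨hz₁, hz₂⟩ := mul_ne_zero_iff.1 hz
    rw [Finset.prod_ne_zero_iff] at hz₂
    have h₀ : τ (Sum.inl 0) = Sum.inl 0 := by
      rcases h : τ (Sum.inl 0) with i | ⟨i, j⟩
      · rw [Subsingleton.elim i 0]
      · rw [h] at hz₁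
        fin_cases j <;> simp [c, he, hf] at hz₁
    have h₂ : ∀ i, ∃ i', τ (Sum.inr (i, 0)) = Sum.inr (i', 0) ∧
        τ (Sum.inr (i, 1)) = Sum.inr (i', 1) := by
      intro i
      have hi := hz₂ i (Finset.mem_univ i)
      rcases h : τ (Sum.inr (i, 0)) with l | ⟨l, j⟩
      · rw [Subsingleton.elim l 0, ← h₀] at h
        simpa using τ.injective h
      rcases h' : τ (Sum.inr (i, 1)) with l' | ⟨l', j'⟩
      · rw [Subsingleton.elim l' 0, ← h₀] at h'
        simpa using τ.injective h'
      rw [h, h'] at hi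
      fin_cases j <;> fin_cases j' <;> simp [c, hee, hff, hfe, hef] at hi
      exact ⟨l, rfl, by simp [hi]⟩
    have hs : Equiv.Perm.sign τ = 1 := by
      refine sign_eq_one_of_permutes_pairs τ (fun i => by rw [Subsingleton.elim i 0, h₀]) ?_
      intro i
      obtain ⟨i', hi'⟩ := h₂ i
      exact ⟨i', fun j => by fin_cases j; exacts [hi'.1, hi'.2]⟩
    rw [Equiv.Perm.sign_permCongr, hs, one_smul, h₀]
    refine mul_nonneg (by simp [c, hT]) (Finset.prod_nonneg fun i _ => ?_)
    obtain ⟨i', hi₁, hi₂⟩ := h₂ i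
    rw [hi₁, hi₂]
    simp [c, hef]
  have hone : 0 < Equiv.Perm.sign (1 : Equiv.Perm (Fin (1 + 2 * k))) •
      (A.tensor (B.tensorPow k)) fun i => (c ∘ ε.symm) ((1 : Equiv.Perm (Fin (1 + 2 * k))) i) := by
    have h := heval 1
    rw [show ε.permCongr 1 = 1 by ext; simp] at h
    rw [h]
    simp [c, hT, hef]
  exact absurd h1 (Finset.sum_pos' (fun σ _ => hterm σ) ⟨1, Finset.mem_univ _, hone⟩).ne'

end Exterior

/-! ### Local flows of `C²` vector fields and their derivatives. -/

section LocalFlow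

open Metric Set Filter Topology

variable {F : Type*} [NormedAddCommGroup F] [NormedSpace ℝ F]

/-- Linearity in the inhomogeneity `δ`: it pulls the quadratic factor `‖y - x‖ ^ 2` out of the
Grönwall estimate. -/
theorem gronwallBound_zero_eq_mul (K δ x : ℝ) :
    gronwallBound 0 K δ x = δ * gronwallBound 0 K 1 x := by
  by_cases hK : K = 0
  · simp [hK, gronwallBound_K0]
  · simp only [gronwallBound_of_K_ne_0 hK]
    ring

/-- A two-sided Grönwall inequality for a function that vanishes at `0`. -/
theorem norm_le_gronwallBound_abs {f f' : ℝ → F} {ε K δ : ℝ}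
    (hf : ∀ s ∈ Ioo (-ε) ε, HasDerivAt f (f' s) s) (h0 : f 0 = 0)
    (hbound : ∀ s ∈ Ioo (-ε) ε, ‖f' s‖ ≤ K * ‖f s‖ + δ) {s : ℝ} (hs : s ∈ Ioo (-ε) ε) :
    ‖f s‖ ≤ gronwallBound 0 K δ |s| := by
  rcases le_total 0 s with h | h
  · have hsub : ∀ u ∈ Icc 0 s, u ∈ Ioo (-ε) ε := fun u hu =>
      ⟨by linarith [hs.1, hs.2, hu.1], hu.2.trans_lt hs.2⟩
    have := norm_le_gronwallBound_of_norm_deriv_right_le (f := f) (f' := f') (δ := 0) (K := K)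
      (ε := δ) (a := 0) (b := s)
      (fun u hu => (hf u (hsub u hu)).continuousAt.continuousWithinAt)
      (fun u hu => (hf u (hsub u (Ico_subset_Icc_self hu))).hasDerivWithinAt) (by simp [h0])
      (fun u hu => hbound u (hsub u (Ico_subset_Icc_self hu))) s ⟨h, le_rfl⟩
    simpa [abs_of_nonneg h] using this
  · have hsub : ∀ u ∈ Icc 0 (-s), -u ∈ Ioo (-ε) ε := fun u hu =>
      ⟨by linarith [hs.1, hu.2], by linarith [hs.1, hs.2, hu.1]⟩
    have hd : ∀ u ∈ Icc 0 (-s), HasDerivAt (fun u => f (-u)) (-f' (-u)) u := fun u hu => by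
      simpa [Function.comp_def] using HasDerivAt.scomp u (hf (-u) (hsub u hu)) (hasDerivAt_neg u)
    have := norm_le_gronwallBound_of_norm_deriv_right_le (f := fun u => f (-u))
      (f' := fun u => -f' (-u)) (δ := 0) (K := K) (ε := δ) (a := 0) (b := -s)
      (fun u hu => (hd u hu).continuousAt.continuousWithinAt)
      (fun u hu => (hd u (Ico_subset_Icc_self hu)).hasDerivWithinAt) (by simp [h0])
      (fun u hu => by simpa using hbound (-u) (hsub u (Ico_subset_Icc_self hu)))
      (-s) ⟨by linarith, le_rfl⟩
    simpa [abs_of_nonpos h] using this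

/-- A flow is differentiable in the initial point, and its derivative is the solution of the
variational equation. -/
theorem hasFDerivAt_flow_of_variational {X : F → F} {X' : F → F →L[ℝ] F} {S V : Set F}
    {K C L ε : ℝ} (hS : Convex ℝ S) (hX : ∀ y ∈ S, HasFDerivAt X (X' y) y)
    (hK : ∀ y ∈ S, ‖X' y‖ ≤ K) (hC : ∀ a ∈ S, ∀ b ∈ S, ‖X' b - X' a‖ ≤ C * ‖b - a‖)
    (hC0 : 0 ≤ C) {x : F} (hV : V ∈ 𝓝 x) {φ : ℝ → F → F} {A : ℝ → F →L[ℝ] F}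
    (h0 : ∀ y ∈ V, φ 0 y = y) (hmem : ∀ s ∈ Ioo (-ε) ε, ∀ y ∈ V, φ s y ∈ S)
    (hφ : ∀ s ∈ Ioo (-ε) ε, ∀ y ∈ V, HasDerivAt (fun u => φ u y) (X (φ s y)) s)
    (hL : ∀ s ∈ Ioo (-ε) ε, ∀ y ∈ V, ‖φ s y - φ s x‖ ≤ L * ‖y - x‖)
    (hA0 : A 0 = ContinuousLinearMap.id ℝ F)
    (hA : ∀ s ∈ Ioo (-ε) ε, HasDerivAt A (X' (φ s x) ∘L A s) s) {s : ℝ} (hs : s ∈ Ioo (-ε) ε) :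
    HasFDerivAt (φ s) (A s) x := by
  have hx : x ∈ V := mem_of_mem_nhds hV
  -- The remainder `φ u y - φ u x - A u (y - x)` solves the linearized equation up to the Taylor
  -- error of `X`, which is quadratic in `‖y - x‖`. Grönwall's inequality makes the remainder
  -- quadratic too.
  have key : ∀ y ∈ V, ‖φ s y - φ s x - A s (y - x)‖ ≤
      (C * L ^ 2 * gronwallBound 0 K 1 |s|) * ‖‖y - x‖ ^ 2‖ := by
    intro y hy
    have hb := norm_le_gronwallBound_abs (f := fun u => φ u y - φ u x - A u (y - x))
      (f' := fun u => X (φ u y) - X (φ u x) - X' (φ u x) (A u (y - x))) (ε := ε) (K := K)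
      (δ := C * L ^ 2 * ‖y - x‖ ^ 2)
      (fun u hu => ((hφ u hu y hy).sub (hφ u hu x hx)).sub
        (by simpa using (hA u hu).clm_apply (hasDerivAt_const u (y - x))))
      (by simp [h0 y hy, h0 x hx, hA0]) ?_ hs
    · refine hb.trans (le_of_eq ?_)
      rw [gronwallBound_zero_eq_mul, norm_pow, norm_norm]
      ring
    · intro u hu
      have hyS := hmem u hu y hy
      have hxS := hmem u hu x hx
      have htaylor : ‖X (φ u y) - X (φ u x) - X' (φ u x) (φ u y - φ u x)‖ ≤
          (C * ‖φ u y - φ u x‖) * ‖φ u y - φ u x‖ := by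
        -- Intersecting with the ball of radius `‖φ u y - φ u x‖` keeps the set convex and bounds
        -- the variation of `X'` on it by `C` times that radius.
        refine (hS.inter (convex_closedBall (φ u x) ‖φ u y - φ u x‖)
          ).norm_image_sub_le_of_norm_hasFDerivWithin_le' (f' := X')
          (fun z hz => (hX z hz.1).hasFDerivWithinAt) (fun z hz => ?_)
          ⟨hxS, by simp⟩ ⟨hyS, by simp [dist_eq_norm]⟩
        refine (hC _ hxS z hz.1).trans ?_
        have := hz.2
        rw [mem_closedBall, dist_eq_norm] at this
        gcongr
      have hsq : (C * ‖φ u y - φ u x‖) * ‖φ u y - φ u x‖ ≤ C * L ^ 2 * ‖y - x‖ ^ 2 := by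
        have h1 := hL u hu y hy
        have h2 : ‖φ u y - φ u x‖ ^ 2 ≤ (L * ‖y - x‖) ^ 2 := by gcongr
        nlinarith [mul_le_mul_of_nonneg_left h2 hC0]
      calc ‖X (φ u y) - X (φ u x) - X' (φ u x) (A u (y - x))‖
          = ‖(X (φ u y) - X (φ u x) - X' (φ u x) (φ u y - φ u x)) +
              X' (φ u x) (φ u y - φ u x - A u (y - x))‖ := by
            congr 1
            simp only [map_sub]
            abel
        _ ≤ C * L ^ 2 * ‖y - x‖ ^ 2 + K * ‖φ u y - φ u x - A u (y - x)‖ :=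
            (norm_add_le _ _).trans (add_le_add (htaylor.trans hsq)
              ((ContinuousLinearMap.le_opNorm _ _).trans
                (mul_le_mul_of_nonneg_right (hK _ hxS) (norm_nonneg _))))
        _ = _ := by ring
  have hg : HasFDerivAt (fun y => φ s y - φ s x - A s (y - x)) (0 : F →L[ℝ] F) x :=
    Asymptotics.IsBigO.hasFDerivAt (n := 2)
      (Asymptotics.IsBigO.of_bound _ (Filter.mem_of_superset hV key)) one_lt_two
  have hl : HasFDerivAt (fun y => φ s x + A s (y - x)) (A s) x := by
    have h1 : HasFDerivAt (fun y => y - x) (ContinuousLinearMap.id ℝ F) x :=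
      (hasFDerivAt_id x).sub_const x
    simpa using! (HasFDerivAt.comp x (A s).hasFDerivAt h1).const_add (φ s x)
  have := hg.add hl
  simp only [zero_add] at this
  refine this.congr_of_eventuallyEq (Eventually.of_forall fun y => ?_)
  simp

/-- `φ` is a local flow of `X` for times in `(-ε, ε)` and initial points in the ball of radius `r`
about `x₀`. It stays in the ball of radius `R`, where `X` is Lipschitz, is of class `C¹` jointly in
time and initial point, and its derivative satisfies the variational equation. -/
structure IsLocalFlow (X : F → F) (x₀ : F) (R r ε : ℝ) (K : NNReal) (φ : ℝ × F → F) : Prop where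
  r_pos : 0 < r
  ε_pos : 0 < ε
  r_le : r ≤ R
  lipschitz : LipschitzOnWith K X (ball x₀ R)
  zero : ∀ x ∈ ball x₀ r, φ (0, x) = x
  mem : ∀ s ∈ Ioo (-ε) ε, ∀ x ∈ ball x₀ r, φ (s, x) ∈ ball x₀ R
  hasDerivAt : ∀ s ∈ Ioo (-ε) ε, ∀ x ∈ ball x₀ r,
    HasDerivAt (fun u => φ (u, x)) (X (φ (s, x))) s
  hasDerivAt_fderiv : ∀ s ∈ Ioo (-ε) ε, ∀ x ∈ ball x₀ r,
    HasDerivAt (fun u => fderiv ℝ (fun y => φ (u, y)) x)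
      (fderiv ℝ X (φ (s, x)) ∘L fderiv ℝ (fun y => φ (s, y)) x) s
  contDiffOn : ContDiffOn ℝ 1 φ (Ioo (-ε) ε ×ˢ ball x₀ r)

/-- A `C²` vector field has a local flow near every point, in any prescribed neighbourhood. -/
theorem exists_isLocalFlow [CompleteSpace F] {X : F → F} {x₀ : F} (hX : ContDiffAt ℝ 2 X x₀)
    {B : Set F} (hB : B ∈ 𝓝 x₀) :
    ∃ (R r ε : ℝ) (K : NNReal) (φ : ℝ × F → F), ball x₀ R ⊆ B ∧ IsLocalFlow X x₀ R r ε K φ := by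
  have hX' : ContDiffAt ℝ 1 (fderiv ℝ X) x₀ := hX.fderiv_right (m := 1) (by norm_num)
  obtain ⟨K, s₁, hs₁, hK⟩ := (hX.of_le (by norm_num : (1 : ℕ∞ω) ≤ 2)).exists_lipschitzOnWith
  obtain ⟨C, s₂, hs₂, hC⟩ := hX'.exists_lipschitzOnWith
  have hd : ∀ᶠ y in 𝓝 x₀, DifferentiableAt ℝ X y :=
    ((hX.eventually (by simp)).mono fun y hy => hy.differentiableAt (by simp))
  obtain ⟨R, hR, hRsub⟩ := Metric.mem_nhds_iff.1
    (inter_mem (inter_mem hB hd) (inter_mem hs₁ hs₂))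
  have hKR : LipschitzOnWith K X (ball x₀ R) := hK.mono fun y hy => (hRsub hy).2.1
  have hCR : LipschitzOnWith C (fderiv ℝ X) (ball x₀ R) := hC.mono fun y hy => (hRsub hy).2.2
  -- The flow and its variational equation are solved as one system. It is `C¹` because `X` is `C²`;
  -- its second component, started at the identity, will be the derivative of its first.
  let Y : F × (F →L[ℝ] F) → F × (F →L[ℝ] F) := fun p => (X p.1, fderiv ℝ X p.1 ∘L p.2)
  have hY : ContDiffAt ℝ 1 Y (x₀, ContinuousLinearMap.id ℝ F) := by
    have h1 : ContDiffAt ℝ 1 (fun p : F × (F →L[ℝ] F) => X p.1)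
        (x₀, ContinuousLinearMap.id ℝ F) :=
      ContDiffAt.comp _ (hX.of_le (by norm_num)) contDiffAt_fst
    have h2 : ContDiffAt ℝ 1 (fun p : F × (F →L[ℝ] F) => fderiv ℝ X p.1)
        (x₀, ContinuousLinearMap.id ℝ F) :=
      ContDiffAt.comp _ hX' contDiffAt_fst
    exact h1.prodMk (h2.clm_comp contDiffAt_snd)
  obtain ⟨ε₀, hε₀, a, r₀, L, K', hr₀, hpl⟩ := IsPicardLindelof.of_contDiffAt_one hY
  obtain ⟨α, hα, L', hL'⟩ := (hpl 0).exists_forall_mem_closedBall_eq_hasDerivWithinAt_lipschitzOnWith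
  simp only [zero_sub, zero_add] at hα hL'
  have hαc : ContinuousOn (Function.uncurry α)
      (closedBall (x₀, ContinuousLinearMap.id ℝ F) r₀ ×ˢ Icc (-ε₀) ε₀) :=
    continuousOn_prod_of_continuousOn_lipschitzOnWith _ L'
      (fun x hx => HasDerivWithinAt.continuousOn (hα x hx).2) hL'
  let i : F → F × (F →L[ℝ] F) := fun x => (x, ContinuousLinearMap.id ℝ F)
  have hi : ∀ x ∈ ball x₀ (r₀ : ℝ), i x ∈ closedBall (x₀, ContinuousLinearMap.id ℝ F) r₀ := by
    intro x hx
    rw [mem_closedBall, Prod.dist_eq, dist_self]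
    exact max_le (mem_ball.1 hx).le r₀.2
  have hcont : ContinuousOn (fun q : ℝ × F => α (i q.2) q.1) (Ioo (-ε₀) ε₀ ×ˢ ball x₀ r₀) :=
    hαc.comp (f := fun q : ℝ × F => (i q.2, q.1)) (by fun_prop)
      fun q hq => ⟨hi _ hq.2, Ioo_subset_Icc_self hq.1⟩
  have hopen : IsOpen (Ioo (-ε₀) ε₀ ×ˢ ball x₀ (r₀ : ℝ)) := isOpen_Ioo.prod isOpen_ball
  have hx₀ : x₀ ∈ ball x₀ (r₀ : ℝ) := mem_ball_self hr₀
  have hα0 : ∀ x ∈ ball x₀ (r₀ : ℝ), α (i x) 0 = i x := fun x hx => (hα _ (hi x hx)).1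
  have hnear : ∀ᶠ q : ℝ × F in 𝓝 (0, x₀), (α (i q.2) q.1).1 ∈ ball x₀ R := by
    have h0 : ((0 : ℝ), x₀) ∈ Ioo (-ε₀) ε₀ ×ˢ ball x₀ (r₀ : ℝ) := ⟨⟨by linarith, hε₀⟩, hx₀⟩
    have hca : ContinuousAt (fun q : ℝ × F => (α (i q.2) q.1).1) (0, x₀) :=
      (hcont.continuousAt (hopen.mem_nhds h0)).fst
    refine hca.preimage_mem_nhds (isOpen_ball.mem_nhds ?_)
    simp only [hα0 _ hx₀, i]
    exact mem_ball_self hR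
  obtain ⟨η, hη, hηsub⟩ := Metric.mem_nhds_iff.1 hnear
  -- `η` keeps the trajectories in the ball of radius `R`, where `X` and its derivative are
  -- Lipschitz; the bound `R` in `r` gives `r ≤ R`.
  let ε := min ε₀ η
  let r := min (min (r₀ : ℝ) η) R
  have hε : 0 < ε := lt_min hε₀ hη
  have hr : 0 < r := lt_min (lt_min hr₀ hη) hR
  have hIoo : Ioo (-ε) ε ⊆ Ioo (-ε₀) ε₀ :=
    Ioo_subset_Ioo (neg_le_neg (min_le_left _ _)) (min_le_left _ _)
  have hball : ball x₀ r ⊆ ball x₀ (r₀ : ℝ) :=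
    ball_subset_ball ((min_le_left _ _).trans (min_le_left _ _))
  have hmem : ∀ s ∈ Ioo (-ε) ε, ∀ x ∈ ball x₀ r, (α (i x) s).1 ∈ ball x₀ R := by
    intro s hs x hx
    refine hηsub (?_ : (s, x) ∈ ball ((0 : ℝ), x₀) η)
    rw [mem_ball, Prod.dist_eq]
    refine max_lt ?_ ((mem_ball.1 hx).trans_le ((min_le_left _ _).trans (min_le_right _ _)))
    rw [Real.dist_eq, sub_zero]
    exact (abs_lt.2 hs).trans_le (min_le_right _ _)
  have hder : ∀ s ∈ Ioo (-ε) ε, ∀ x ∈ ball x₀ r, HasDerivAt (α (i x)) (Y (α (i x) s)) s :=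
    fun s hs x hx => ((hα _ (hi x (hball hx))).2 s (Ioo_subset_Icc_self (hIoo hs))).hasDerivAt
      (Icc_mem_nhds (hIoo hs).1 (hIoo hs).2)
  have hder₁ : ∀ s ∈ Ioo (-ε) ε, ∀ x ∈ ball x₀ r,
      HasDerivAt (fun u => (α (i x) u).1) (X (α (i x) s).1) s :=
    fun s hs x hx => (hder s hs x hx).fst
  have hder₂ : ∀ s ∈ Ioo (-ε) ε, ∀ x ∈ ball x₀ r,
      HasDerivAt (fun u => (α (i x) u).2) (fderiv ℝ X (α (i x) s).1 ∘L (α (i x) s).2) s :=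
    fun s hs x hx => (hder s hs x hx).snd
  have hfd : ∀ s ∈ Ioo (-ε) ε, ∀ x ∈ ball x₀ r,
      HasFDerivAt (fun y => (α (i y) s).1) (α (i x) s).2 x := by
    intro s hs x hx
    refine hasFDerivAt_flow_of_variational (X := X) (X' := fderiv ℝ X) (S := ball x₀ R)
      (V := ball x₀ r) (K := K) (C := C) (L := L') (ε := ε) (φ := fun u y => (α (i y) u).1)
      (A := fun u => (α (i x) u).2) (convex_ball _ _) (fun y hy => (hRsub hy).1.2.hasFDerivAt)
      (fun y hy => norm_fderiv_le_of_lipschitzOn ℝ (isOpen_ball.mem_nhds hy) hKR)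
      (fun a ha b hb => by simpa [dist_eq_norm] using hCR.dist_le_mul b hb a ha) C.2
      (isOpen_ball.mem_nhds hx) (fun y hy => by rw [hα0 y (hball hy)]) hmem hder₁ ?_
      (by rw [hα0 x (hball hx)]) (fun u hu => hder₂ u hu x hx) hs
    intro u hu y hy
    have h1 := (hL' u (Ioo_subset_Icc_self (hIoo hu))).dist_le_mul _ (hi y (hball hy)) _
      (hi x (hball hx))
    rw [Prod.dist_eq] at h1
    have h2 := (le_max_left _ _).trans h1
    rw [Prod.dist_eq] at h2
    simpa [i, dist_eq_norm] using h2
  have hopen' : IsOpen (Ioo (-ε) ε ×ˢ ball x₀ r) := isOpen_Ioo.prod isOpen_ball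
  have hsub : Ioo (-ε) ε ×ˢ ball x₀ r ⊆ Ioo (-ε₀) ε₀ ×ˢ ball x₀ (r₀ : ℝ) := prod_mono hIoo hball
  have hXc : ContinuousOn X (ball x₀ R) := hKR.continuousOn
  let D : ℝ × F → (ℝ × F →L[ℝ] F) := fun q =>
    (ContinuousLinearMap.toSpanSingleton ℝ (X (α (i q.2) q.1).1)).coprod (α (i q.2) q.1).2
  have hX1 : ContinuousOn (fun q : ℝ × F => X (α (i q.2) q.1).1) (Ioo (-ε) ε ×ˢ ball x₀ r) :=
    hXc.comp (hcont.mono hsub).fst fun q hq => hmem q.1 hq.1 q.2 hq.2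
  have hX2 : ContinuousOn (fun q : ℝ × F =>
      ContinuousLinearMap.toSpanSingleton ℝ (X (α (i q.2) q.1).1)) (Ioo (-ε) ε ×ˢ ball x₀ r) :=
    (ContinuousLinearMap.toSpanSingletonCLE (𝕜 := ℝ) (E := F)).continuous.comp_continuousOn hX1
  have hA2 : ContinuousOn (fun q : ℝ × F => (α (i q.2) q.1).2) (Ioo (-ε) ε ×ˢ ball x₀ r) :=
    (hcont.mono hsub).snd
  -- Both partial derivatives exist and are continuous, hence the flow is jointly differentiable.
  have hjoint : ∀ q ∈ Ioo (-ε) ε ×ˢ ball x₀ r,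
      HasFDerivAt (fun q : ℝ × F => (α (i q.2) q.1).1) (D q) q := by
    intro q hq
    have hnh := hopen'.mem_nhds hq
    exact (hasStrictFDerivAt_uncurry_coprod (u := q) (f := fun s x => (α (i x) s).1)
      (f₁ := fun s x => ContinuousLinearMap.toSpanSingleton ℝ (X (α (i x) s).1))
      (f₂ := fun s x => (α (i x) s).2)
      (Filter.mem_of_superset hnh fun v hv => (hder₁ v.1 hv.1 v.2 hv.2).hasFDerivAt)
      (Filter.mem_of_superset hnh fun v hv => hfd v.1 hv.1 v.2 hv.2)
      (hX2.continuousAt hnh) (hA2.continuousAt hnh)).hasFDerivAt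
  refine ⟨R, r, ε, K, fun q => (α (i q.2) q.1).1, fun y hy => (hRsub hy).1.1, hr, hε,
    min_le_right _ _, hKR, fun x hx => by simp only [hα0 x (hball hx)]; rfl, hmem, hder₁,
    fun s hs x hx => ?_, ?_⟩
  · rw [(hfd s hs x hx).fderiv]
    refine (hder₂ s hs x hx).congr_of_eventuallyEq ?_
    filter_upwards [isOpen_Ioo.mem_nhds hs] with u hu
    exact (hfd u hu x hx).fderiv
  · rw [show (1 : ℕ∞ω) = 0 + 1 by simp, contDiffOn_succ_iff_fderiv_of_isOpen hopen']
    refine ⟨fun q hq => (hjoint q hq).differentiableAt.differentiableWithinAt, by simp, ?_⟩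
    rw [contDiffOn_zero]
    refine ContinuousOn.congr ?_ fun q hq => (hjoint q hq).fderiv
    have hD : D = fun q => ContinuousLinearMap.toSpanSingleton ℝ (X (α (i q.2) q.1).1) ∘L
        ContinuousLinearMap.fst ℝ ℝ F + (α (i q.2) q.1).2 ∘L ContinuousLinearMap.snd ℝ ℝ F := by
      ext q v <;> simp [D]
    rw [hD]
    exact (hX2.clm_comp continuousOn_const).add (hA2.clm_comp continuousOn_const)

namespace IsLocalFlow

variable {X : F → F} {x₀ : F} {R r ε : ℝ} {K : NNReal} {φ : ℝ × F → F}

/-- A solution that stays in the ball coincides with the local flow. -/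
theorem eq_of_solution (hφ : IsLocalFlow X x₀ R r ε K φ) {a b : ℝ} {c : ℝ → F} (hab : a ≤ b)
    (hba : b - a < ε) (hc : ∀ s ∈ Icc a b, HasDerivWithinAt c (X (c s)) (Icc a b) s)
    (hmem : ∀ s ∈ Icc a b, c s ∈ ball x₀ R) (hca : c a ∈ ball x₀ r) : φ (b - a, c a) = c b := by
  have hI : ∀ s ∈ Icc a b, s - a ∈ Ioo (-ε) ε := fun s hs =>
    ⟨by linarith [hs.1, hφ.ε_pos], by linarith [hs.2]⟩
  have hd : ∀ s ∈ Icc a b,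
      HasDerivAt (fun u => φ (u - a, c a)) (X (φ (s - a, c a))) s := fun s hs => by
    simpa [Function.comp_def] using
      HasDerivAt.scomp s (hφ.hasDerivAt (s - a) (hI s hs) _ hca) ((hasDerivAt_id s).sub_const a)
  -- At the endpoints `c` has only one-sided derivatives, so uniqueness is applied with right
  -- derivatives.
  refine ODE_solution_unique_of_mem_Icc_right (v := fun _ => X) (s := fun _ => ball x₀ R) (K := K)
    (f := fun u => φ (u - a, c a)) (g := c) (a := a) (b := b) (fun _ _ => hφ.lipschitz)
    (fun s hs => (hd s hs).continuousAt.continuousWithinAt)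
    (fun s hs => (hd s (Ico_subset_Icc_self hs)).hasDerivWithinAt)
    (fun s hs => hφ.mem _ (hI s (Ico_subset_Icc_self hs)) _ hca)
    (fun s hs => (hc s hs).continuousWithinAt) (fun s hs => ?_)
    (fun s hs => hmem s (Ico_subset_Icc_self hs)) ?_ ⟨hab, le_rfl⟩
  · exact (hc s (Ico_subset_Icc_self hs)).mono_of_mem_nhdsWithin (Icc_mem_nhdsGE_of_mem hs)
  · simp [hφ.zero _ hca]

theorem differentiableAt (hφ : IsLocalFlow X x₀ R r ε K φ) {s : ℝ} {x : F} (hs : s ∈ Ioo (-ε) ε)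
    (hx : x ∈ ball x₀ r) : DifferentiableAt ℝ φ (s, x) :=
  (hφ.contDiffOn.contDiffAt ((isOpen_Ioo.prod isOpen_ball).mem_nhds ⟨hs, hx⟩)).differentiableAt
    (by simp)

/-- Isolates the time direction as a multiple of `X`. This is the part that `dθ` does not see. -/
theorem fderiv_apply (hφ : IsLocalFlow X x₀ R r ε K φ) {s : ℝ} {x : F} (hs : s ∈ Ioo (-ε) ε)
    (hx : x ∈ ball x₀ r) (u : ℝ) (v : F) :
    fderiv ℝ φ (s, x) (u, v) = u • X (φ (s, x)) + fderiv ℝ (fun y => φ (s, y)) x v := by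
  have h := (hφ.differentiableAt hs hx).hasFDerivAt
  have h1 : HasDerivAt (fun u : ℝ => (u, x)) ((1 : ℝ), (0 : F)) s :=
    (hasDerivAt_id s).prodMk (hasDerivAt_const s x)
  have h2 : HasDerivAt (fun u => φ (u, x)) (fderiv ℝ φ (s, x) (1, 0)) s := h.comp_hasDerivAt s h1
  have h3 : HasFDerivAt (fun y => φ (s, y)) (fderiv ℝ φ (s, x) ∘L ContinuousLinearMap.inr ℝ ℝ F) x :=
    HasFDerivAt.comp x h (hasFDerivAt_prodMk_right s x)
  rw [h3.fderiv, ← h2.unique (hφ.hasDerivAt s hs x hx), ← map_smul]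
  simp [← map_add]

theorem fderiv_zero (hφ : IsLocalFlow X x₀ R r ε K φ) {x : F} (hx : x ∈ ball x₀ r) :
    fderiv ℝ (fun y => φ (0, y)) x = ContinuousLinearMap.id ℝ F := by
  have : (fun y => φ (0, y)) =ᶠ[𝓝 x] id := by
    filter_upwards [isOpen_ball.mem_nhds hx] with y hy
    exact hφ.zero y hy
  rw [this.fderiv_eq, fderiv_id]

end IsLocalFlow

end LocalFlow

/-! ### The exterior derivative of a one-form on a normed space. -/

section Curl

open Metric Set Filter Topology

variable {F F' : Type*} [NormedAddCommGroup F] [NormedSpace ℝ F]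
  [NormedAddCommGroup F'] [NormedSpace ℝ F']

/-- The exterior derivative of a field of covectors on a normed space. -/
def curl (θ : F → F →L[ℝ] ℝ) (e v w : F) : ℝ := fderiv ℝ θ e v w - fderiv ℝ θ e w v

theorem curl_smul_left (θ : F → F →L[ℝ] ℝ) (e v w : F) (c : ℝ) :
    curl θ e (c • v) w = c * curl θ e v w := by
  simp [curl, mul_sub]

theorem curl_add_left (θ : F → F →L[ℝ] ℝ) (e v v' w : F) :
    curl θ e (v + v') w = curl θ e v w + curl θ e v' w := by
  simp only [curl, map_add, add_apply]
  ring

theorem curl_swap (θ : F → F →L[ℝ] ℝ) (e v w : F) : curl θ e w v = -curl θ e v w := by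
  simp [curl]

theorem Filter.EventuallyEq.curl_eq {θ θ' : F → F →L[ℝ] ℝ} {e : F} (h : θ =ᶠ[𝓝 e] θ') :
    curl θ e = curl θ' e := by
  ext v w
  simp [curl, h.fderiv_eq]

/-- The second derivative of `f` enters symmetrically and cancels in the antisymmetrization. This is
where `C²` regularity of `f` is needed. -/
theorem curl_pullback {θ : F' → F' →L[ℝ] ℝ} {f : F → F'} {x : F}
    (hθ : DifferentiableAt ℝ θ (f x)) (hf : ContDiffAt ℝ 2 f x) (v w : F) :
    curl (fun y => θ (f y) ∘L fderiv ℝ f y) x v w =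
      curl θ (f x) (fderiv ℝ f x v) (fderiv ℝ f x w) := by
  have hf1 : DifferentiableAt ℝ f x := hf.differentiableAt (by simp)
  have hf2 : DifferentiableAt ℝ (fderiv ℝ f) x :=
    (hf.fderiv_right (m := 1) (by norm_num)).differentiableAt (by simp)
  have hc : HasFDerivAt (fun y => θ (f y)) (fderiv ℝ θ (f x) ∘L fderiv ℝ f x) x :=
    hθ.hasFDerivAt.comp x hf1.hasFDerivAt
  have h : HasFDerivAt (fun y => θ (f y) ∘L fderiv ℝ f y) _ x := hc.clm_comp hf2.hasFDerivAt
  have hsymm : fderiv ℝ (fderiv ℝ f) x v w = fderiv ℝ (fderiv ℝ f) x w v :=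
    (hf.isSymmSndFDerivAt (by simp)).eq v w
  simp only [curl, h.fderiv]
  simp [hsymm]

set_option synthInstance.maxHeartbeats 200000 in
set_option maxHeartbeats 800000 in
/-- A flow of a vector field in the kernel of `dθ` preserves `dθ`. -/
theorem curl_flow {θ : F → F →L[ℝ] ℝ} {X : F → F} {B : Set F} (hB : IsOpen B)
    (hθ : ContDiffOn ℝ 2 θ B) (hX : ContDiffOn ℝ 1 X B)
    (hker : ∀ y ∈ B, ∀ w, curl θ y (X y) w = 0) {ε : ℝ} {γ : ℝ → F} {A : ℝ → F →L[ℝ] F}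
    (hmem : ∀ s ∈ Ioo (-ε) ε, γ s ∈ B) (hγ : ∀ s ∈ Ioo (-ε) ε, HasDerivAt γ (X (γ s)) s)
    (hA : ∀ s ∈ Ioo (-ε) ε, HasDerivAt A (fderiv ℝ X (γ s) ∘L A s) s)
    (hA0 : A 0 = ContinuousLinearMap.id ℝ F) {s : ℝ} (hs : s ∈ Ioo (-ε) ε) (v w : F) :
    curl θ (γ s) (A s v) (A s w) = curl θ (γ 0) v w := by
  have hθ' : ∀ y ∈ B, HasFDerivAt (fderiv ℝ θ) (fderiv ℝ (fderiv ℝ θ) y) y := fun y hy =>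
    (((hθ.contDiffAt (hB.mem_nhds hy)).fderiv_right (m := 1) (by norm_num)).differentiableAt
      (by simp)).hasFDerivAt
  have hX' : ∀ y ∈ B, HasFDerivAt X (fderiv ℝ X y) y := fun y hy =>
    ((hX.contDiffAt (hB.mem_nhds hy)).differentiableAt (by simp)).hasFDerivAt
  have hsymm : ∀ y ∈ B, ∀ a b, fderiv ℝ (fderiv ℝ θ) y a b = fderiv ℝ (fderiv ℝ θ) y b a :=
    fun y hy a b => ((hθ.contDiffAt (hB.mem_nhds hy)).isSymmSndFDerivAt (by simp)).eq a b
  -- The derivative in direction `a` of the identity `dθ(X, b) = 0`.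
  have hid : ∀ y ∈ B, ∀ a b, fderiv ℝ (fderiv ℝ θ) y a (X y) b + fderiv ℝ θ y (fderiv ℝ X y a) b -
      (fderiv ℝ (fderiv ℝ θ) y a b (X y) + fderiv ℝ θ y b (fderiv ℝ X y a)) = 0 := by
    intro y hy a b
    have h1 := (((hθ' y hy).clm_apply (hX' y hy)).clm_apply (hasFDerivAt_const b y)).sub
      (((hθ' y hy).clm_apply (hasFDerivAt_const b y)).clm_apply (hX' y hy))
    have h2 : HasFDerivAt (fun y => fderiv ℝ θ y (X y) b - fderiv ℝ θ y b (X y))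
        (0 : F →L[ℝ] ℝ) y := by
      refine (hasFDerivAt_const (0 : ℝ) y).congr_of_eventuallyEq ?_
      filter_upwards [hB.mem_nhds hy] with z hz
      exact hker z hz b
    have h3 := congrArg (fun L : F →L[ℝ] ℝ => L a) (h1.unique h2)
    simp at h3
    linarith
  -- Cartan's formula in coordinates: with the second derivatives of `θ` symmetric, which expresses
  -- `d(dθ) = 0`, the difference of `hid` for `(A u v, A u w)` and for the swapped pair is the
  -- derivative along the flow.
  have hder : ∀ u ∈ Ioo (-ε) ε, HasDerivAt (fun u => curl θ (γ u) (A u v) (A u w)) 0 u := by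
    intro u hu
    have hm := hmem u hu
    have hAv : ∀ v, HasDerivAt (fun u => A u v) (fderiv ℝ X (γ u) (A u v)) u := fun v => by
      simpa using (hA u hu).clm_apply (hasDerivAt_const u v)
    have hT : HasDerivAt (fun u => fderiv ℝ θ (γ u))
        (fderiv ℝ (fderiv ℝ θ) (γ u) (X (γ u))) u :=
      HasFDerivAt.comp_hasDerivAt (𝕜 := ℝ) (F := F) (E := F →L[ℝ] F →L[ℝ] ℝ) (l := fderiv ℝ θ) u
        (hθ' _ hm) (hγ u hu)
    have h1 := ((hT.clm_apply (hAv v)).clm_apply (hAv w)).sub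
      ((hT.clm_apply (hAv w)).clm_apply (hAv v))
    refine h1.congr_deriv ?_
    have i1 := hid _ hm (A u v) (A u w)
    have i2 := hid _ hm (A u w) (A u v)
    rw [hsymm _ hm _ (X (γ u)), hsymm _ hm (A u v) (A u w)] at i1
    rw [hsymm _ hm _ (X (γ u))] at i2
    simp only [add_apply]
    linarith
  have h0 : (0 : ℝ) ∈ Ioo (-ε) ε := ⟨by linarith [hs.1, hs.2], by linarith [hs.1, hs.2]⟩
  have := (convex_Ioo (-ε) ε).is_const_of_fderivWithin_eq_zero (𝕜 := ℝ)
    (f := fun u => curl θ (γ u) (A u v) (A u w))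
    (fun u hu => (hder u hu).differentiableAt.differentiableWithinAt)
    (fun u hu => by
      rw [fderivWithin_of_isOpen isOpen_Ioo hu, (hder u hu).hasFDerivAt.fderiv]
      ext
      simp) hs h0
  simpa [hA0] using this

theorem ContinuousLinearMap.isInvertible_of_apply_one_ne_zero {L : ℝ →L[ℝ] ℝ} (h : L 1 ≠ 0) :
    L.IsInvertible := by
  refine ⟨ContinuousLinearEquiv.unitsEquivAut ℝ (Units.mk0 _ h), ?_⟩
  ext
  simp

/-- The implicit function theorem for the time at which a flow meets a transversal hypersurface. -/
theorem exists_hitTime [CompleteSpace F] {φ : ℝ × F → F} {h : F → ℝ} {e₀ X₀ : F} {n : ℕ∞ω}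
    (hn : n ≠ 0) (hφ : ContDiffAt ℝ n φ (0, e₀)) (hφ0 : φ (0, e₀) = e₀)
    (hX : HasDerivAt (fun s => φ (s, e₀)) X₀ 0) (hh : ContDiffAt ℝ n h e₀) (h0 : h e₀ = 0)
    (hne : fderiv ℝ h e₀ X₀ ≠ 0) :
    ∃ τ : F → ℝ, ContDiffAt ℝ n τ e₀ ∧ τ e₀ = 0 ∧ (∀ᶠ e in 𝓝 e₀, h (φ (τ e, e)) = 0) ∧
      ∀ᶠ q : ℝ × F in 𝓝 (0, e₀), h (φ q) = 0 → τ q.2 = q.1 := by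
  have hf : ContDiffAt ℝ n (fun p : F × ℝ => h (φ (p.2, p.1))) (e₀, 0) := by
    refine ContDiffAt.comp (e₀, (0 : ℝ)) (g := h) (by simpa [hφ0] using hh) ?_
    exact ContDiffAt.comp (e₀, (0 : ℝ)) (g := φ) hφ (contDiffAt_snd.prodMk contDiffAt_fst)
  have hinv : (fderiv ℝ (fun p : F × ℝ => h (φ (p.2, p.1))) (e₀, 0) ∘L
      ContinuousLinearMap.inr ℝ F ℝ).IsInvertible := by
    -- The time derivative of `h ∘ φ` at the base point is `dh(X₀)`, so transversality is exactly
    -- the invertibility needed.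
    refine ContinuousLinearMap.isInvertible_of_apply_one_ne_zero ?_
    have h1 : HasDerivAt (fun s : ℝ => (e₀, s)) ((0 : F), (1 : ℝ)) 0 :=
      (hasDerivAt_const _ _).prodMk (hasDerivAt_id _)
    have h2 := ((hf.differentiableAt hn).hasFDerivAt).comp_hasDerivAt (0 : ℝ) h1
    have hh' : HasFDerivAt h (fderiv ℝ h e₀) (φ (0, e₀)) := by
      rw [hφ0]
      exact (hh.differentiableAt hn).hasFDerivAt
    have h3 := hh'.comp_hasDerivAt (0 : ℝ) hX
    have h4 := h2.unique h3
    simpa [h4] using hne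
  refine ⟨hf.implicitFunction hn hinv, hf.contDiffAt_implicitFunction hn hinv,
    hf.implicitFunction_apply_self hn hinv, ?_, ?_⟩
  · filter_upwards [hf.eventually_apply_implicitFunction hn hinv] with e he
    simpa [hφ0, h0] using he
  · have hsw : Tendsto (fun q : ℝ × F => (q.2, q.1)) (𝓝 (0, e₀)) (𝓝 (e₀, 0)) :=
      (continuous_snd.prodMk continuous_fst).tendsto _
    filter_upwards [hsw.eventually (hf.eventually_apply_eq_iff_implicitFunction hn hinv)]
      with q hq hz
    exact hq.1 (by simpa [hφ0, h0] using hz)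

end Curl

/-! ### Maps that pull one bilinear form back to another. -/

section PullsBack

variable {F : Type*} [NormedAddCommGroup F] [NormedSpace ℝ F] {K : Type*} [TopologicalSpace K]
  {J : ModelWithCorners ℝ F K} {N : Type*} [TopologicalSpace N] [ChartedSpace K N]
  {F' : Type*} [NormedAddCommGroup F'] [NormedSpace ℝ F'] {K' : Type*} [TopologicalSpace K']
  {J' : ModelWithCorners ℝ F' K'} {N' : Type*} [TopologicalSpace N'] [ChartedSpace K' N']
  {F'' : Type*} [NormedAddCommGroup F''] [NormedSpace ℝ F''] {K'' : Type*} [TopologicalSpace K'']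
  {J'' : ModelWithCorners ℝ F'' K''} {N'' : Type*} [TopologicalSpace N''] [ChartedSpace K'' N'']

variable (J J') in
/-- `f` is differentiable at `z` and pulls the bilinear form `B'` back to `B` there. -/
def PullsBackAt (f : N → N') (B' : (z : N') → TangentSpace J' z → TangentSpace J' z → ℝ)
    (B : (z : N) → TangentSpace J z → TangentSpace J z → ℝ) (z : N) : Prop :=
  ∃ f' : TangentSpace J z →L[ℝ] TangentSpace J' (f z), HasMFDerivAt J J' f z f' ∧
    ∀ v w, B' (f z) (f' v) (f' w) = B z v w

variable {B : (z : N) → TangentSpace J z → TangentSpace J z → ℝ}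
  {B' : (z : N') → TangentSpace J' z → TangentSpace J' z → ℝ}
  {B'' : (z : N'') → TangentSpace J'' z → TangentSpace J'' z → ℝ}

theorem PullsBackAt.comp {f : N → N'} {g : N' → N''} {z : N}
    (hg : PullsBackAt J' J'' g B'' B' (f z)) (hf : PullsBackAt J J' f B' B z) :
    PullsBackAt J J'' (g ∘ f) B'' B z := by
  obtain ⟨f', hf', hfB⟩ := hf
  obtain ⟨g', hg', hgB⟩ := hg
  exact ⟨g' ∘L f', hg'.comp z hf', fun v w => (hgB _ _).trans (hfB v w)⟩

theorem PullsBackAt.continuousAt {f : N → N'} {z : N} (hf : PullsBackAt J J' f B' B z) :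
    ContinuousAt f z := by
  obtain ⟨f', hf', -⟩ := hf
  exact hf'.continuousAt

theorem PullsBackAt.mdifferentiableAt {f : N → N'} {z : N} (hf : PullsBackAt J J' f B' B z) :
    MDifferentiableAt J J' f z := by
  obtain ⟨f', hf', -⟩ := hf
  exact hf'.mdifferentiableAt

theorem PullsBackAt.apply_mfderiv {f : N → N'} {z : N} (hf : PullsBackAt J J' f B' B z)
    (v w : TangentSpace J z) : B' (f z) (mfderiv J J' f z v) (mfderiv J J' f z w) = B z v w := by
  obtain ⟨f', hf', hfB⟩ := hf
  rw [hf'.mfderiv]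
  exact hfB v w

theorem PullsBackAt.congr_of_eventuallyEq {f g : N → N'} {z : N}
    (hf : PullsBackAt J J' f B' B z) (h : g =ᶠ[nhds z] f) : PullsBackAt J J' g B' B z := by
  obtain ⟨f', hf', hfB⟩ := hf
  -- Stated for a free point `y`, because the type of the tangent vectors depends on the base point.
  have key : ∀ y, y = f z → ∀ v w, B' y (f' v) (f' w) = B z v w := by
    rintro _ rfl v w
    exact hfB v w
  exact ⟨f', hf'.congr_of_eventuallyEq h, key _ h.eq_of_nhds⟩

end PullsBack

/-! ### Forms and vector fields in charts. -/

section Charts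

open Metric Set Filter Topology

variable {F : Type*} [NormedAddCommGroup F] [NormedSpace ℝ F] {K : Type*} [TopologicalSpace K]
  {J : ModelWithCorners ℝ F K} {N : Type*} [TopologicalSpace N] [ChartedSpace K N]

variable (J) in
/-- The derivative of the preferred chart at `z₀`, with values in the model space. -/
def chartDeriv (z₀ z : N) : TangentSpace J z →L[ℝ] F :=
  mfderiv J 𝓘(ℝ, F) (extChartAt J z₀) z

variable (J) in
/-- The derivative of the inverse of the preferred chart at `z₀`. -/
def chartSymmDeriv (z₀ : N) (e : F) : F →L[ℝ] TangentSpace J ((extChartAt J z₀).symm e) :=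
  mfderiv 𝓘(ℝ, F) J (extChartAt J z₀).symm e

variable (J) in
/-- A field of covectors in the preferred chart at `z₀`. -/
def covectorInChart (θ : (z : N) → TangentSpace J z →L[ℝ] ℝ) (z₀ : N) (e : F) : F →L[ℝ] ℝ :=
  (θ ((extChartAt J z₀).symm e)) ∘L (chartSymmDeriv J z₀ e)

variable (J) in
/-- A vector field in the preferred chart at `z₀`. -/
def fieldInChart (X : (z : N) → TangentSpace J z) (z₀ : N) (e : F) : F :=
  chartDeriv J z₀ ((extChartAt J z₀).symm e) (X ((extChartAt J z₀).symm e))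

variable (J) in
/-- The exterior derivative of a field of covectors, as a field of bilinear forms. -/
def bilinOfCovector (θ : (z : N) → TangentSpace J z →L[ℝ] ℝ) (z : N) (v w : TangentSpace J z) : ℝ :=
  mextDerivOne J θ z ![v, w]

variable (J) in
/-- A field of covectors that is of class `C²` in charts. -/
def IsSmoothCovectorField (θ : (z : N) → TangentSpace J z →L[ℝ] ℝ) : Prop :=
  ∀ z₀, ContDiffOn ℝ 2 (covectorInChart J θ z₀) (extChartAt J z₀).target

variable (J) in
/-- A vector field that is of class `C²` in charts. -/
def IsSmoothVectorField (X : (z : N) → TangentSpace J z) : Prop :=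
  ∀ z₀, ContDiffOn ℝ 2 (fieldInChart J X z₀) (extChartAt J z₀).target

section C1

variable [IsManifold J 1 N]

theorem hasMFDerivAt_chart {z₀ z : N} (hz : z ∈ (extChartAt J z₀).source) :
    HasMFDerivAt J 𝓘(ℝ, F) (extChartAt J z₀) z (chartDeriv J z₀ z) :=
  (mdifferentiableAt_extChartAt (by simpa using hz)).hasMFDerivAt

variable [J.Boundaryless]

theorem hasMFDerivAt_chart_symm {z₀ : N} {e : F} (he : e ∈ (extChartAt J z₀).target) :
    HasMFDerivAt 𝓘(ℝ, F) J (extChartAt J z₀).symm e (chartSymmDeriv J z₀ e) := by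
  have h := mdifferentiableWithinAt_extChartAt_symm he
  rw [J.range_eq_univ, mdifferentiableWithinAt_univ] at h
  exact h.hasMFDerivAt

theorem chartDeriv_chartSymmDeriv {z₀ : N} {e : F} (he : e ∈ (extChartAt J z₀).target) (v : F) :
    chartDeriv J z₀ ((extChartAt J z₀).symm e) (chartSymmDeriv J z₀ e v) = v := by
  have h := mfderiv_extChartAt_comp_mfderivWithin_extChartAt_symm (I := J) he
  rw [J.range_eq_univ, mfderivWithin_univ] at h
  exact congrArg (fun L : F →L[ℝ] F => L v) h

theorem chartSymmDeriv_chartDeriv_symm {z₀ : N} {e : F} (he : e ∈ (extChartAt J z₀).target)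
    (v : TangentSpace J ((extChartAt J z₀).symm e)) :
    chartSymmDeriv J z₀ e (chartDeriv J z₀ ((extChartAt J z₀).symm e) v) = v := by
  have h := mfderivWithin_extChartAt_symm_comp_mfderiv_extChartAt (I := J) he
  rw [J.range_eq_univ, mfderivWithin_univ] at h
  exact congrArg (fun L : F →L[ℝ] F => L v) h

theorem chartDeriv_surjective {z₀ z : N} (hz : z ∈ (extChartAt J z₀).source) :
    Function.Surjective (chartDeriv J z₀ z) := by
  obtain ⟨e, he, rfl⟩ : ∃ e, e ∈ (extChartAt J z₀).target ∧ (extChartAt J z₀).symm e = z :=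
    ⟨_, (extChartAt J z₀).map_source hz, (extChartAt J z₀).left_inv hz⟩
  exact Function.RightInverse.surjective (chartDeriv_chartSymmDeriv he)

end C1

/-- Links the definition of `d` on the manifold to `curl`. The general chart is reached from this
one by a change of coordinates. -/
theorem mextDerivOne_apply_self [J.Boundaryless] {θ : (z : N) → TangentSpace J z →L[ℝ] ℝ} {z : N}
    (hθ : DifferentiableAt ℝ (covectorInChart J θ z) (extChartAt J z z)) (v w : TangentSpace J z) :
    mextDerivOne J θ z ![v, w] = curl (covectorInChart J θ z) (extChartAt J z z)
      (chartDeriv J z z v) (chartDeriv J z z w) := by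
  have hform : formInChart J (fun y => ContinuousAlternatingMap.ofSubsingleton ℝ
      (TangentSpace J y) ℝ (0 : Fin 1) (θ y)) z = fun e =>
      ContinuousAlternatingMap.ofSubsingleton ℝ F ℝ (0 : Fin 1) (covectorInChart J θ z e) := by
    funext e
    simp only [formInChart, covectorInChart, J.range_eq_univ, mfderivWithin_univ]
    rfl
  have hd : DifferentiableAt ℝ (fun e => ContinuousAlternatingMap.ofSubsingleton ℝ F ℝ (0 : Fin 1)
      (covectorInChart J θ z e)) (extChartAt J z z) :=
    (ContinuousAlternatingMap.ofSubsingletonLIE (𝕜 := ℝ) (E := F) (F := ℝ)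
      (0 : Fin 1)).differentiable.differentiableAt.comp _ hθ
  rw [mextDerivOne, mextDeriv, hform, J.range_eq_univ, extDerivWithin_univ]
  refine (extDeriv_apply hd (fun i => chartDeriv J z z (![v, w] i))).trans ?_
  have hc : ∀ u : F, fderiv ℝ (fun e => covectorInChart J θ z e u) (extChartAt J z z) =
      (fderiv ℝ (covectorInChart J θ z) (extChartAt J z z)).flip u := by
    intro u
    rw [fderiv_clm_apply hθ (differentiableAt_const u)]
    simp
  rw [Fin.sum_univ_two]
  simp only [ContinuousAlternatingMap.ofSubsingleton_apply_apply, Fin.removeNth, hc]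
  simp [curl, sub_eq_add_neg]

theorem contDiffAt_chart_change [J.Boundaryless] [IsManifold J 2 N] {z₀ z₁ : N} {e : F}
    (he : e ∈ (extChartAt J z₁).target) (he' : (extChartAt J z₁).symm e ∈ (extChartAt J z₀).source) :
    ContDiffAt ℝ 2 (extChartAt J z₀ ∘ (extChartAt J z₁).symm) e := by
  rw [← contMDiffAt_iff_contDiffAt]
  refine ContMDiffAt.comp e (contMDiffAt_extChartAt' (by simpa using he')) ?_
  exact (contMDiffOn_extChartAt_symm z₁).contMDiffAt ((isOpen_extChartAt_target z₁).mem_nhds he)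

theorem IsSmoothCovectorField.differentiableAt [J.Boundaryless]
    {θ : (z : N) → TangentSpace J z →L[ℝ] ℝ} (hθ : IsSmoothCovectorField J θ) {z₀ : N} {e : F}
    (he : e ∈ (extChartAt J z₀).target) : DifferentiableAt ℝ (covectorInChart J θ z₀) e :=
  ((hθ z₀).contDiffAt ((isOpen_extChartAt_target z₀).mem_nhds he)).differentiableAt (by simp)

theorem covectorInChart_apply_chartDeriv [J.Boundaryless] [IsManifold J 1 N]
    (θ : (z : N) → TangentSpace J z →L[ℝ] ℝ) {z₀ z : N}
    (hz : z ∈ (extChartAt J z₀).source) (v : TangentSpace J z) :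
    covectorInChart J θ z₀ (extChartAt J z₀ z) (chartDeriv J z₀ z v) = θ z v := by
  obtain ⟨e, he, rfl⟩ : ∃ e, e ∈ (extChartAt J z₀).target ∧ (extChartAt J z₀).symm e = z :=
    ⟨_, (extChartAt J z₀).map_source hz, (extChartAt J z₀).left_inv hz⟩
  rw [(extChartAt J z₀).right_inv he, covectorInChart, ContinuousLinearMap.comp_apply,
    chartSymmDeriv_chartDeriv_symm he]

/-- The exterior derivative of a one-form can be computed in any chart. -/
theorem bilinOfCovector_eq_curl [J.Boundaryless] [IsManifold J 2 N]
    {θ : (z : N) → TangentSpace J z →L[ℝ] ℝ} (hθ : IsSmoothCovectorField J θ) {z₀ z : N}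
    (hz : z ∈ (extChartAt J z₀).source) (v w : TangentSpace J z) :
    bilinOfCovector J θ z v w = curl (covectorInChart J θ z₀) (extChartAt J z₀ z)
      (chartDeriv J z₀ z v) (chartDeriv J z₀ z w) := by
  have : IsManifold J 1 N := IsManifold.of_le (n := 2) (by norm_num)
  have hzt : extChartAt J z z ∈ (extChartAt J z).target := mem_extChartAt_target z
  have hzz : (extChartAt J z).symm (extChartAt J z z) = z := extChartAt_to_inv z
  -- `mextDerivOne` is defined in the chart centred at `z`; the transition map `c` carries it to the
  -- chart at `z₀`.
  set c := extChartAt J z₀ ∘ (extChartAt J z).symm with hc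
  have hcz : c (extChartAt J z z) = extChartAt J z₀ z := by simp [hc]
  have hO : ∀ᶠ e in 𝓝 (extChartAt J z z), e ∈ (extChartAt J z).target ∧
      (extChartAt J z).symm e ∈ (extChartAt J z₀).source := by
    refine Filter.Eventually.and ((isOpen_extChartAt_target z).mem_nhds hzt) ?_
    exact (continuousAt_extChartAt_symm z).preimage_mem_nhds
      ((isOpen_extChartAt_source z₀).mem_nhds (by rwa [hzz]))
  have hder : ∀ e, e ∈ (extChartAt J z).target → (extChartAt J z).symm e ∈ (extChartAt J z₀).source →
      ∀ v : F, fderiv ℝ c e v = chartDeriv J z₀ ((extChartAt J z).symm e)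
        (chartSymmDeriv J z e v) := by
    intro e he he' v
    have h : HasMFDerivAt 𝓘(ℝ, F) 𝓘(ℝ, F) c e
        (chartDeriv J z₀ ((extChartAt J z).symm e) ∘L chartSymmDeriv J z e) :=
      (hasMFDerivAt_chart he').comp e (hasMFDerivAt_chart_symm he)
    have h' : HasFDerivAt c (chartDeriv J z₀ ((extChartAt J z).symm e) ∘L chartSymmDeriv J z e) e :=
      h.hasFDerivAt
    rw [h'.fderiv]
    rfl
  have heq : covectorInChart J θ z =ᶠ[𝓝 (extChartAt J z z)]
      fun e => covectorInChart J θ z₀ (c e) ∘L fderiv ℝ c e := by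
    filter_upwards [hO] with e he
    ext v
    rw [ContinuousLinearMap.comp_apply, hder e he.1 he.2]
    exact (covectorInChart_apply_chartDeriv θ he.2 _).symm
  have hcv : ∀ v : TangentSpace J z, fderiv ℝ c (extChartAt J z z) (chartDeriv J z z v) =
      chartDeriv J z₀ z v := by
    intro v
    rw [hder _ hzt (by rwa [hzz])]
    -- The point `(extChartAt J z).symm (extChartAt J z z)` equals `z` only propositionally, so
    -- tangent vectors at the two are compared as elements of `F`.
    have key : ∀ y, y = z → ∀ u : TangentSpace J y, (u : F) = (v : F) →
        chartDeriv J z₀ y u = chartDeriv J z₀ z v := by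
      rintro _ rfl u h
      exact congrArg _ h
    refine key _ hzz _ ?_
    have h := mfderivWithin_extChartAt_symm_comp_mfderiv_extChartAt' (I := J)
      (mem_extChartAt_source (I := J) z)
    rw [J.range_eq_univ, mfderivWithin_univ] at h
    exact congrArg (fun L : F →L[ℝ] F => L v) h
  rw [bilinOfCovector, mextDerivOne_apply_self (hθ.differentiableAt hzt), heq.curl_eq, curl_pullback,
    hcz, hcv, hcv]
  · rw [hcz]
    exact hθ.differentiableAt ((extChartAt J z₀).map_source hz)
  · exact contDiffAt_chart_change hzt (by rwa [hzz])

section PullsBackCharts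

variable [J.Boundaryless] [IsManifold J 2 N] {θ : (z : N) → TangentSpace J z →L[ℝ] ℝ}

variable (J) in
/-- The bilinear form `dθ` in the preferred chart at `z₀`. -/
def chartForm (θ : (z : N) → TangentSpace J z →L[ℝ] ℝ) (z₀ : N) (e : F)
    (v w : TangentSpace 𝓘(ℝ, F) e) : ℝ := curl (covectorInChart J θ z₀) e v w

theorem pullsBackAt_chart (hθ : IsSmoothCovectorField J θ) {z₀ z : N}
    (hz : z ∈ (extChartAt J z₀).source) :
    PullsBackAt J 𝓘(ℝ, F) (extChartAt J z₀) (chartForm J θ z₀) (bilinOfCovector J θ) z := by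
  have : IsManifold J 1 N := IsManifold.of_le (n := 2) (by norm_num)
  exact ⟨_, hasMFDerivAt_chart hz, fun v w => (bilinOfCovector_eq_curl hθ hz v w).symm⟩

theorem pullsBackAt_chart_symm (hθ : IsSmoothCovectorField J θ) {z₀ : N} {e : F}
    (he : e ∈ (extChartAt J z₀).target) :
    PullsBackAt 𝓘(ℝ, F) J (extChartAt J z₀).symm (bilinOfCovector J θ) (chartForm J θ z₀) e := by
  have : IsManifold J 1 N := IsManifold.of_le (n := 2) (by norm_num)
  have key : ∀ v w : F, bilinOfCovector J θ ((extChartAt J z₀).symm e) (chartSymmDeriv J z₀ e v)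
      (chartSymmDeriv J z₀ e w) = curl (covectorInChart J θ z₀) e v w := by
    intro v w
    rw [bilinOfCovector_eq_curl hθ ((extChartAt J z₀).map_target he),
      chartDeriv_chartSymmDeriv he, chartDeriv_chartSymmDeriv he, (extChartAt J z₀).right_inv he]
  exact ⟨_, hasMFDerivAt_chart_symm he, key⟩

theorem pullsBackAt_of_hasFDerivAt {f : F → F} {f' : F →L[ℝ] F} {e : F}
    {B B' : (e : F) → TangentSpace 𝓘(ℝ, F) e → TangentSpace 𝓘(ℝ, F) e → ℝ}
    (hf : HasFDerivAt f f' e) (h : ∀ v w : F, B' (f e) (f' v) (f' w) = B e v w) :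
    PullsBackAt 𝓘(ℝ, F) 𝓘(ℝ, F) f B' B e :=
  ⟨f', hf.hasMFDerivAt, h⟩

/-- A map that pulls `dθ` back to itself, assembled from its expression in charts. -/
theorem PullsBackAt.of_chart (hθ : IsSmoothCovectorField J θ) {z₀ z₁ z : N} {g : F → F}
    (hz : z ∈ (extChartAt J z₀).source) (hgz : g (extChartAt J z₀ z) ∈ (extChartAt J z₁).target)
    (hg : PullsBackAt 𝓘(ℝ, F) 𝓘(ℝ, F) g (chartForm J θ z₁) (chartForm J θ z₀) (extChartAt J z₀ z)) :
    PullsBackAt J J (fun y => (extChartAt J z₁).symm (g (extChartAt J z₀ y)))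
      (bilinOfCovector J θ) (bilinOfCovector J θ) z :=
  ((pullsBackAt_chart_symm hθ hgz).comp (f := g) hg).comp (f := extChartAt J z₀)
    (pullsBackAt_chart hθ hz)

end PullsBackCharts

end Charts

/-! ### Flow boxes of a vector field in the kernel of `dθ`. -/

section Steps

open Metric Set Filter Topology

variable {F : Type*} [NormedAddCommGroup F] [NormedSpace ℝ F] {K : Type*} [TopologicalSpace K]
  {J : ModelWithCorners ℝ F K} {N : Type*} [TopologicalSpace N] [ChartedSpace K N]

/-- A local flow of a vector field in the kernel of `dθ` pulls `dθ` back to the pullback of `dθ`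
by the projection to the space factor. -/
theorem IsLocalFlow.curl_fderiv {X : F → F} {x₀ : F} {R r ε : ℝ} {L : NNReal} {φ : ℝ × F → F}
    (hφ : IsLocalFlow X x₀ R r ε L φ) {θ : F → F →L[ℝ] ℝ} {B : Set F} (hB : IsOpen B)
    (hRB : ball x₀ R ⊆ B) (hθ : ContDiffOn ℝ 2 θ B) (hX : ContDiffOn ℝ 2 X B)
    (hker : ∀ y ∈ B, ∀ w, curl θ y (X y) w = 0) {s : ℝ} {x : F} (hs : s ∈ Ioo (-ε) ε)
    (hx : x ∈ ball x₀ r) (p q : ℝ × F) :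
    curl θ (φ (s, x)) (fderiv ℝ φ (s, x) p) (fderiv ℝ φ (s, x) q) = curl θ x p.2 q.2 := by
  have hflow : ∀ v w, curl θ (φ (s, x)) (fderiv ℝ (fun y => φ (s, y)) x v)
      (fderiv ℝ (fun y => φ (s, y)) x w) = curl θ x v w := by
    intro v w
    have := curl_flow hB hθ (hX.of_le (by norm_num)) hker (ε := ε) (γ := fun u => φ (u, x))
      (A := fun u => fderiv ℝ (fun y => φ (u, y)) x) (fun u hu => hRB (hφ.mem u hu x hx))
      (fun u hu => hφ.hasDerivAt u hu x hx) (fun u hu => hφ.hasDerivAt_fderiv u hu x hx)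
      (hφ.fderiv_zero hx) hs v w
    rwa [hφ.zero x hx] at this
  have hk : ∀ w, curl θ (φ (s, x)) (X (φ (s, x))) w = 0 := hker _ (hRB (hφ.mem s hs x hx))
  obtain ⟨a, v⟩ := p
  obtain ⟨b, w⟩ := q
  -- Both vectors split into a multiple of `X` and a spatial part; every term that contains `X`
  -- vanishes.
  rw [hφ.fderiv_apply hs hx, hφ.fderiv_apply hs hx, curl_add_left, curl_smul_left, hk,
    curl_swap, curl_add_left, curl_smul_left, hk, curl_swap, hflow]
  simp

/-- The standing assumptions on a vector field `X` in the kernel of `dθ`. -/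
structure IsCharacteristic (J : ModelWithCorners ℝ F K) {N : Type*} [TopologicalSpace N]
    [ChartedSpace K N] (θ : (z : N) → TangentSpace J z →L[ℝ] ℝ) (X : (z : N) → TangentSpace J z) :
    Prop where
  smooth_form : IsSmoothCovectorField J θ
  smooth_field : IsSmoothVectorField J X
  ker : ∀ z w, bilinOfCovector J θ z (X z) w = 0

variable {θ : (z : N) → TangentSpace J z →L[ℝ] ℝ} {X : (z : N) → TangentSpace J z}

theorem IsCharacteristic.curl_eq_zero [J.Boundaryless] [IsManifold J 2 N]
    (h : IsCharacteristic J θ X) (z₀ : N) {e : F} (he : e ∈ (extChartAt J z₀).target) (w : F) :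
    curl (covectorInChart J θ z₀) e (fieldInChart J X z₀ e) w = 0 := by
  have : IsManifold J 1 N := IsManifold.of_le (n := 2) (by norm_num)
  have h0 := h.ker ((extChartAt J z₀).symm e) (chartSymmDeriv J z₀ e w)
  rwa [bilinOfCovector_eq_curl h.smooth_form ((extChartAt J z₀).map_target he),
    chartDeriv_chartSymmDeriv he, (extChartAt J z₀).right_inv he] at h0

theorem IsMIntegralCurveOn.hasDerivWithinAt_chart [IsManifold J 1 N] {γ : ℝ → N} {s : Set ℝ} {z₀ : N}
    (hγ : IsMIntegralCurveOn γ X s) {t : ℝ} (ht : t ∈ s) (hz : γ t ∈ (extChartAt J z₀).source) :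
    HasDerivWithinAt (fun u => extChartAt J z₀ (γ u))
      (fieldInChart J X z₀ (extChartAt J z₀ (γ t))) s t := by
  have h := (hasMFDerivAt_chart hz).comp_hasMFDerivWithinAt t (hγ t ht)
  have key : fieldInChart J X z₀ (extChartAt J z₀ (γ t)) = chartDeriv J z₀ (γ t) (X (γ t)) := by
    rw [fieldInChart, (extChartAt J z₀).left_inv hz]
  have hL : (chartDeriv J z₀ (γ t) ∘L (ContinuousLinearMap.toSpanSingleton ℝ (X (γ t))) : ℝ →L[ℝ] F) =
      ContinuousLinearMap.toSpanSingleton ℝ (chartDeriv J z₀ (γ t) (X (γ t)) : F) := by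
    ext
    simp
  have h' : HasFDerivWithinAt (fun u => extChartAt J z₀ (γ u))
      (chartDeriv J z₀ (γ t) ∘L (ContinuousLinearMap.toSpanSingleton ℝ (X (γ t))) : ℝ →L[ℝ] F) s t :=
    h.hasFDerivWithinAt
  rw [key, hasDerivWithinAt_iff_hasFDerivWithinAt, ← hL]
  exact h'

theorem HasMFDerivAt.prodMk_normedSpace {F₁ F₂ : Type*} [NormedAddCommGroup F₁] [NormedSpace ℝ F₁]
    [NormedAddCommGroup F₂] [NormedSpace ℝ F₂] {f : N → F₁} {g : N → F₂} {z : N}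
    {f' : TangentSpace J z →L[ℝ] F₁} {g' : TangentSpace J z →L[ℝ] F₂}
    (hf : HasMFDerivAt J 𝓘(ℝ, F₁) f z f') (hg : HasMFDerivAt J 𝓘(ℝ, F₂) g z g') :
    HasMFDerivAt J 𝓘(ℝ, F₁ × F₂) (fun y => (f y, g y)) z (f'.prod g') :=
  ⟨hf.1.prodMk hg.1, HasFDerivWithinAt.prodMk hf.2 hg.2⟩

/-- The time shift `T` may depend on the point. This is essential: the time left after a reset
varies with the initial point. -/
theorem IsLocalFlow.pullsBackAt [J.Boundaryless] [IsManifold J 2 N]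
    (h : IsCharacteristic J θ X) {z₀ : N} {e₀ : F} {R r ε : ℝ}
    {L : NNReal} {φ : ℝ × F → F} (hφ : IsLocalFlow (fieldInChart J X z₀) e₀ R r ε L φ)
    (hR : ball e₀ R ⊆ (extChartAt J z₀).target)
    {F' : Type*} [NormedAddCommGroup F'] [NormedSpace ℝ F'] {K' : Type*} [TopologicalSpace K']
    {J' : ModelWithCorners ℝ F' K'} {N' : Type*} [TopologicalSpace N'] [ChartedSpace K' N']
    {B : (z : N') → TangentSpace J' z → TangentSpace J' z → ℝ} {T : N' → ℝ} {Q : N' → F} {y : N'}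
    (hT : MDifferentiableAt J' 𝓘(ℝ, ℝ) T y) (hQ : PullsBackAt J' 𝓘(ℝ, F) Q (chartForm J θ z₀) B y)
    (hTy : T y ∈ Ioo (-ε) ε) (hQy : Q y ∈ ball e₀ r) :
    PullsBackAt J' 𝓘(ℝ, F) (fun y => φ (T y, Q y)) (chartForm J θ z₀) B y := by
  obtain ⟨Q', hQ', hQB⟩ := hQ
  have h1 := HasMFDerivAt.prodMk_normedSpace hT.hasMFDerivAt hQ'
  have h2 := (hφ.differentiableAt hTy hQy).hasFDerivAt.hasMFDerivAt.comp y h1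
  refine ⟨_, h2, fun v w => ?_⟩
  exact (hφ.curl_fderiv (isOpen_extChartAt_target z₀) hR (h.smooth_form z₀) (h.smooth_field z₀)
    (fun e he w => h.curl_eq_zero z₀ he w) hTy hQy _ _).trans (hQB v w)

section Boxes

variable (J θ X)

/-- A flow box of `X`: an open set with a local flow that preserves `dθ`, also for time-shifts that
depend on the point. -/
structure FlowBox where
  dom : Set N
  radius : ℝ
  map : ℝ → N → N
  isOpen_dom : IsOpen dom
  radius_pos : 0 < radius
  pullsBackAt : ∀ {T : N → ℝ} {Q : N → N} {y : N}, MDifferentiableAt J 𝓘(ℝ, ℝ) T y →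
    PullsBackAt J J Q (bilinOfCovector J θ) (bilinOfCovector J θ) y → T y ∈ Ioo (-radius) radius →
    Q y ∈ dom →
    PullsBackAt J J (fun y => map (T y) (Q y)) (bilinOfCovector J θ) (bilinOfCovector J θ) y
  map_eq : ∀ {γ : ℝ → N} {a b : ℝ}, a ≤ b → b - a < radius → IsMIntegralCurveOn γ X (Icc a b) →
    (∀ s ∈ Icc a b, γ s ∈ dom) → map (b - a) (γ a) = γ b

/-- A partially defined map that takes a certain time and preserves `dθ`. -/
structure FlowStep where
  dom : Set N
  time : N → ℝ
  map : N → N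
  isOpen_dom : IsOpen dom
  mdifferentiableAt : ∀ y ∈ dom, MDifferentiableAt J 𝓘(ℝ, ℝ) time y
  pullsBackAt : ∀ y ∈ dom, PullsBackAt J J map (bilinOfCovector J θ) (bilinOfCovector J θ) y

/-- A local step that follows the field `X` until it hits `S` and then applies the reset `ρ`. -/
structure HitBox (S : Set N) (ρ : N → N) extends FlowStep J θ where
  radius : ℝ
  radius_pos : 0 < radius
  map_eq : ∀ {γ : ℝ → N} {a b : ℝ}, a ≤ b → b - a < radius → IsMIntegralCurveOn γ X (Icc a b) →
    (∀ s ∈ Icc a b, γ s ∈ dom) → γ b ∈ S → time (γ a) = b - a ∧ map (γ a) = ρ (γ b)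

end Boxes

theorem IsCharacteristic.exists_isLocalFlow [CompleteSpace F] [J.Boundaryless]
    (h : IsCharacteristic J θ X) (z₀ : N) :
    ∃ (R r ε : ℝ) (L : NNReal) (φ : ℝ × F → F), ball (extChartAt J z₀ z₀) R ⊆ (extChartAt J z₀).target ∧
      IsLocalFlow (fieldInChart J X z₀) (extChartAt J z₀ z₀) R r ε L φ :=
  _root_.exists_isLocalFlow ((h.smooth_field z₀).contDiffAt (extChartAt_target_mem_nhds z₀))
    (extChartAt_target_mem_nhds z₀)

theorem IsLocalFlow.eq_of_isMIntegralCurveOn [IsManifold J 1 N] {z₀ : N} {e₀ : F} {R r ε : ℝ}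
    {L : NNReal} {φ : ℝ × F → F} (hφ : IsLocalFlow (fieldInChart J X z₀) e₀ R r ε L φ)
    {γ : ℝ → N} {a b : ℝ} (hab : a ≤ b) (hba : b - a < ε) (hγ : IsMIntegralCurveOn γ X (Icc a b))
    (hsrc : ∀ s ∈ Icc a b, γ s ∈ (extChartAt J z₀).source)
    (hmem : ∀ s ∈ Icc a b, extChartAt J z₀ (γ s) ∈ ball e₀ r) :
    φ (b - a, extChartAt J z₀ (γ a)) = extChartAt J z₀ (γ b) :=
  hφ.eq_of_solution (c := fun u => extChartAt J z₀ (γ u)) hab hba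
    (fun s hs => hγ.hasDerivWithinAt_chart hs (hsrc s hs))
    (fun s hs => ball_subset_ball hφ.r_le (hmem s hs)) (hmem a (left_mem_Icc.2 hab))

theorem isOpen_chart_preimage (z₀ : N) {B : Set F} (hB : IsOpen B) :
    IsOpen ((extChartAt J z₀).source ∩ extChartAt J z₀ ⁻¹' B) :=
  (continuousOn_extChartAt z₀).isOpen_inter_preimage (isOpen_extChartAt_source z₀) hB

/-- The local flow of the field in the chart at `z₀`, transported back to the manifold. -/
theorem IsCharacteristic.exists_flowBox [CompleteSpace F] [J.Boundaryless] [IsManifold J 2 N]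
    (h : IsCharacteristic J θ X) (z₀ : N) : ∃ b : FlowBox J θ X, z₀ ∈ b.dom := by
  have : IsManifold J 1 N := IsManifold.of_le (n := 2) (by norm_num)
  obtain ⟨R, r, ε, L, φ, hR, hφ⟩ := h.exists_isLocalFlow z₀
  refine ⟨⟨_, ε, fun s y => (extChartAt J z₀).symm (φ (s, extChartAt J z₀ y)),
    isOpen_chart_preimage z₀ (isOpen_ball (x := extChartAt J z₀ z₀) (ε := r)), hφ.ε_pos, ?_, ?_⟩,
    mem_extChartAt_source z₀, mem_ball_self hφ.r_pos⟩
  · intro T Q y hT hQ hTy hQy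
    have h1 : PullsBackAt J 𝓘(ℝ, F) (fun y => extChartAt J z₀ (Q y)) (chartForm J θ z₀)
        (bilinOfCovector J θ) y := (pullsBackAt_chart h.smooth_form hQy.1).comp hQ
    have h2 := hφ.pullsBackAt h hR hT h1 hTy hQy.2
    exact (pullsBackAt_chart_symm h.smooth_form (hR (hφ.mem _ hTy _ hQy.2))).comp
      (f := fun y => φ (T y, extChartAt J z₀ (Q y))) h2
  · intro γ a b hab hba hγ hmem
    rw [hφ.eq_of_isMIntegralCurveOn hab hba hγ (fun s hs => (hmem s hs).1)
      (fun s hs => (hmem s hs).2), (extChartAt J z₀).left_inv (hmem b (right_mem_Icc.2 hab)).1]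

end Steps

/-! ### Retractions onto regular level sets. -/

section Retraction

open Filter Topology

variable {F : Type*} [NormedAddCommGroup F] [NormedSpace ℝ F]

/-- A regular level set has a local retraction. -/
theorem exists_retraction [CompleteSpace F] {h : F → ℝ} {e₀ ν : F} (hh : ContDiffAt ℝ 2 h e₀)
    (h0 : h e₀ = 0) (hν : fderiv ℝ h e₀ ν ≠ 0) :
    ∃ r : F → F, ContDiffAt ℝ 2 r e₀ ∧ r e₀ = e₀ ∧ (∀ᶠ e in 𝓝 e₀, h (r e) = 0) ∧
      ∀ᶠ e in 𝓝 e₀, h e = 0 → r e = e := by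
  -- Move along straight lines in direction `ν` until the level set is met.
  obtain ⟨τ, hτ, hτ0, hτh, hτu⟩ := exists_hitTime (φ := fun q : ℝ × F => q.2 + q.1 • ν) (e₀ := e₀)
    (X₀ := ν) (h := h) two_ne_zero (by fun_prop) (by simp)
    (by simpa using ((hasDerivAt_id (0 : ℝ)).smul_const ν).const_add e₀) hh h0 hν
  refine ⟨fun e => e + τ e • ν, contDiffAt_id.add (hτ.smul contDiffAt_const), by simp [hτ0], hτh, ?_⟩
  have hc : Tendsto (fun e : F => ((0 : ℝ), e)) (𝓝 e₀) (𝓝 (0, e₀)) :=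
    (Continuous.prodMk_right (0 : ℝ)).tendsto e₀
  filter_upwards [hc.eventually hτu] with e he h0
  simp [he (by simpa using h0)]

/-- If `R` and a retraction `r` pull two one-forms back to forms with the same differential, then
`R ∘ σ` acts like `σ` for each map `σ` into the fixed points of `r`. -/
theorem curl_comp_of_retraction {F₂ : Type*} [NormedAddCommGroup F₂] [NormedSpace ℝ F₂]
    {θ : F → F →L[ℝ] ℝ} {θ₂ : F₂ → F₂ →L[ℝ] ℝ} {r σ : F → F} {R : F → F₂} {e : F}
    (hσ : DifferentiableAt ℝ σ e) (hr : DifferentiableAt ℝ r (σ e)) (hR : DifferentiableAt ℝ R (σ e))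
    (hrσ : ∀ᶠ y in 𝓝 e, r (σ y) = σ y)
    (hpull : ∀ v w, curl θ₂ (R (σ e)) (fderiv ℝ R (σ e) v) (fderiv ℝ R (σ e) w) =
      curl θ (r (σ e)) (fderiv ℝ r (σ e) v) (fderiv ℝ r (σ e) w)) (v w : F) :
    curl θ₂ (R (σ e)) (fderiv ℝ (fun y => R (σ y)) e v) (fderiv ℝ (fun y => R (σ y)) e w) =
      curl θ (σ e) (fderiv ℝ σ e v) (fderiv ℝ σ e w) := by
  have h1 : HasFDerivAt (fun y => R (σ y)) (fderiv ℝ R (σ e) ∘L fderiv ℝ σ e) e :=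
    hR.hasFDerivAt.comp e hσ.hasFDerivAt
  have h2 : HasFDerivAt (fun y => r (σ y)) (fderiv ℝ r (σ e) ∘L fderiv ℝ σ e) e :=
    hr.hasFDerivAt.comp e hσ.hasFDerivAt
  -- Since `r ∘ σ = σ` near `e`, the factor `dr` may be inserted in front of `dσ`, and `hpull` then
  -- applies to vectors in the image of `dσ`. First derivatives of `σ` are enough.
  have h3 : fderiv ℝ σ e = fderiv ℝ r (σ e) ∘L fderiv ℝ σ e := by
    rw [← h2.fderiv]
    exact (Filter.EventuallyEq.fderiv_eq hrσ).symm
  rw [h1.fderiv, ContinuousLinearMap.comp_apply, ContinuousLinearMap.comp_apply, hpull,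
    hrσ.self_of_nhds, ← ContinuousLinearMap.comp_apply, ← ContinuousLinearMap.comp_apply, ← h3]

end Retraction

/-! ### Flowing to the guard and resetting. -/

section Hit

open Metric Set Filter Topology

variable {F : Type*} [NormedAddCommGroup F] [NormedSpace ℝ F] {K : Type*} [TopologicalSpace K]
  {J : ModelWithCorners ℝ F K} {N : Type*} [TopologicalSpace N] [ChartedSpace K N]

variable (J) in
/-- The part of the zero set of `g` where `g` increases along `X`. -/
def crossingSet (X : (z : N) → TangentSpace J z) (W : Set N) (g : N → ℝ) : Set N :=
  {z ∈ W | g z = 0 ∧ 0 < mvfderiv J g z (X z)}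

variable (J) in
/-- The reset `ρ` pulls the one-form `θ` back to its restriction to the crossing set of `g`. -/
structure IsActionReset (θ : (z : N) → TangentSpace J z →L[ℝ] ℝ) (X : (z : N) → TangentSpace J z)
    (W : Set N) (g : N → ℝ) (ρ : N → N) : Prop where
  isOpen : IsOpen W
  smooth_defining : ContMDiffOn J 𝓘(ℝ, ℝ) 2 g W
  smooth_reset : ContMDiffOn J J 2 ρ (crossingSet J X W g)
  action : ∀ z ∈ crossingSet J X W g, ∀ v : TangentSpace J z, mvfderiv J g z v = 0 →
    θ (ρ z) (mfderivWithin J J ρ (crossingSet J X W g) z v) = θ z v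

variable [J.Boundaryless] {θ : (z : N) → TangentSpace J z →L[ℝ] ℝ}
  {X : (z : N) → TangentSpace J z} {W : Set N} {g : N → ℝ} {ρ : N → N}

theorem IsActionReset.eventually_mem (hA : IsActionReset J θ X W g ρ) {z₀ : N} (hz₀ : z₀ ∈ W) :
    ∀ᶠ e in 𝓝 (extChartAt J z₀ z₀), e ∈ (extChartAt J z₀).target ∧ (extChartAt J z₀).symm e ∈ W := by
  refine Filter.Eventually.and (extChartAt_target_mem_nhds z₀) ?_
  refine (continuousAt_extChartAt_symm z₀).preimage_mem_nhds (hA.isOpen.mem_nhds ?_)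
  rwa [extChartAt_to_inv]

variable [IsManifold J 2 N]

theorem IsActionReset.contDiffAt_chart (hA : IsActionReset J θ X W g ρ) {z₀ : N} (hz₀ : z₀ ∈ W) :
    ContDiffAt ℝ 2 (fun e => g ((extChartAt J z₀).symm e)) (extChartAt J z₀ z₀) := by
  rw [← contMDiffAt_iff_contDiffAt]
  refine ContMDiffAt.comp_of_eq (y := z₀) (hA.smooth_defining.contMDiffAt (hA.isOpen.mem_nhds hz₀)) ?_
    (extChartAt_to_inv z₀)
  exact (contMDiffOn_extChartAt_symm z₀).contMDiffAt (extChartAt_target_mem_nhds z₀)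

theorem IsActionReset.fderiv_chart (hA : IsActionReset J θ X W g ρ) {z₀ : N} {e : F}
    (he : e ∈ (extChartAt J z₀).target) (heW : (extChartAt J z₀).symm e ∈ W) (v : F) :
    fderiv ℝ (fun e => g ((extChartAt J z₀).symm e)) e v =
      mvfderiv J g ((extChartAt J z₀).symm e) (chartSymmDeriv J z₀ e v) := by
  have : IsManifold J 1 N := IsManifold.of_le (n := 2) (by norm_num)
  have hg : MDifferentiableAt J 𝓘(ℝ, ℝ) g ((extChartAt J z₀).symm e) :=
    (hA.smooth_defining.contMDiffAt (hA.isOpen.mem_nhds heW)).mdifferentiableAt (by simp)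
  have h := hg.hasMFDerivAt.comp e (hasMFDerivAt_chart_symm he)
  have h' : HasFDerivAt (fun e => g ((extChartAt J z₀).symm e))
      (mvfderiv J g ((extChartAt J z₀).symm e) ∘L chartSymmDeriv J z₀ e) e := h.hasFDerivAt
  rw [h'.fderiv]
  rfl

theorem IsActionReset.fderiv_chart_field (hA : IsActionReset J θ X W g ρ) {z₀ : N} {e : F}
    (he : e ∈ (extChartAt J z₀).target) (heW : (extChartAt J z₀).symm e ∈ W) :
    fderiv ℝ (fun e => g ((extChartAt J z₀).symm e)) e (fieldInChart J X z₀ e) =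
      mvfderiv J g ((extChartAt J z₀).symm e) (X ((extChartAt J z₀).symm e)) := by
  have : IsManifold J 1 N := IsManifold.of_le (n := 2) (by norm_num)
  rw [hA.fderiv_chart he heW, fieldInChart, chartSymmDeriv_chartDeriv_symm he]

theorem IsActionReset.fderiv_chart_field_pos (hA : IsActionReset J θ X W g ρ) {z₀ : N}
    (hz₀ : z₀ ∈ crossingSet J X W g) :
    0 < fderiv ℝ (fun e => g ((extChartAt J z₀).symm e)) (extChartAt J z₀ z₀)
      (fieldInChart J X z₀ (extChartAt J z₀ z₀)) := by
  have hz : (extChartAt J z₀).symm (extChartAt J z₀ z₀) = z₀ := extChartAt_to_inv z₀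
  rw [hA.fderiv_chart_field (mem_extChartAt_target z₀) (by rw [hz]; exact hz₀.1), hz]
  exact hz₀.2.2

/-- Increase of `g` along `X` is an open condition, so near `z₀` the crossing set is the whole zero
set of `g`. -/
theorem IsActionReset.eventually_mem_crossingSet (hA : IsActionReset J θ X W g ρ)
    (hX : IsCharacteristic J θ X) {z₀ : N} (hz₀ : z₀ ∈ crossingSet J X W g) :
    ∀ᶠ e in 𝓝 (extChartAt J z₀ z₀), g ((extChartAt J z₀).symm e) = 0 →
      (extChartAt J z₀).symm e ∈ crossingSet J X W g := by
  have hc : ContinuousAt (fun e => fderiv ℝ (fun e => g ((extChartAt J z₀).symm e)) e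
      (fieldInChart J X z₀ e)) (extChartAt J z₀ z₀) :=
    ((hA.contDiffAt_chart hz₀.1).fderiv_right (m := 1) (by norm_num)).continuousAt.clm_apply
      ((hX.smooth_field z₀).contDiffAt (extChartAt_target_mem_nhds z₀)).continuousAt
  filter_upwards [hA.eventually_mem hz₀.1, hc.eventually_const_lt (hA.fderiv_chart_field_pos hz₀)]
    with e he hpos h0
  exact ⟨he.2, h0, by rwa [hA.fderiv_chart_field he.1 he.2] at hpos⟩

/-- Precomposed with a retraction onto the crossing set, a reset is of class `C²` in charts. -/
theorem IsActionReset.contDiffAt_reset (hA : IsActionReset J θ X W g ρ) {z₀ : N}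
    (hz₀ : z₀ ∈ crossingSet J X W g) {r : F → F} (hr : ContDiffAt ℝ 2 r (extChartAt J z₀ z₀))
    (hr0 : r (extChartAt J z₀ z₀) = extChartAt J z₀ z₀)
    (hrS : ∀ᶠ e in 𝓝 (extChartAt J z₀ z₀), (extChartAt J z₀).symm (r e) ∈ crossingSet J X W g) :
    ContMDiffAt 𝓘(ℝ, F) J 2 (fun e => ρ ((extChartAt J z₀).symm (r e))) (extChartAt J z₀ z₀) := by
  have h1 : ContMDiffAt 𝓘(ℝ, F) J 2 (fun e => (extChartAt J z₀).symm (r e)) (extChartAt J z₀ z₀) :=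
    ContMDiffAt.comp_of_eq (y := extChartAt J z₀ z₀)
      ((contMDiffOn_extChartAt_symm z₀).contMDiffAt (extChartAt_target_mem_nhds z₀))
      hr.contMDiffAt hr0
  have h2 := ContMDiffWithinAt.comp_of_eq (y := z₀) (hA.smooth_reset z₀ hz₀)
    (h1.contMDiffWithinAt (s := {e | (extChartAt J z₀).symm (r e) ∈ crossingSet J X W g}))
    (fun e he => he) (by rw [hr0]; exact extChartAt_to_inv z₀)
  exact h2.contMDiffAt hrS

/-- The action condition only concerns vectors tangent to the guard. The image of `dr` consists of
such vectors, so `ρ ∘ r` pulls `θ` back to `r^* θ` on a full neighbourhood, an identity that can be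
differentiated. -/
theorem IsActionReset.covectorInChart_reset (hA : IsActionReset J θ X W g ρ) {z₀ z₂ : N} {r : F → F}
    {e : F} (hr : DifferentiableAt ℝ r e)
    (hrt : r e ∈ (extChartAt J z₀).target)
    (hrS : ∀ᶠ e in 𝓝 e, (extChartAt J z₀).symm (r e) ∈ crossingSet J X W g)
    (hρ : ρ ((extChartAt J z₀).symm (r e)) ∈ (extChartAt J z₂).source) (v : F) :
    covectorInChart J θ z₂ (extChartAt J z₂ (ρ ((extChartAt J z₀).symm (r e))))
        (fderiv ℝ (fun e => extChartAt J z₂ (ρ ((extChartAt J z₀).symm (r e)))) e v) =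
      covectorInChart J θ z₀ (r e) (fderiv ℝ r e v) := by
  have : IsManifold J 1 N := IsManifold.of_le (n := 2) (by norm_num)
  set z := (extChartAt J z₀).symm (r e) with hz
  have hzS : z ∈ crossingSet J X W g := hrS.self_of_nhds
  have h1 : HasMFDerivAt 𝓘(ℝ, F) J (fun e => (extChartAt J z₀).symm (r e)) e
      (chartSymmDeriv J z₀ (r e) ∘L fderiv ℝ r e) :=
    (hasMFDerivAt_chart_symm hrt).comp e hr.hasFDerivAt.hasMFDerivAt
  have h2 : HasMFDerivWithinAt J J ρ (crossingSet J X W g) z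
      (mfderivWithin J J ρ (crossingSet J X W g) z) :=
    ((hA.smooth_reset z hzS).mdifferentiableWithinAt (by simp)).hasMFDerivWithinAt
  have h3 := (HasMFDerivWithinAt.comp e (u := crossingSet J X W g) h2
    (h1.hasMFDerivWithinAt (s := {e | (extChartAt J z₀).symm (r e) ∈ crossingSet J X W g}))
    (fun e he => he)).hasMFDerivAt hrS
  have h4 := (hasMFDerivAt_chart hρ).comp e h3
  have h5 : HasFDerivAt (fun e => extChartAt J z₂ (ρ ((extChartAt J z₀).symm (r e))))
      (chartDeriv J z₂ (ρ z) ∘L mfderivWithin J J ρ (crossingSet J X W g) z ∘L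
        chartSymmDeriv J z₀ (r e) ∘L fderiv ℝ r e) e := h4.hasFDerivAt
  -- `g ∘ r` vanishes identically near `e`: this is the tangency of `fderiv ℝ r e v` to the guard.
  have h6 : fderiv ℝ (fun e => g ((extChartAt J z₀).symm (r e))) e v = 0 := by
    have : (fun e => g ((extChartAt J z₀).symm (r e))) =ᶠ[𝓝 e] fun _ => 0 := by
      filter_upwards [hrS] with e he using he.2.1
    rw [this.fderiv_eq]
    simp
  have h7 : mvfderiv J g z (chartSymmDeriv J z₀ (r e) (fderiv ℝ r e v)) = 0 := by
    rw [← hA.fderiv_chart hrt hzS.1, ← h6]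
    have hg : MDifferentiableAt J 𝓘(ℝ, ℝ) g z :=
      (hA.smooth_defining.contMDiffAt (hA.isOpen.mem_nhds hzS.1)).mdifferentiableAt (by simp)
    have h := hg.hasMFDerivAt.comp (r e) (hasMFDerivAt_chart_symm hrt)
    have h' : DifferentiableAt ℝ (fun e => g ((extChartAt J z₀).symm e)) (r e) :=
      h.mdifferentiableAt.differentiableAt
    have h8 : HasFDerivAt (fun e => g ((extChartAt J z₀).symm (r e)))
        (fderiv ℝ (fun e => g ((extChartAt J z₀).symm e)) (r e) ∘L fderiv ℝ r e) e :=
      h'.hasFDerivAt.comp e hr.hasFDerivAt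
    rw [h8.fderiv]
    rfl
  rw [h5.fderiv]
  exact (covectorInChart_apply_chartDeriv θ hρ _).trans (hA.action z hzS _ h7)

/-- The reset extended by a retraction `r` has the same effect on `dθ` as `r`. -/
theorem IsActionReset.eventually_curl_reset (hA : IsActionReset J θ X W g ρ)
    (hX : IsCharacteristic J θ X) {z₀ : N} (hz₀ : z₀ ∈ crossingSet J X W g) {r : F → F}
    (hr : ContDiffAt ℝ 2 r (extChartAt J z₀ z₀))
    (hr0 : r (extChartAt J z₀ z₀) = extChartAt J z₀ z₀)
    (hrS : ∀ᶠ e in 𝓝 (extChartAt J z₀ z₀), (extChartAt J z₀).symm (r e) ∈ crossingSet J X W g) :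
    ∀ᶠ e in 𝓝 (extChartAt J z₀ z₀),
      ρ ((extChartAt J z₀).symm (r e)) ∈ (extChartAt J (ρ z₀)).source ∧
      DifferentiableAt ℝ (fun e => extChartAt J (ρ z₀) (ρ ((extChartAt J z₀).symm (r e)))) e ∧
      ∀ v w, curl (covectorInChart J θ (ρ z₀))
          (extChartAt J (ρ z₀) (ρ ((extChartAt J z₀).symm (r e))))
          (fderiv ℝ (fun e => extChartAt J (ρ z₀) (ρ ((extChartAt J z₀).symm (r e)))) e v)
          (fderiv ℝ (fun e => extChartAt J (ρ z₀) (ρ ((extChartAt J z₀).symm (r e)))) e w) =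
        curl (covectorInChart J θ z₀) (r e) (fderiv ℝ r e v) (fderiv ℝ r e w) := by
  have hG := hA.contDiffAt_reset hz₀ hr hr0 hrS
  have hG0 : ρ ((extChartAt J z₀).symm (r (extChartAt J z₀ z₀))) = ρ z₀ := by
    rw [hr0, extChartAt_to_inv]
  have hR : ContDiffAt ℝ 2 (fun e => extChartAt J (ρ z₀) (ρ ((extChartAt J z₀).symm (r e))))
      (extChartAt J z₀ z₀) := by
    rw [← contMDiffAt_iff_contDiffAt]
    exact ContMDiffAt.comp_of_eq contMDiffAt_extChartAt hG hG0
  have hsrc : ∀ᶠ e in 𝓝 (extChartAt J z₀ z₀),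
      ρ ((extChartAt J z₀).symm (r e)) ∈ (extChartAt J (ρ z₀)).source :=
    hG.continuousAt.preimage_mem_nhds (by rw [hG0]; exact extChartAt_source_mem_nhds _)
  have htgt : ∀ᶠ e in 𝓝 (extChartAt J z₀ z₀), r e ∈ (extChartAt J z₀).target :=
    hr.continuousAt.preimage_mem_nhds (by rw [hr0]; exact extChartAt_target_mem_nhds _)
  have hev := hsrc.and (htgt.and (hrS.and ((hr.eventually (by simp)).and (hR.eventually (by simp)))))
  -- The equality of one-forms must hold near `e`, not only at `e`, for their exterior derivatives
  -- to agree there.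
  filter_upwards [hev.eventually_nhds] with e he
  obtain ⟨h1, h2, h3, h4, h5⟩ := he.self_of_nhds
  refine ⟨h1, h5.differentiableAt (by simp), fun v w => ?_⟩
  rw [← curl_pullback (f := fun e => extChartAt J (ρ z₀) (ρ ((extChartAt J z₀).symm (r e))))
      (hX.smooth_form.differentiableAt ((extChartAt J (ρ z₀)).map_source h1)) h5,
    ← curl_pullback (hX.smooth_form.differentiableAt h2) h4]
  refine congrFun (congrFun (Filter.EventuallyEq.curl_eq ?_) v) w
  filter_upwards [he.eventually_nhds] with y hy
  obtain ⟨k1, k2, k3, k4, k5⟩ := hy.self_of_nhds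
  ext u
  exact hA.covectorInChart_reset (k4.differentiableAt (by simp)) k2 (hy.mono fun _ h => h.2.2.1) k1 u

/-- The step is `ρ ∘ r ∘ σ`, with `σ` the flow to the guard. The retraction `r` turns `ρ`, which is
smooth only along the guard, into a `C²` map on an open set and does nothing on the image of `σ`. As
`φ` and hence `σ` are only known to be `C¹`, `curl_pullback` is used for `r` and `ρ ∘ r`, while `dσ`
is treated by `curl_fderiv` and `curl_comp_of_retraction`. -/
theorem IsActionReset.exists_hitBox [CompleteSpace F] (hA : IsActionReset J θ X W g ρ)
    (hX : IsCharacteristic J θ X) {z₀ : N} (hz₀ : z₀ ∈ crossingSet J X W g) :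
    ∃ b : HitBox J θ X (crossingSet J X W g) ρ, z₀ ∈ b.dom := by
  have : IsManifold J 1 N := IsManifold.of_le (n := 2) (by norm_num)
  set χ := extChartAt J z₀ with hχ
  set e₀ := χ z₀ with he₀
  set g' : F → ℝ := fun e => g (χ.symm e) with hg'
  have hg2 : ContDiffAt ℝ 2 g' e₀ := hA.contDiffAt_chart hz₀.1
  have hg0 : g' e₀ = 0 := by
    rw [hg', he₀]
    simp only [hχ, extChartAt_to_inv]
    exact hz₀.2.1
  have hpos : 0 < fderiv ℝ g' e₀ (fieldInChart J X z₀ e₀) := hA.fderiv_chart_field_pos hz₀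
  obtain ⟨r, hr, hr0, hrg, hrfix⟩ := exists_retraction hg2 hg0 hpos.ne'
  have hS := hA.eventually_mem_crossingSet hX hz₀
  have hrS : ∀ᶠ e in 𝓝 e₀, χ.symm (r e) ∈ crossingSet J X W g := by
    have : Tendsto r (𝓝 e₀) (𝓝 e₀) := by
      have := hr.continuousAt.tendsto
      rwa [hr0] at this
    filter_upwards [this.eventually hS, hrg] with e h1 h2 using h1 h2
  have hcurl := hA.eventually_curl_reset hX hz₀ hr hr0 hrS
  obtain ⟨R, r₀, ε, L, φ, hR, hφ⟩ := hX.exists_isLocalFlow z₀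
  have hφ1 : ContDiffAt ℝ 1 φ (0, e₀) := hφ.contDiffOn.contDiffAt
    ((isOpen_Ioo.prod isOpen_ball).mem_nhds
      ⟨⟨neg_lt_zero.2 hφ.ε_pos, hφ.ε_pos⟩, mem_ball_self hφ.r_pos⟩)
  have hφ0 : φ (0, e₀) = e₀ := hφ.zero _ (mem_ball_self hφ.r_pos)
  have hφd : HasDerivAt (fun s => φ (s, e₀)) (fieldInChart J X z₀ e₀) 0 := by
    have := hφ.hasDerivAt 0 ⟨neg_lt_zero.2 hφ.ε_pos, hφ.ε_pos⟩ e₀ (mem_ball_self hφ.r_pos)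
    rwa [hφ0] at this
  obtain ⟨τ, hτ, hτ0, hτg, hτu⟩ := exists_hitTime one_ne_zero hφ1 hφ0 hφd (hg2.of_le (by norm_num))
    hg0 hpos.ne'
  -- `τ` may be negative: points just beyond the guard are taken back to it. This extends the step
  -- to a full neighbourhood, where it need not be part of an execution.
  set σ : F → F := fun e => φ (τ e, e) with hσ
  have hσ0 : σ e₀ = e₀ := by simp only [hσ, hτ0, hφ0]
  have hσ1 : ContDiffAt ℝ 1 σ e₀ :=
    ContDiffAt.comp e₀ (g := φ) (f := fun e => (τ e, e)) (by rwa [hτ0]) (hτ.prodMk contDiffAt_id)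
  have hσt : Tendsto σ (𝓝 e₀) (𝓝 e₀) := by
    have := hσ1.continuousAt.tendsto
    rwa [hσ0] at this
  have hτε : ∀ᶠ e in 𝓝 e₀, τ e ∈ Ioo (-ε) ε :=
    hτ.continuousAt.preimage_mem_nhds (by
      rw [hτ0]; exact isOpen_Ioo.mem_nhds ⟨neg_lt_zero.2 hφ.ε_pos, hφ.ε_pos⟩)
  have hrσ : ∀ᶠ e in 𝓝 e₀, r (σ e) = σ e := by
    filter_upwards [hσt.eventually hrfix, hτg] with e h1 h2 using h1 h2
  have hgood : ∀ᶠ e in 𝓝 e₀, (e ∈ ball e₀ r₀ ∧ τ e ∈ Ioo (-ε) ε) ∧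
      (∀ᶠ y in 𝓝 e, r (σ y) = σ y) ∧ (DifferentiableAt ℝ τ e ∧ DifferentiableAt ℝ σ e) ∧
      DifferentiableAt ℝ r (σ e) := by
    refine Filter.Eventually.and (Filter.Eventually.and (ball_mem_nhds _ hφ.r_pos) hτε)
      (hrσ.eventually_nhds.and (Filter.Eventually.and ?_ (hσt.eventually ?_)))
    · filter_upwards [hτ.eventually (by simp), hσ1.eventually (by simp)] with e h1 h2
      exact ⟨h1.differentiableAt (by simp), h2.differentiableAt (by simp)⟩
    · filter_upwards [hr.eventually (by simp)] with e h1 using h1.differentiableAt (by simp)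
  obtain ⟨δ, hδ, hball⟩ := Metric.eventually_nhds_iff_ball.1
    (hgood.and ((hσt.eventually hcurl).and (hcurl.and hrfix)))
  obtain ⟨δ', hδ', hball'⟩ := Metric.eventually_nhds_iff_ball.1 hτu
  set B := ball e₀ (min δ δ') with hB
  have hBδ : B ⊆ ball e₀ δ := ball_subset_ball (min_le_left _ _)
  refine ⟨⟨⟨χ.source ∩ χ ⁻¹' B, fun y => τ (χ y), fun y => (extChartAt J (ρ z₀)).symm
      (extChartAt J (ρ z₀) (ρ (χ.symm (r (σ (χ y)))))), isOpen_chart_preimage z₀ isOpen_ball, ?_, ?_⟩,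
    min ε δ', lt_min hφ.ε_pos hδ', ?_⟩, mem_extChartAt_source z₀, mem_ball_self (lt_min hδ hδ')⟩
  · rintro y ⟨hy, hyB⟩
    have h1 := (hball _ (hBδ hyB)).1.2.2.1.1
    exact (h1.hasFDerivAt.hasMFDerivAt.comp y (hasMFDerivAt_chart hy)).mdifferentiableAt
  · rintro y ⟨hy, hyB⟩
    obtain ⟨⟨⟨h1, h2⟩, h3, ⟨h4, h5⟩, h6⟩, ⟨h7, h8, h9⟩, -⟩ := hball _ (hBδ hyB)
    refine PullsBackAt.of_chart (z₁ := ρ z₀) hX.smooth_form hy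
      (g := fun e => extChartAt J (ρ z₀) (ρ (χ.symm (r (σ e)))))
      ((extChartAt J (ρ z₀)).map_source h7) ?_
    refine pullsBackAt_of_hasFDerivAt (DifferentiableAt.hasFDerivAt (h8.comp (χ y) h5))
      fun v w => ?_
    refine (curl_comp_of_retraction h5 h6 h8 h3 h9 v w).trans ?_
    -- The vectors `(dτ v, v)` are the derivatives of `e ↦ (τ e, e)`; their time components do not
    -- matter.
    have hk := hφ.curl_fderiv (isOpen_extChartAt_target z₀) hR (hX.smooth_form z₀)
      (hX.smooth_field z₀) (fun e he w => hX.curl_eq_zero z₀ he w) h2 h1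
      (fderiv ℝ τ (χ y) v, v) (fderiv ℝ τ (χ y) w, w)
    have hd : HasFDerivAt σ (fderiv ℝ φ (τ (χ y), χ y) ∘L
        (fderiv ℝ τ (χ y)).prod (ContinuousLinearMap.id ℝ F)) (χ y) :=
      HasFDerivAt.comp (χ y) (f := fun e => (τ e, e)) (hφ.differentiableAt h2 h1).hasFDerivAt
        (h4.hasFDerivAt.prodMk (hasFDerivAt_id _))
    rw [hd.fderiv]
    exact hk
  · intro γ a b hab hba hγ hmem hγS
    have ha := hmem a (left_mem_Icc.2 hab)
    have hb := hmem b (right_mem_Icc.2 hab)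
    have hflow := hφ.eq_of_isMIntegralCurveOn hab (hba.trans_le (min_le_left _ _)) hγ
      (fun s hs => (hmem s hs).1) (fun s hs => (hball _ (hBδ (hmem s hs).2)).1.1.1)
    have hgb : g' (χ (γ b)) = 0 := by
      rw [hg']
      simp only [χ.left_inv hb.1]
      exact hγS.2.1
    have hq : ((b - a, χ (γ a)) : ℝ × F) ∈ ball ((0 : ℝ), e₀) δ' := by
      rw [← ball_prod_same]
      refine ⟨?_, ball_subset_ball (min_le_right _ _) ha.2⟩
      rw [Real.ball_eq_Ioo]
      exact ⟨by linarith, by linarith [hba.trans_le (min_le_right _ _)]⟩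
    -- Local uniqueness in the implicit function theorem: `γ` reaches the guard after time `b - a`,
    -- so that is the hitting time.
    have hτa : τ (χ (γ a)) = b - a := hball' _ hq (by rw [hflow]; exact hgb)
    refine ⟨hτa, ?_⟩
    obtain ⟨-, -, ⟨h7, -⟩, h8⟩ := hball _ (hBδ hb.2)
    simp only [hσ, hτa]
    rw [hflow, (extChartAt J (ρ z₀)).left_inv h7, h8 hgb, χ.left_inv hb.1]

end Hit

/-! ### Executions as words in countably many local steps. -/

section Words

open Metric Set Filter Topology

variable {F : Type*} [NormedAddCommGroup F] [NormedSpace ℝ F] {K : Type*} [TopologicalSpace K]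
  {J : ModelWithCorners ℝ F K} {N : Type*} [TopologicalSpace N] [ChartedSpace K N]
  {θ : (z : N) → TangentSpace J z →L[ℝ] ℝ} {X : (z : N) → TangentSpace J z} {S : Set N} {ρ : N → N}

variable (J θ) in
/-- The step that does nothing. -/
def FlowStep.refl : FlowStep J θ where
  dom := univ
  time _ := 0
  map := id
  isOpen_dom := isOpen_univ
  mdifferentiableAt _ _ := mdifferentiableAt_const
  pullsBackAt _ _ := ⟨_, hasMFDerivAt_id _, fun _ _ => rfl⟩

/-- One step after the other. -/
def FlowStep.trans (s₁ s₂ : FlowStep J θ) : FlowStep J θ where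
  dom := s₁.dom ∩ s₁.map ⁻¹' s₂.dom
  time y := s₁.time y + s₂.time (s₁.map y)
  map := s₂.map ∘ s₁.map
  isOpen_dom := by
    refine ContinuousOn.isOpen_inter_preimage (fun y hy => ?_) s₁.isOpen_dom s₂.isOpen_dom
    exact (s₁.pullsBackAt y hy).continuousAt.continuousWithinAt
  mdifferentiableAt y hy := (s₁.mdifferentiableAt y hy.1).add
    ((s₂.mdifferentiableAt _ hy.2).comp y (s₁.pullsBackAt y hy.1).mdifferentiableAt)
  pullsBackAt y hy := (s₂.pullsBackAt _ hy.2).comp (s₁.pullsBackAt y hy.1)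

/-- The flow of a flow box for a fixed time. -/
def FlowBox.step (b : FlowBox J θ X) (q : ℝ) : FlowStep J θ where
  dom := b.dom ∩ {_y | q ∈ Ioo (-b.radius) b.radius}
  time _ := q
  map := b.map q
  isOpen_dom := b.isOpen_dom.inter isOpen_const
  mdifferentiableAt _ _ := mdifferentiableAt_const
  pullsBackAt _ hy := b.pullsBackAt (T := fun _ => q) (Q := id) mdifferentiableAt_const
    ⟨_, hasMFDerivAt_id _, fun _ _ => rfl⟩ hy.2 hy.1

variable {β κ : Type*} (b : β → FlowBox J θ X) (k : κ → HitBox J θ X S ρ)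

/-- The letters of words of local steps. -/
def letterStep : (β × ℚ) ⊕ κ → FlowStep J θ
  | .inl p => (b p.1).step p.2
  | .inr j => (k j).toFlowStep

/-- The composition of a word of local steps. -/
def wordStep : List ((β × ℚ) ⊕ κ) → FlowStep J θ
  | [] => FlowStep.refl J θ
  | i :: l => (letterStep b k i).trans (wordStep l)

variable {b k}

theorem mem_dom_wordStep_append {l₁ l₂ : List ((β × ℚ) ⊕ κ)} {y : N}
    (h₁ : y ∈ (wordStep b k l₁).dom) (h₂ : (wordStep b k l₁).map y ∈ (wordStep b k l₂).dom) :
    y ∈ (wordStep b k (l₁ ++ l₂)).dom := by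
  induction l₁ generalizing y with
  | nil => exact h₂
  | cons i l ih => exact ⟨h₁.1, ih h₁.2 h₂⟩

theorem map_wordStep_append (l₁ l₂ : List ((β × ℚ) ⊕ κ)) (y : N) :
    (wordStep b k (l₁ ++ l₂)).map y = (wordStep b k l₂).map ((wordStep b k l₁).map y) := by
  induction l₁ generalizing y with
  | nil => rfl
  | cons i l ih => exact ih _

theorem time_wordStep_append (l₁ l₂ : List ((β × ℚ) ⊕ κ)) (y : N) :
    (wordStep b k (l₁ ++ l₂)).time y =
      (wordStep b k l₁).time y + (wordStep b k l₂).time ((wordStep b k l₁).map y) := by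
  induction l₁ generalizing y with
  | nil => exact (zero_add _).symm
  | cons i l ih => exact (congrArg _ (ih _)).trans (add_assoc _ _ _).symm

theorem mem_dom_wordStep_singleton {i : (β × ℚ) ⊕ κ} {y : N} :
    y ∈ (wordStep b k [i]).dom ↔ y ∈ (letterStep b k i).dom := by
  simp [wordStep, FlowStep.trans, FlowStep.refl]

theorem map_wordStep_singleton (i : (β × ℚ) ⊕ κ) (y : N) :
    (wordStep b k [i]).map y = (letterStep b k i).map y := rfl

theorem time_wordStep_singleton (i : (β × ℚ) ⊕ κ) (y : N) :
    (wordStep b k [i]).time y = (letterStep b k i).time y := by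
  simp [wordStep, FlowStep.trans, FlowStep.refl]

variable (b k) in
/-- The word `l` leads from `y` to `w` in time `t`. -/
structure WordLeads (l : List ((β × ℚ) ⊕ κ)) (t : ℝ) (y w : N) : Prop where
  mem : y ∈ (wordStep b k l).dom
  time_eq : (wordStep b k l).time y = t
  map_eq : (wordStep b k l).map y = w

theorem WordLeads.append {l₁ l₂ : List ((β × ℚ) ⊕ κ)} {t₁ t₂ : ℝ} {y₁ y₂ y₃ : N}
    (h₁ : WordLeads b k l₁ t₁ y₁ y₂) (h₂ : WordLeads b k l₂ t₂ y₂ y₃) :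
    WordLeads b k (l₁ ++ l₂) (t₁ + t₂) y₁ y₃ := by
  obtain ⟨m₁, rfl, rfl⟩ := h₁
  obtain ⟨m₂, rfl, rfl⟩ := h₂
  exact ⟨mem_dom_wordStep_append m₁ m₂, time_wordStep_append _ _ _, map_wordStep_append _ _ _⟩

theorem WordLeads.singleton {i : (β × ℚ) ⊕ κ} {y : N} (h : y ∈ (letterStep b k i).dom) :
    WordLeads b k [i] ((letterStep b k i).time y) y ((letterStep b k i).map y) :=
  ⟨mem_dom_wordStep_singleton.2 h, time_wordStep_singleton i y, map_wordStep_singleton i y⟩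

theorem ContinuousOn.exists_forall_abs_sub_lt {γ : ℝ → N} {a c : ℝ} {s : Set ℝ} {O : Set N}
    (hγ : ContinuousOn γ s) (hc : c ∈ s) (hO : IsOpen O) (hcO : γ c ∈ O) (ha : 0 < a) :
    ∃ δ, 0 < δ ∧ δ ≤ a ∧ ∀ u ∈ s, |u - c| < δ → γ u ∈ O := by
  obtain ⟨δ, hδ, h⟩ := Metric.mem_nhdsWithin_iff.1 ((hγ c hc).preimage_mem_nhdsWithin
    (hO.mem_nhds hcO))
  exact ⟨min δ a, lt_min hδ ha, min_le_right _ _,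
    fun u hu huc => h ⟨mem_ball_iff_norm.2 (huc.trans_le (min_le_left _ _)), hu⟩⟩

/-- A word leads along an integral curve arbitrarily close to its end. -/
theorem exists_wordLeads_of_isMIntegralCurveOn (hb : ∀ z, ∃ i, z ∈ (b i).dom) {γ : ℝ → N} {t δ : ℝ}
    (ht : 0 ≤ t) (hγ : IsMIntegralCurveOn γ X (Icc 0 t)) (hδ : 0 < δ) :
    ∃ l, ∃ c ∈ Icc 0 t, t - c < δ ∧ WordLeads b k l c (γ 0) (γ c) := by
  -- Flow letters last a rational time, so `t` itself may be missing from `A`; only `sSup A = t` is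
  -- claimed. The remaining time is left to a final flow or hit box.
  set A : Set ℝ := {c ∈ Icc 0 t | ∃ l, WordLeads b k l c (γ 0) (γ c)} with hA
  have h0 : (0 : ℝ) ∈ A := ⟨left_mem_Icc.2 ht, [], mem_univ _, rfl, rfl⟩
  have hbdd : BddAbove A := ⟨t, fun c hc => hc.1.2⟩
  have hs0 : 0 ≤ sSup A := le_csSup hbdd h0
  have hst : sSup A ≤ t := csSup_le ⟨0, h0⟩ fun c hc => hc.1.2
  have hsup : sSup A = t := by
    by_contra hne
    have hlt : sSup A < t := lt_of_le_of_ne hst hne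
    obtain ⟨i, hi⟩ := hb (γ (sSup A))
    obtain ⟨η, hη, hηr, hηO⟩ := hγ.continuousOn.exists_forall_abs_sub_lt ⟨hs0, hst⟩
      (b i).isOpen_dom hi (b i).radius_pos
    obtain ⟨c, hcA, hcs⟩ := exists_lt_of_lt_csSup ⟨0, h0⟩ (show sSup A - η / 2 < sSup A by linarith)
    have hcle : c ≤ sSup A := le_csSup hbdd hcA
    -- A rational step that starts at some `c ∈ A` near the supremum, passes beyond it, and stays
    -- before `t` and inside the flow box.
    obtain ⟨q, hq1, hq2⟩ := exists_rat_btwn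
      (show sSup A - c < min (t - c) (sSup A - c + η / 2) from
        lt_min (by linarith) (by linarith))
    have hq3 := hq2.trans_le (min_le_left _ _)
    have hq4 := hq2.trans_le (min_le_right _ _)
    have hc0 : 0 ≤ c := hcA.1.1
    have hsub : Icc c (c + q) ⊆ Icc 0 t := Icc_subset_Icc hc0 (by linarith)
    have hO : ∀ s ∈ Icc c (c + (q : ℝ)), γ s ∈ (b i).dom := fun s hs =>
      hηO s (hsub hs) (by rw [abs_lt]; constructor <;> linarith [hs.1, hs.2])
    have hqpos : (0 : ℝ) ≤ q := by linarith
    have hmap := (b i).map_eq (by linarith) (by linarith) (hγ.mono hsub) hO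
    rw [add_sub_cancel_left] at hmap
    obtain ⟨l, hl⟩ := hcA.2
    have hstep : WordLeads b k [.inl (i, q)] q (γ c) (γ (c + q)) := by
      have h1 : γ c ∈ (letterStep b k (.inl (i, q))).dom :=
        ⟨hO c (left_mem_Icc.2 (by linarith)), by
          constructor <;> dsimp only <;> linarith [(b i).radius_pos]⟩
      have h2 := WordLeads.singleton h1
      simp only [letterStep, FlowBox.step, hmap] at h2
      exact h2
    have hmem : c + q ∈ A := ⟨⟨by linarith, by linarith⟩, _, hl.append hstep⟩
    linarith [le_csSup hbdd hmem]
  obtain ⟨c, hcA, hcs⟩ := exists_lt_of_lt_csSup ⟨0, h0⟩ (show t - δ < sSup A by linarith)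
  obtain ⟨l, hl⟩ := hcA.2
  exact ⟨l, c, hcA.1, by linarith, hl⟩

/-- The same, with the last piece of the curve in a prescribed neighbourhood of its end. -/
theorem exists_wordLeads_of_isOpen (hb : ∀ z, ∃ i, z ∈ (b i).dom) {γ : ℝ → N} {t δ : ℝ} {O : Set N}
    (ht : 0 ≤ t) (hγ : IsMIntegralCurveOn γ X (Icc 0 t)) (hδ : 0 < δ) (hO : IsOpen O)
    (htO : γ t ∈ O) :
    ∃ l, ∃ c ∈ Icc 0 t, t - c < δ ∧ (∀ s ∈ Icc c t, γ s ∈ O) ∧ WordLeads b k l c (γ 0) (γ c) := by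
  obtain ⟨η, hη, hηδ, hηO⟩ := hγ.continuousOn.exists_forall_abs_sub_lt (right_mem_Icc.2 ht) hO htO hδ
  obtain ⟨l, c, hc, hct, hl⟩ := exists_wordLeads_of_isMIntegralCurveOn (k := k) hb ht hγ hη
  refine ⟨l, c, hc, hct.trans_le hηδ, fun s hs => hηO s ⟨hc.1.trans hs.1, hs.2⟩ ?_, hl⟩
  rw [abs_lt]
  constructor <;> linarith [hs.1, hs.2]

variable (b k) in
/-- The points where a word followed by a flow box can be run for time `t`. -/
def wordFlowDom (l : List ((β × ℚ) ⊕ κ)) (i : β) (t : ℝ) : Set N :=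
  {y ∈ (wordStep b k l).dom | (wordStep b k l).map y ∈ (b i).dom ∧
    t - (wordStep b k l).time y ∈ Ioo (-(b i).radius) (b i).radius}

variable (b k) in
/-- A word followed by a flow box, run for total time `t`. -/
def wordFlow (l : List ((β × ℚ) ⊕ κ)) (i : β) (t : ℝ) (y : N) : N :=
  (b i).map (t - (wordStep b k l).time y) ((wordStep b k l).map y)

theorem isOpen_wordFlowDom (l : List ((β × ℚ) ⊕ κ)) (i : β) (t : ℝ) :
    IsOpen (wordFlowDom b k l i t) := by
  have h1 : ContinuousOn (fun y => ((wordStep b k l).map y, t - (wordStep b k l).time y))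
      (wordStep b k l).dom := fun y hy =>
    ContinuousAt.continuousWithinAt (((wordStep b k l).pullsBackAt y hy).continuousAt.prodMk
      (continuousAt_const.sub ((wordStep b k l).mdifferentiableAt y hy).continuousAt))
  exact h1.isOpen_inter_preimage (wordStep b k l).isOpen_dom ((b i).isOpen_dom.prod isOpen_Ioo)

theorem pullsBackAt_wordFlow {l : List ((β × ℚ) ⊕ κ)} {i : β} {t : ℝ} {y : N}
    (hy : y ∈ wordFlowDom b k l i t) :
    PullsBackAt J J (wordFlow b k l i t) (bilinOfCovector J θ) (bilinOfCovector J θ) y :=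
  (b i).pullsBackAt (T := fun y => t - (wordStep b k l).time y) (Q := (wordStep b k l).map)
    (mdifferentiableAt_const.sub ((wordStep b k l).mdifferentiableAt y hy.1))
    ((wordStep b k l).pullsBackAt y hy.1) hy.2.2 hy.2.1

/-- Every execution is, locally, one of the countably many words followed by a flow box. -/
theorem HybridSystem.Reaches.exists_wordFlow_eq {Y : HybridSystem J N} {b : β → FlowBox J θ Y.field}
    {k : κ → HitBox J θ Y.field Y.guard Y.reset} (hb : ∀ z, ∃ i, z ∈ (b i).dom)
    (hk : ∀ z ∈ Y.guard, ∃ j, z ∈ (k j).dom) {t : ℝ} {y w : N} (h : Y.Reaches t y w) :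
    ∃ l i, y ∈ wordFlowDom b k l i t ∧ wordFlow b k l i t y = w := by
  induction h with
  | flow t γ ht hγ hS =>
    obtain ⟨i, hi⟩ := hb (γ t)
    obtain ⟨l, c, hc, hct, hO, hl⟩ := exists_wordLeads_of_isOpen (k := k) hb ht hγ (b i).radius_pos
      (b i).isOpen_dom hi
    have hmap := (b i).map_eq hc.2 hct (hγ.mono (Icc_subset_Icc_left hc.1)) hO
    refine ⟨l, i, ⟨hl.mem, ?_, ?_⟩, ?_⟩
    · rw [hl.map_eq]
      exact hO c (left_mem_Icc.2 hc.2)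
    · rw [hl.time_eq]
      exact ⟨by linarith [hc.2, (b i).radius_pos], hct⟩
    · rw [wordFlow, hl.time_eq, hl.map_eq, hmap]
  | reset τ t γ w hτ ht hγ hS hτS hw ih =>
    obtain ⟨l', i, ⟨hm1, hm2, hm3⟩, hw'⟩ := ih
    -- A hit box at the guard point covers the last stretch `τ - c` and the reset; its duration
    -- depends on the point and is not restricted to rationals.
    obtain ⟨j, hj⟩ := hk _ hτS
    obtain ⟨l, c, hc, hct, hO, hl⟩ := exists_wordLeads_of_isOpen (k := k) hb hτ hγ (k j).radius_pos
      (k j).isOpen_dom hj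
    obtain ⟨h1, h2⟩ := (k j).map_eq hc.2 hct (hγ.mono (Icc_subset_Icc_left hc.1)) hO hτS
    have hstep : WordLeads b k [.inr j] (τ - c) (γ c) (Y.reset (γ τ)) := by
      rw [← h1, ← h2]
      exact WordLeads.singleton (i := .inr j) (hO c (left_mem_Icc.2 hc.2))
    have hrest : WordLeads b k l' ((wordStep b k l').time (Y.reset (γ τ))) (Y.reset (γ τ))
      ((wordStep b k l').map (Y.reset (γ τ))) := ⟨hm1, rfl, rfl⟩
    have hall := (hl.append hstep).append hrest
    have htime : τ + t - (c + (τ - c) + (wordStep b k l').time (Y.reset (γ τ))) =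
        t - (wordStep b k l').time (Y.reset (γ τ)) := by ring
    refine ⟨_, i, ⟨hall.mem, ?_, ?_⟩, ?_⟩
    · rwa [hall.map_eq]
    · rwa [hall.time_eq, htime]
    · rwa [wordFlow, hall.time_eq, hall.map_eq, htime]

end Words

/-! ### A Baire category argument for coincidence sets. -/

section Baire

open Set Filter Topology

/-- If countably many relatively closed sets cover an open set, then near each of its points some of
them is a neighbourhood of some point. -/
theorem frequently_exists_mem_nhds {N ι : Type*} [TopologicalSpace N] [BaireSpace N] [Countable ι]
    {U : Set N} (hU : IsOpen U) {E O : ι → Set N} (hO : ∀ i, IsOpen (O i)) (hEO : ∀ i, E i ⊆ O i)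
    (hE : ∀ i, closure (E i) ∩ O i ⊆ E i) (hcov : U ⊆ ⋃ i, E i) {x : N} (hx : x ∈ U) :
    ∃ᶠ y in 𝓝 x, ∃ i, E i ∈ 𝓝 y := by
  -- The closures of the `E i`, with the complement of `U` added as index `none`, cover the whole
  -- space.
  have hd : Dense (⋃ i : Option ι, interior (i.elim Uᶜ fun i => closure (E i))) := by
    refine dense_iUnion_interior_of_closed (fun i => ?_) (eq_univ_of_forall fun y => ?_)
    · cases i with
      | none => exact hU.isClosed_compl
      | some i => exact isClosed_closure
    · by_cases hy : y ∈ U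
      · obtain ⟨i, hi⟩ := mem_iUnion.1 (hcov hy)
        exact mem_iUnion.2 ⟨some i, subset_closure hi⟩
      · exact mem_iUnion.2 ⟨none, hy⟩
  rw [frequently_iff]
  intro V hV
  have hne : (interior V ∩ U).Nonempty := ⟨x, mem_interior_iff_mem_nhds.2 hV, hx⟩
  obtain ⟨z, ⟨hzV, hzU⟩, hz⟩ := hd.inter_open_nonempty _ (isOpen_interior.inter hU) hne
  obtain ⟨i, hi⟩ := mem_iUnion.1 hz
  cases i with
  | none => exact absurd hzU (interior_subset hi)
  | some i =>
    -- The point `z` may lie outside `O i`. A nearby `y ∈ E i` lies in `O i`, and there `E i` agrees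
    -- with its closure.
    obtain ⟨y, ⟨hyV, hyi⟩, hyE⟩ := mem_closure_iff.1 (interior_subset hi) _
      (isOpen_interior.inter isOpen_interior) ⟨hzV, hi⟩
    refine ⟨y, interior_subset hyV, i, ?_⟩
    filter_upwards [isOpen_interior.mem_nhds hyi, (hO i).mem_nhds (hEO i hyE)] with u h1 h2
    exact hE i ⟨interior_subset h1, h2⟩

theorem closure_inter_subset_of_continuousOn {N N' : Type*} [TopologicalSpace N]
    [TopologicalSpace N'] [T2Space N'] {O : Set N} (hO : IsOpen O) {f g : N → N'}
    (hf : ContinuousOn f O) (hg : ContinuousOn g O) :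
    closure {y ∈ O | f y = g y} ∩ O ⊆ {y ∈ O | f y = g y} := by
  rintro y ⟨hy, hyO⟩
  refine ⟨hyO, ?_⟩
  by_contra hne
  have hc := ((hf.continuousAt (hO.mem_nhds hyO)).prodMk (hg.continuousAt (hO.mem_nhds hyO)))
  have hev : ∀ᶠ u in 𝓝 y, (f u, g u) ∈ (diagonal N')ᶜ :=
    hc.preimage_mem_nhds (isClosed_diagonal.isOpen_compl.mem_nhds hne)
  obtain ⟨u, hu, hu'⟩ := (mem_closure_iff_frequently.1 hy).and_eventually hev |>.exists
  exact hu' hu.2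

end Baire

/-! ### Preservation of `dθ` by the hybrid flow. -/

section Preservation

open Set Filter Topology

theorem continuousAt_curl {A F₂ : Type*} [TopologicalSpace A] [NormedAddCommGroup F₂] [NormedSpace ℝ F₂]
    {θ : F₂ → F₂ →L[ℝ] ℝ} {f v w : A → F₂} {e : A} (hθ : ContDiffAt ℝ 2 θ (f e))
    (hf : ContinuousAt f e) (hv : ContinuousAt v e) (hw : ContinuousAt w e) :
    ContinuousAt (fun e => curl θ (f e) (v e) (w e)) e := by
  have h : ContinuousAt (fun e => fderiv ℝ θ (f e)) e :=
    ContinuousAt.comp (g := fderiv ℝ θ) (hθ.fderiv_right (m := 1) (by norm_num)).continuousAt hf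
  exact ((h.clm_apply hv).clm_apply hw).sub ((h.clm_apply hw).clm_apply hv)

variable {F : Type*} [NormedAddCommGroup F] [NormedSpace ℝ F] {K : Type*} [TopologicalSpace K]
  {J : ModelWithCorners ℝ F K} {N : Type*} [TopologicalSpace N] [ChartedSpace K N]
  {θ : (z : N) → TangentSpace J z →L[ℝ] ℝ} [J.Boundaryless] [IsManifold J 2 N]

/-- A `C²` map that preserves `dθ` at points arbitrarily close to `x` preserves it at `x`. -/
theorem PullsBackAt.of_frequently (hθ : IsSmoothCovectorField J θ) {Φ : N → N} {x : N}
    (hΦ : ContMDiffAt J J 2 Φ x)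
    (h : ∃ᶠ y in 𝓝 x, PullsBackAt J J Φ (bilinOfCovector J θ) (bilinOfCovector J θ) y) :
    PullsBackAt J J Φ (bilinOfCovector J θ) (bilinOfCovector J θ) x := by
  have : IsManifold J 1 N := IsManifold.of_le (n := 2) (by norm_num)
  set χ := extChartAt J x with hχ
  set χ' := extChartAt J (Φ x) with hχ'
  set f : F → F := fun e => χ' (Φ (χ.symm e)) with hf
  have hxx : χ.symm (χ x) = x := extChartAt_to_inv x
  have hf2 : ContDiffAt ℝ 2 f (χ x) := by
    rw [← contMDiffAt_iff_contDiffAt]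
    refine ContMDiffAt.comp_of_eq (y := Φ x) contMDiffAt_extChartAt ?_ (by rw [hxx])
    exact ContMDiffAt.comp_of_eq (y := x) hΦ
      ((contMDiffOn_extChartAt_symm x).contMDiffAt (extChartAt_target_mem_nhds x)) hxx
  have hfx : f (χ x) = χ' (Φ x) := by rw [hf]; simp only [hxx]
  have hsrc : ∀ᶠ y in 𝓝 x, y ∈ χ.source ∧ Φ y ∈ χ'.source :=
    Filter.Eventually.and (extChartAt_source_mem_nhds x)
      (hΦ.continuousAt.preimage_mem_nhds (extChartAt_source_mem_nhds (Φ x)))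
  have hpt : ∀ y, y ∈ χ.source → Φ y ∈ χ'.source →
      PullsBackAt J J Φ (bilinOfCovector J θ) (bilinOfCovector J θ) y → ∀ v w : F,
      curl (covectorInChart J θ (Φ x)) (f (χ y)) (fderiv ℝ f (χ y) v) (fderiv ℝ f (χ y) w) =
        curl (covectorInChart J θ x) (χ y) v w := by
    intro y hy hy' hpb
    have hyy : χ.symm (χ y) = y := χ.left_inv hy
    have h1 : PullsBackAt 𝓘(ℝ, F) J (fun e => Φ (χ.symm e)) (bilinOfCovector J θ)
        (chartForm J θ x) (χ y) :=
      PullsBackAt.comp (g := Φ) (by rwa [hyy]) (pullsBackAt_chart_symm hθ (χ.map_source hy))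
    have h2 : PullsBackAt 𝓘(ℝ, F) 𝓘(ℝ, F) f (chartForm J θ (Φ x)) (chartForm J θ x) (χ y) :=
      PullsBackAt.comp (f := fun e => Φ (χ.symm e)) (pullsBackAt_chart hθ (by rwa [hyy])) h1
    have h3 := h2.apply_mfderiv
    rw [mfderiv_eq_fderiv] at h3
    exact h3
  have hlim : ∀ v w : F,
      curl (covectorInChart J θ (Φ x)) (f (χ x)) (fderiv ℝ f (χ x) v) (fderiv ℝ f (χ x) w) =
        curl (covectorInChart J θ x) (χ x) v w := by
    intro v w
    have hc1 : ContinuousAt (fun e => curl (covectorInChart J θ (Φ x)) (f e) (fderiv ℝ f e v)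
        (fderiv ℝ f e w)) (χ x) := by
      have hd : ContinuousAt (fderiv ℝ f) (χ x) :=
        (hf2.fderiv_right (m := 1) (by norm_num)).continuousAt
      refine continuousAt_curl ?_ hf2.continuousAt (hd.clm_apply continuousAt_const)
        (hd.clm_apply continuousAt_const)
      rw [hfx]
      exact (hθ (Φ x)).contDiffAt (extChartAt_target_mem_nhds _)
    have hc2 : ContinuousAt (fun e => curl (covectorInChart J θ x) e v w) (χ x) :=
      continuousAt_curl (f := id) ((hθ x).contDiffAt (extChartAt_target_mem_nhds x)) continuousAt_id
        continuousAt_const continuousAt_const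
    have hc := (hc1.sub hc2).comp (f := χ) (continuousAt_extChartAt x)
    -- A nonzero defect at `x` would persist on a neighbourhood, which contains points where the
    -- defect vanishes.
    by_contra hne
    have hev := hc.eventually_ne (y := 0) (sub_ne_zero.2 hne)
    obtain ⟨y, hy, hy1, hy3⟩ := (h.and_eventually (hsrc.and hev)).exists
    exact hy3 (sub_eq_zero.2 (hpt y hy1.1 hy1.2 hy v w))
  have hfinal := PullsBackAt.of_chart (z₀ := x) (z₁ := Φ x) (g := f) hθ (mem_extChartAt_source x)
    (by rw [← hχ, hfx]; exact mem_extChartAt_target _)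
    (pullsBackAt_of_hasFDerivAt (hf2.differentiableAt (by simp)).hasFDerivAt hlim)
  refine hfinal.congr_of_eventuallyEq ?_
  filter_upwards [hsrc] with y hy
  simp only [hf, ← hχ, ← hχ', χ.left_inv hy.1, χ'.left_inv hy.2]

variable [FiniteDimensional ℝ F] [T2Space N] [SecondCountableTopology N]

/-- Resets that preserve the one-form `θ` and a vector field in the kernel of `dθ` make a hybrid
system that preserves `dθ`. -/
theorem HybridSystem.IsFlowMapOn.pullsBackAt {Y : HybridSystem J N} {W : Set N} {g : N → ℝ}
    (hX : IsCharacteristic J θ Y.field) (hA : IsActionReset J θ Y.field W g Y.reset)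
    (hG : Y.guard = crossingSet J Y.field W g) {t : ℝ} {Φ : N → N} {U : Set N} (hU : IsOpen U)
    (hflow : Y.IsFlowMapOn t Φ U) (hΦ : ContMDiffOn J J 2 Φ U) {x : N} (hx : x ∈ U) :
    PullsBackAt J J Φ (bilinOfCovector J θ) (bilinOfCovector J θ) x := by
  have : CompleteSpace F := FiniteDimensional.complete ℝ F
  -- Local compactness together with the Hausdorff property makes `N` a Baire space.
  have : LocallyCompactSpace N := Manifold.locallyCompact_of_finiteDimensional J
  have hΦc : ∀ y ∈ U, ContMDiffAt J J 2 Φ y := fun y hy => hΦ.contMDiffAt (hU.mem_nhds hy)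
  choose bx hbx using hX.exists_flowBox
  have hk0 : ∀ z : Y.guard, ∃ b : HitBox J θ Y.field Y.guard Y.reset, z.1 ∈ b.dom := by
    rw [hG]
    exact fun z => hA.exists_hitBox hX z.2
  choose kx hkx using hk0
  obtain ⟨β, hβc, hβ⟩ := TopologicalSpace.isOpen_iUnion_countable (fun z => (bx z).dom)
    fun z => (bx z).isOpen_dom
  obtain ⟨κ, hκc, hκ⟩ := TopologicalSpace.isOpen_iUnion_countable (fun z => (kx z).dom)
    fun z => (kx z).isOpen_dom
  have : Countable β := hβc.to_subtype
  have : Countable κ := hκc.to_subtype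
  set b : β → FlowBox J θ Y.field := fun i => bx i with hb
  set k : κ → HitBox J θ Y.field Y.guard Y.reset := fun j => kx j with hk
  have hbcov : ∀ z, ∃ i, z ∈ (b i).dom := fun z => by
    have : z ∈ ⋃ i ∈ β, (bx i).dom := hβ ▸ mem_iUnion.2 ⟨z, hbx z⟩
    obtain ⟨i, hi, hz⟩ := mem_iUnion₂.1 this
    exact ⟨⟨i, hi⟩, hz⟩
  have hkcov : ∀ z ∈ Y.guard, ∃ j, z ∈ (k j).dom := fun z hz => by
    have : z ∈ ⋃ i ∈ κ, (kx i).dom := hκ ▸ mem_iUnion.2 ⟨⟨z, hz⟩, hkx ⟨z, hz⟩⟩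
    obtain ⟨i, hi, hz⟩ := mem_iUnion₂.1 this
    exact ⟨⟨i, hi⟩, hz⟩
  refine PullsBackAt.of_frequently hX.smooth_form (hΦc x hx) ?_
  rcases le_or_gt 0 t with ht | ht
  -- For each word, the set where `Φ` coincides with the word flow is relatively closed; these
  -- countably many sets cover `U`.
  · refine (frequently_exists_mem_nhds hU
      (E := fun j : List ((β × ℚ) ⊕ κ) × β =>
        {y ∈ U ∩ wordFlowDom b k j.1 j.2 t | wordFlow b k j.1 j.2 t y = Φ y})
      (O := fun j => U ∩ wordFlowDom b k j.1 j.2 t)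
      (fun j => hU.inter (isOpen_wordFlowDom _ _ _)) (fun j => sep_subset _ _)
      (fun j => closure_inter_subset_of_continuousOn (hU.inter (isOpen_wordFlowDom _ _ _))
        (fun y hy => (pullsBackAt_wordFlow hy.2).continuousAt.continuousWithinAt)
        (hΦ.continuousOn.mono inter_subset_left)) (fun y hy => ?_) hx).mono ?_
    · obtain ⟨l, i, h1, h2⟩ := ((hflow y hy).1 ht).exists_wordFlow_eq hbcov hkcov
      exact mem_iUnion.2 ⟨(l, i), ⟨hy, h1⟩, h2⟩
    · rintro y ⟨j, hj⟩
      refine (pullsBackAt_wordFlow (mem_of_mem_nhds hj).1.2).congr_of_eventuallyEq ?_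
      filter_upwards [hj] with u hu using hu.2.symm
  · have hO : ∀ j : List ((β × ℚ) ⊕ κ) × β, IsOpen (U ∩ Φ ⁻¹' wordFlowDom b k j.1 j.2 (-t)) :=
      fun j => hΦ.continuousOn.isOpen_inter_preimage hU (isOpen_wordFlowDom _ _ _)
    refine (frequently_exists_mem_nhds hU
      (E := fun j : List ((β × ℚ) ⊕ κ) × β =>
        {y ∈ U ∩ Φ ⁻¹' wordFlowDom b k j.1 j.2 (-t) | wordFlow b k j.1 j.2 (-t) (Φ y) = y})
      (O := fun j => U ∩ Φ ⁻¹' wordFlowDom b k j.1 j.2 (-t)) hO (fun j => sep_subset _ _)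
      (fun j => closure_inter_subset_of_continuousOn (hO j)
        (fun y hy => ((pullsBackAt_wordFlow hy.2).continuousAt.comp
          (hΦc y hy.1).continuousAt).continuousWithinAt) continuousOn_id) (fun y hy => ?_) hx).mono ?_
    · obtain ⟨l, i, h1, h2⟩ := ((hflow y hy).2 ht).exists_wordFlow_eq hbcov hkcov
      exact mem_iUnion.2 ⟨(l, i), ⟨hy, h1⟩, h2⟩
    · rintro y ⟨j, hj⟩
      obtain ⟨⟨hyU, hyD⟩, -⟩ := mem_of_mem_nhds hj
      -- Here the word flow `Ψ` for time `-t` satisfies `Ψ ∘ Φ = id` near `y`. Since `Ψ` preserves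
      -- `dθ` at `Φ y` and `Ψ' ∘ dΦ` is the identity, `Φ` preserves `dθ` at `y`.
      obtain ⟨Ψ', hΨ', hΨB⟩ := pullsBackAt_wordFlow hyD
      have hΦd := ((hΦc y hyU).mdifferentiableAt (by simp)).hasMFDerivAt
      have hid : HasMFDerivAt J J (fun u => wordFlow b k j.1 j.2 (-t) (Φ u)) y
          (Ψ' ∘L mfderiv J J Φ y) := hΨ'.comp y hΦd
      have hid' : HasMFDerivAt J J id y (Ψ' ∘L mfderiv J J Φ y) := by
        refine hid.congr_of_eventuallyEq ?_
        filter_upwards [hj] with u hu using hu.2.symm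
      have heq : ∀ v, Ψ' (mfderiv J J Φ y v) = v := fun v =>
        congrArg (fun L : F →L[ℝ] F => L v) (hasMFDerivAt_unique hid' (hasMFDerivAt_id y))
      refine ⟨_, hΦd, fun v w => ?_⟩
      have key : ∀ z, z = y → ∀ v w v' w' : F, v = v' → w = w' →
          bilinOfCovector J θ z v w = bilinOfCovector J θ y v' w' := by
        rintro _ rfl v w _ _ rfl rfl
        rfl
      exact (hΨB _ _).symm.trans (key _ (mem_of_mem_nhds hj).2 _ _ _ _ (heq v) (heq w))

end Preservation

/-! ### Hausdorffness and second countability of bundles. -/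

section BundleTopology

open Set Topology

variable {B F : Type*} {E : B → Type*} [TopologicalSpace F] [TopologicalSpace B]
  [TopologicalSpace (Bundle.TotalSpace F E)] [∀ x, TopologicalSpace (E x)] [FiberBundle F E]

-- Points of one fibre are separated inside a trivialization, points of different fibres by their
-- projections.
variable (F E) in
theorem FiberBundle.t2Space_totalSpace [T2Space B] [T2Space F] :
    T2Space (Bundle.TotalSpace F E) := by
  refine ⟨fun z z' hne => ?_⟩
  by_cases hp : z.proj = z'.proj
  · set e := trivializationAt F E z.proj
    have hz : z ∈ e.source := e.mem_source.2 (FiberBundle.mem_baseSet_trivializationAt' _)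
    have hz' : z' ∈ e.source := e.mem_source.2 (hp ▸ FiberBundle.mem_baseSet_trivializationAt' _)
    obtain ⟨u, v, hu, hv, hzu, hzv, huv⟩ := t2_separation (fun h => hne (e.injOn hz hz' h))
    refine ⟨e.source ∩ e ⁻¹' u, e.source ∩ e ⁻¹' v,
      e.continuousOn.isOpen_inter_preimage e.open_source hu,
      e.continuousOn.isOpen_inter_preimage e.open_source hv, ⟨hz, hzu⟩, ⟨hz', hzv⟩, ?_⟩
    exact (huv.preimage e).mono inter_subset_right inter_subset_right
  · obtain ⟨u, v, hu, hv, hzu, hzv, huv⟩ := t2_separation hp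
    have hc : Continuous (Bundle.TotalSpace.proj : Bundle.TotalSpace F E → B) :=
      FiberBundle.continuous_proj F E
    exact ⟨_, _, hu.preimage hc, hv.preimage hc, hzu, hzv, huv.preimage _⟩

variable (F E) in
theorem FiberBundle.secondCountableTopology_totalSpace [SecondCountableTopology B]
    [SecondCountableTopology F] [∀ x, Inhabited (E x)] :
    SecondCountableTopology (Bundle.TotalSpace F E) := by
  obtain ⟨T, hT, hTU⟩ := TopologicalSpace.isOpen_iUnion_countable
    (fun x : B => (trivializationAt F E x).baseSet) fun x => (trivializationAt F E x).open_baseSet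
  refine ChartedSpace.secondCountable_of_countable_cover (B × F)
    (s := (fun x : B => (⟨x, default⟩ : Bundle.TotalSpace F E)) '' T)
    (eq_univ_of_forall fun z => ?_) (hT.image _)
  have : z.proj ∈ ⋃ x ∈ T, (trivializationAt F E x).baseSet := by
    rw [hTU]
    exact mem_iUnion.2 ⟨z.proj, FiberBundle.mem_baseSet_trivializationAt' _⟩
  obtain ⟨x, hx, hz⟩ := mem_iUnion₂.1 this
  exact mem_iUnion₂.2 ⟨_, ⟨x, hx, rfl⟩, (trivializationAt F E x).mem_source.2 hz⟩

end BundleTopology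

/-! ### Canonical coordinates on the cotangent bundle. -/

section CotangentCharts

open Set Filter Topology

variable {n : ℕ} {M : Type*} [TopologicalSpace M] [ChartedSpace (EuclideanSpace ℝ (Fin n)) M]
  [IsManifold (𝓡 n) ∞ M]

instance : IsManifold (cotModel n) ∞ (Cotangent n M) :=
  Bundle.TotalSpace.isManifold (n := ∞) (IB := 𝓡 n) _ _ 

instance [T2Space M] : T2Space (Cotangent n M) := FiberBundle.t2Space_totalSpace _ _

instance [SecondCountableTopology M] : SecondCountableTopology (Cotangent n M) :=
  have : ∀ x : M, Inhabited (TangentSpace (𝓡 n) x →L[ℝ] Bundle.Trivial M ℝ x) := fun _ => ⟨0⟩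
  FiberBundle.secondCountableTopology_totalSpace _ _


/-- The model vector space of `T^*M`. -/
abbrev PhaseSpace (n : ℕ) := EuclideanSpace ℝ (Fin n) × (EuclideanSpace ℝ (Fin n) →L[ℝ] ℝ)

theorem mem_cotangent_chart_source {z₀ z : Cotangent n M} :
    z ∈ (extChartAt (cotModel n) z₀).source ↔ z.proj ∈ (extChartAt (𝓡 n) z₀.proj).source := by
  rw [FiberBundle.extChartAt]
  simp only [mfld_simps]
  exact ⟨fun h => h.1.1, fun h => ⟨⟨h, mem_univ _⟩, h⟩⟩

theorem cotangent_chart_fst (z₀ z : Cotangent n M) :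
    (extChartAt (cotModel n) z₀ z).1 = extChartAt (𝓡 n) z₀.proj z.proj := by
  rw [FiberBundle.extChartAt]
  rfl

/-- The fibre coordinate is the covector read through the derivative of the inverse chart of `M`,
that is, the momenta `p_i`. This makes the bundle charts canonical for `ϑ`. -/
theorem cotangent_chart_snd {z₀ z : Cotangent n M} (hz : z ∈ (extChartAt (cotModel n) z₀).source)
    (v : EuclideanSpace ℝ (Fin n)) :
    (extChartAt (cotModel n) z₀ z).2 v =
      covector z ((chartSymmDeriv (𝓡 n) z₀.proj (extChartAt (𝓡 n) z₀.proj z.proj) v :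
        EuclideanSpace ℝ (Fin n))) := by
  have hz' := mem_cotangent_chart_source.1 hz
  rw [extChartAt_source] at hz'
  have h := TangentBundle.symmL_trivializationAt (I := 𝓡 n) hz'
  rw [(𝓡 n).range_eq_univ, mfderivWithin_univ] at h
  have h2 := congrArg (fun L : EuclideanSpace ℝ (Fin n) →L[ℝ] EuclideanSpace ℝ (Fin n) => L v) h
  rw [FiberBundle.extChartAt]
  have h3 : ((trivializationAt (EuclideanSpace ℝ (Fin n) →L[ℝ] ℝ)
      (fun x : M => TangentSpace (𝓡 n) x →L[ℝ] Bundle.Trivial M ℝ x) z₀.proj) z).2 v =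
      z.2 ((trivializationAt (EuclideanSpace ℝ (Fin n)) (TangentSpace (𝓡 n)) z₀.proj).symmL ℝ
        z.proj v) := by
    rw [hom_trivializationAt_apply]
    simp only [ContinuousLinearMap.inCoordinates]
    simp
  exact h3.trans (congrArg (fun u : EuclideanSpace ℝ (Fin n) => covector z u) h2)

variable (M) in
theorem contMDiff_cotProj : ContMDiff (cotModel n) (𝓡 n) ∞ (cotProj : Cotangent n M → M) :=
  Bundle.contMDiff_proj _

theorem mdifferentiableAt_cotProj (z : Cotangent n M) :
    MDifferentiableAt (cotModel n) (𝓡 n) cotProj z :=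
  (contMDiff_cotProj M z).mdifferentiableAt (by simp)

theorem chartDeriv_cotangent_fst {z₀ z : Cotangent n M}
    (hz : z ∈ (extChartAt (cotModel n) z₀).source) (v : TangentSpace (cotModel n) z) :
    (chartDeriv (cotModel n) z₀ z v).1 =
      chartDeriv (𝓡 n) z₀.proj z.proj (mfderiv (cotModel n) (𝓡 n) cotProj z v) := by
  have : IsManifold (𝓡 n) 1 M := IsManifold.of_le (n := ∞) (by simp)
  have h1 : HasMFDerivAt (cotModel n) 𝓘(ℝ, EuclideanSpace ℝ (Fin n))
      (fun z => (extChartAt (cotModel n) z₀ z).1) z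
      (ContinuousLinearMap.fst ℝ (EuclideanSpace ℝ (Fin n)) (EuclideanSpace ℝ (Fin n) →L[ℝ] ℝ) ∘L
        chartDeriv (cotModel n) z₀ z) :=
    (ContinuousLinearMap.fst ℝ (EuclideanSpace ℝ (Fin n))
      (EuclideanSpace ℝ (Fin n) →L[ℝ] ℝ)).hasFDerivAt.hasMFDerivAt.comp z (hasMFDerivAt_chart hz)
  have h2 : HasMFDerivAt (cotModel n) 𝓘(ℝ, EuclideanSpace ℝ (Fin n))
      (fun z : Cotangent n M => extChartAt (𝓡 n) z₀.proj (cotProj z)) z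
      (chartDeriv (𝓡 n) z₀.proj z.proj ∘L mfderiv (cotModel n) (𝓡 n) cotProj z) :=
    (hasMFDerivAt_chart (mem_cotangent_chart_source.1 hz)).comp z
      (mdifferentiableAt_cotProj z).hasMFDerivAt
  have h3 : (fun z => (extChartAt (cotModel n) z₀ z).1) =
      fun z : Cotangent n M => extChartAt (𝓡 n) z₀.proj (cotProj z) :=
    funext fun z => cotangent_chart_fst z₀ z
  rw [h3] at h1
  exact congrArg (fun L : PhaseSpace n →L[ℝ] EuclideanSpace ℝ (Fin n) => L v) (hasMFDerivAt_unique h1 h2)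

theorem tautologicalForm_apply {z₀ z : Cotangent n M}
    (hz : z ∈ (extChartAt (cotModel n) z₀).source) (v : TangentSpace (cotModel n) z) :
    tautologicalForm z v = (extChartAt (cotModel n) z₀ z).2 (chartDeriv (cotModel n) z₀ z v).1 := by
  have : IsManifold (𝓡 n) 1 M := IsManifold.of_le (n := ∞) (by simp)
  rw [chartDeriv_cotangent_fst hz, cotangent_chart_snd hz]
  have h := mfderivWithin_extChartAt_symm_comp_mfderiv_extChartAt' (I := 𝓡 n)
    (mem_cotangent_chart_source.1 hz)
  rw [(𝓡 n).range_eq_univ, mfderivWithin_univ] at h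
  exact congrArg (fun L : EuclideanSpace ℝ (Fin n) →L[ℝ] EuclideanSpace ℝ (Fin n) =>
    covector z (L (mfderiv (cotModel n) (𝓡 n) cotProj z v))) h.symm

theorem covectorInChart_tautologicalForm {z₀ : Cotangent n M}
    {e : PhaseSpace n} (he : e ∈ (extChartAt (cotModel n) z₀).target) (v : PhaseSpace n) :
    covectorInChart (cotModel n) tautologicalForm z₀ e v = e.2 v.1 := by
  rw [covectorInChart, ContinuousLinearMap.comp_apply,
    tautologicalForm_apply ((extChartAt (cotModel n) z₀).map_target he),
    chartDeriv_chartSymmDeriv he, (extChartAt (cotModel n) z₀).right_inv he]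

end CotangentCharts

/-! ### The action form and Hamilton's equations on the model space. -/

section ModelPhaseSpace

open Set Filter Topology

variable {A B : Type*} [NormedAddCommGroup A] [NormedSpace ℝ A] [NormedAddCommGroup B]
  [NormedSpace ℝ B]

/-- The one-form `p dx` on `A × B`, for a pairing `P` of `B` and `A`. -/
def modelTautologicalForm (P : B →L[ℝ] A →L[ℝ] ℝ) : (A × B) →L[ℝ] (A × B) →L[ℝ] ℝ :=
  ((ContinuousLinearMap.compL ℝ (A × B) A ℝ).flip
    (ContinuousLinearMap.fst ℝ A B)) ∘L P ∘L ContinuousLinearMap.snd ℝ A B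

theorem modelTautologicalForm_apply (P : B →L[ℝ] A →L[ℝ] ℝ) (e v : A × B) :
    modelTautologicalForm P e v = P e.2 v.1 := rfl

theorem contDiff_modelTautologicalForm (P : B →L[ℝ] A →L[ℝ] ℝ) {m : ℕ∞ω} :
    ContDiff ℝ m (fun e => modelTautologicalForm P e) :=
  (modelTautologicalForm P).contDiff

theorem curl_modelTautologicalForm (P : B →L[ℝ] A →L[ℝ] ℝ) (e v w : A × B) :
    curl (fun e => modelTautologicalForm P e) e v w = P v.2 w.1 - P w.2 v.1 := by
  rw [curl, (modelTautologicalForm P).hasFDerivAt.fderiv]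
  rfl

/-- The one-form `p dx - H dt` on `ℝ × A × B`. -/
def modelActionForm (P : B →L[ℝ] A →L[ℝ] ℝ) (H : ℝ × A × B → ℝ) (e : ℝ × A × B) :
    (ℝ × A × B) →L[ℝ] ℝ :=
  modelTautologicalForm P e.2 ∘L ContinuousLinearMap.snd ℝ ℝ (A × B) -
    H e • ContinuousLinearMap.fst ℝ ℝ (A × B)

theorem ContDiffOn.modelActionForm (P : B →L[ℝ] A →L[ℝ] ℝ) {H : ℝ × A × B → ℝ} {m : ℕ∞ω}
    {s : Set (ℝ × A × B)} (hH : ContDiffOn ℝ m H s) : ContDiffOn ℝ m (modelActionForm P H) s := by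
  refine ContDiffOn.sub ?_ (hH.smul contDiffOn_const)
  exact ((contDiff_modelTautologicalForm P).comp contDiff_snd).contDiffOn.clm_comp contDiffOn_const

theorem curl_modelActionForm (P : B →L[ℝ] A →L[ℝ] ℝ) {H : ℝ × A × B → ℝ} {e : ℝ × A × B}
    (hH : DifferentiableAt ℝ H e) (v w : ℝ × A × B) :
    curl (modelActionForm P H) e v w =
      P v.2.2 w.2.1 - P w.2.2 v.2.1 - fderiv ℝ H e v * w.1 + fderiv ℝ H e w * v.1 := by
  have h1 : HasFDerivAt (fun e : ℝ × A × B => modelTautologicalForm P e.2 ∘L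
      ContinuousLinearMap.snd ℝ ℝ (A × B))
      (((ContinuousLinearMap.compL ℝ (ℝ × A × B) (A × B) ℝ).flip
        (ContinuousLinearMap.snd ℝ ℝ (A × B))) ∘L modelTautologicalForm P ∘L
          ContinuousLinearMap.snd ℝ ℝ (A × B)) e :=
    (((ContinuousLinearMap.compL ℝ (ℝ × A × B) (A × B) ℝ).flip
        (ContinuousLinearMap.snd ℝ ℝ (A × B))) ∘L modelTautologicalForm P ∘L
          ContinuousLinearMap.snd ℝ ℝ (A × B)).hasFDerivAt
  have h2 : HasFDerivAt (modelActionForm P H) _ e :=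
    h1.sub (hH.hasFDerivAt.smul_const (ContinuousLinearMap.fst ℝ ℝ (A × B)))
  rw [curl, h2.fderiv]
  simp only [sub_apply, ContinuousLinearMap.comp_apply, ContinuousLinearMap.smulRight_apply,
    ContinuousLinearMap.flip_apply, ContinuousLinearMap.compL_apply, modelTautologicalForm_apply,
    ContinuousLinearMap.coe_snd', ContinuousLinearMap.coe_fst', smul_apply, smul_eq_mul]
  ring

/-- The structure of a perfect pairing of `B` and `A`, with its two inverse maps. -/
structure IsPerfectPairing (P : B →L[ℝ] A →L[ℝ] ℝ) (D : (B →L[ℝ] ℝ) →L[ℝ] A)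
    (D' : (A →L[ℝ] ℝ) →L[ℝ] B) : Prop where
  apply_left : ∀ ξ p, P p (D ξ) = ξ p
  apply_right : ∀ α a, P (D' α) a = α a
  left_injective : ∀ a, (∀ p, P p a = 0) → a = 0
  right_injective : ∀ p, (∀ a, P p a = 0) → p = 0

/-- The vector that corresponds to a covector under the symplectic form of `A × B`. -/
def modelHamiltonianVector (D : (B →L[ℝ] ℝ) →L[ℝ] A) (D' : (A →L[ℝ] ℝ) →L[ℝ] B)
    (L : (A × B) →L[ℝ] ℝ) : A × B :=
  (D (L ∘L ContinuousLinearMap.inr ℝ A B), -D' (L ∘L ContinuousLinearMap.inl ℝ A B))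

variable {P : B →L[ℝ] A →L[ℝ] ℝ} {D : (B →L[ℝ] ℝ) →L[ℝ] A} {D' : (A →L[ℝ] ℝ) →L[ℝ] B}

theorem IsPerfectPairing.modelHamiltonianVector_spec (hP : IsPerfectPairing P D D')
    (L : (A × B) →L[ℝ] ℝ) (w : A × B) :
    P w.2 (modelHamiltonianVector D D' L).1 - P (modelHamiltonianVector D D' L).2 w.1 = L w := by
  have hw : L w = L (w.1, 0) + L (0, w.2) := by
    rw [← map_add]
    simp
  simp [modelHamiltonianVector, hP.apply_left, hP.apply_right, hw, add_comm]

theorem IsPerfectPairing.eq_modelHamiltonianVector (hP : IsPerfectPairing P D D')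
    {L : (A × B) →L[ℝ] ℝ} {v : A × B} (h : ∀ w : A × B, P w.2 v.1 - P v.2 w.1 = L w) :
    v = modelHamiltonianVector D D' L := by
  have hs := hP.modelHamiltonianVector_spec L
  refine Prod.ext (sub_eq_zero.1 (hP.left_injective _ fun p => ?_))
    (sub_eq_zero.1 (hP.right_injective _ fun a => ?_))
  · have h1 := (h (0, p)).trans (hs (0, p)).symm
    simpa [sub_eq_zero] using h1
  · have h1 := (h (a, 0)).trans (hs (a, 0)).symm
    simpa [sub_eq_zero] using h1

variable (D D') in
/-- The suspended Hamiltonian vector field on `ℝ × A × B`. -/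
def modelSuspendedField (H : ℝ × A × B → ℝ) (e : ℝ × A × B) : ℝ × A × B :=
  (1, modelHamiltonianVector D D' (fderiv ℝ H e ∘L ContinuousLinearMap.inr ℝ ℝ (A × B)))

theorem ContDiffOn.modelSuspendedField {H : ℝ × A × B → ℝ} {s : Set (ℝ × A × B)} (hs : IsOpen s)
    (hH : ContDiffOn ℝ ∞ H s) : ContDiffOn ℝ 2 (modelSuspendedField D D' H) s := by
  have h1 : ContDiffOn ℝ 2 (fderiv ℝ H) s := hH.fderiv_of_isOpen hs (by norm_cast)
  have h2 := h1.clm_comp (contDiffOn_const (s := s) (c := ContinuousLinearMap.inr ℝ ℝ (A × B)))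
  exact contDiffOn_const.prodMk ((D.contDiff.comp_contDiffOn
    (h2.clm_comp contDiffOn_const)).prodMk
      (D'.contDiff.comp_contDiffOn (h2.clm_comp contDiffOn_const)).neg)

/-- Here `dϑ_H = dp ∧ dx - dH ∧ dt`. By Hamilton's equations the contraction of `dp ∧ dx` with the
field cancels the spatial part of `dH`; the `dt` terms cancel because `dH(X_H) = 0`, which is `h2`.
-/
theorem IsPerfectPairing.curl_modelSuspendedField (hP : IsPerfectPairing P D D')
    {H : ℝ × A × B → ℝ} {e : ℝ × A × B} (hH : DifferentiableAt ℝ H e) (w : ℝ × A × B) :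
    curl (modelActionForm P H) e (modelSuspendedField D D' H e) w = 0 := by
  rw [curl_modelActionForm P hH]
  set L := fderiv ℝ H e
  have hv := hP.modelHamiltonianVector_spec (L ∘L ContinuousLinearMap.inr ℝ ℝ _)
  have h1 := hv w.2
  have h2 := hv (modelSuspendedField D D' H e).2
  have h3 : ∀ u : ℝ × A × B, L u = u.1 * L (1, 0) + L (0, u.2) := fun u => by
    rw [← smul_eq_mul, ← map_smul, ← map_add]
    simp
  have h4 : (modelSuspendedField D D' H e).1 = 1 := rfl
  have h5 : (modelSuspendedField D D' H e).2 =
    modelHamiltonianVector D D' (L ∘L ContinuousLinearMap.inr ℝ ℝ _) := rfl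
  simp only [ContinuousLinearMap.comp_apply, ContinuousLinearMap.inr_apply] at h1 h2
  rw [h3 w, h3 (modelSuspendedField D D' H e), h4, ← h2, ← h1, h5]
  ring

end ModelPhaseSpace

/-! ### The pairing of a finite-dimensional space with its dual. -/

section CanonicalPairing

variable (A : Type*) [NormedAddCommGroup A] [NormedSpace ℝ A]

/-- The canonical pairing of the dual space of `A` and `A`. -/
def canonicalPairing : (A →L[ℝ] ℝ) →L[ℝ] A →L[ℝ] ℝ := ContinuousLinearMap.id ℝ (A →L[ℝ] ℝ)

theorem canonicalPairing_apply (p : A →L[ℝ] ℝ) (a : A) : canonicalPairing A p a = p a := rfl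

theorem exists_predual [FiniteDimensional ℝ A] :
    ∃ D : ((A →L[ℝ] ℝ) →L[ℝ] ℝ) →L[ℝ] A, ∀ ξ (p : A →L[ℝ] ℝ), p (D ξ) = ξ p := by
  let b := Module.finBasis ℝ A
  let c : Fin _ → A →L[ℝ] ℝ := fun i => LinearMap.toContinuousLinearMap (b.coord i)
  -- The bidual element `ξ` is represented by the vector whose coordinates are its values on the
  -- dual basis.
  refine ⟨∑ i, (ContinuousLinearMap.apply ℝ ℝ (c i)).smulRight (b i), fun ξ p => ?_⟩
  have hp : p = ∑ i, p (b i) • c i := by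
    ext a
    conv_lhs => rw [← b.sum_repr a, map_sum]
    simp [c, mul_comm]
  conv_rhs => rw [hp]
  simp [mul_comm]

/-- The inverse of the evaluation map from a finite-dimensional space to its bidual. -/
def predual [FiniteDimensional ℝ A] : ((A →L[ℝ] ℝ) →L[ℝ] ℝ) →L[ℝ] A := (exists_predual A).choose

theorem isPerfectPairing_canonicalPairing [FiniteDimensional ℝ A] :
    IsPerfectPairing (canonicalPairing A) (predual A) (ContinuousLinearMap.id ℝ (A →L[ℝ] ℝ)) where
  apply_left := (exists_predual A).choose_spec
  apply_right _ _ := rfl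
  left_injective _ h := SeparatingDual.eq_zero_of_forall_dual_eq_zero (R := ℝ) h
  right_injective _ h := ContinuousLinearMap.ext h

end CanonicalPairing

/-! ### `ω` and `ω_H` in canonical coordinates. -/

section ActionForm

open Set Filter Topology

variable {n : ℕ} {M : Type*} [TopologicalSpace M] [ChartedSpace (EuclideanSpace ℝ (Fin n)) M]
  [IsManifold (𝓡 n) ∞ M]

theorem covectorInChart_tautologicalForm_eqOn (z₀ : Cotangent n M) :
    EqOn (covectorInChart (cotModel n) tautologicalForm z₀) (fun e => modelTautologicalForm (canonicalPairing (EuclideanSpace ℝ (Fin n))) e)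
      (extChartAt (cotModel n) z₀).target := fun _ he =>
  ContinuousLinearMap.ext fun v => covectorInChart_tautologicalForm he v

variable (M) in
theorem isSmoothCovectorField_tautologicalForm :
    IsSmoothCovectorField (cotModel n) (tautologicalForm (n := n) (M := M)) := fun z₀ =>
  (contDiff_modelTautologicalForm (canonicalPairing (EuclideanSpace ℝ (Fin n)))).contDiffOn.congr (covectorInChart_tautologicalForm_eqOn z₀)

theorem symplecticForm_apply {z₀ z : Cotangent n M}
    (hz : z ∈ (extChartAt (cotModel n) z₀).source) (v w : TangentSpace (cotModel n) z) :
    symplecticForm z ![v, w] =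
      (chartDeriv (cotModel n) z₀ z w).2 (chartDeriv (cotModel n) z₀ z v).1 -
        (chartDeriv (cotModel n) z₀ z v).2 (chartDeriv (cotModel n) z₀ z w).1 := by
  have h := bilinOfCovector_eq_curl (isSmoothCovectorField_tautologicalForm M) hz v w
  have heq : covectorInChart (cotModel n) tautologicalForm z₀ =ᶠ[𝓝 (extChartAt (cotModel n) z₀ z)]
      fun e => modelTautologicalForm (canonicalPairing (EuclideanSpace ℝ (Fin n))) e :=
    (covectorInChart_tautologicalForm_eqOn z₀).eventuallyEq_of_mem
      ((isOpen_extChartAt_target z₀).mem_nhds ((extChartAt (cotModel n) z₀).map_source hz))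
  rw [heq.curl_eq, curl_modelTautologicalForm] at h
  have h2 : symplecticForm z ![v, w] = -bilinOfCovector (cotModel n) tautologicalForm z v w := rfl
  rw [h2, h]
  exact neg_sub _ _

/-! ### The extended phase space -/

theorem ext_chart_apply (q₀ q : ℝ × Cotangent n M) :
    extChartAt (extModel n) q₀ q = (q.1, extChartAt (cotModel n) q₀.2 q.2) := by
  rw [extChartAt_prod]
  rfl

theorem ext_chart_symm_apply (q₀ : ℝ × Cotangent n M) (e : ℝ × PhaseSpace n) :
    (extChartAt (extModel n) q₀).symm e = (e.1, (extChartAt (cotModel n) q₀.2).symm e.2) := by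
  rw [extChartAt_prod]
  rfl

theorem mem_ext_chart_source {q₀ q : ℝ × Cotangent n M} :
    q ∈ (extChartAt (extModel n) q₀).source ↔ q.2 ∈ (extChartAt (cotModel n) q₀.2).source := by
  rw [extChartAt_prod]
  exact ⟨fun h => h.2, fun h => ⟨by simp [chartAt_self_eq], h⟩⟩

/-- The time component of a tangent vector. -/
def timePart {q : ℝ × Cotangent n M} (v : TangentSpace (extModel n) q) : ℝ :=
  mfderiv (extModel n) 𝓘(ℝ, ℝ) Prod.fst q v

/-- The component of a tangent vector along `T^*M`. -/
def spacePart {q : ℝ × Cotangent n M} (v : TangentSpace (extModel n) q) :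
    TangentSpace (cotModel n) q.2 :=
  mfderiv (extModel n) (cotModel n) Prod.snd q v

theorem timePart_mk {q : ℝ × Cotangent n M} (s : ℝ) (v : TangentSpace (cotModel n) q.2) :
    timePart (q := q) ((s, v) : ℝ × PhaseSpace n) = s := by
  have h := mfderiv_fst (I := 𝓘(ℝ, ℝ)) (I' := cotModel n) (x := q)
  exact congrArg (fun L : ℝ × PhaseSpace n →L[ℝ] ℝ => L (s, v)) h

theorem spacePart_mk {q : ℝ × Cotangent n M} (s : ℝ) (v : TangentSpace (cotModel n) q.2) :
    spacePart (q := q) ((s, v) : ℝ × PhaseSpace n) = v := by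
  have h := mfderiv_snd (I := 𝓘(ℝ, ℝ)) (I' := cotModel n) (x := q)
  exact congrArg (fun L : ℝ × PhaseSpace n →L[ℝ] PhaseSpace n => L (s, v)) h

theorem ext_chartDeriv {q₀ q : ℝ × Cotangent n M} (hq : q ∈ (extChartAt (extModel n) q₀).source)
    (v : TangentSpace (extModel n) q) :
    chartDeriv (extModel n) q₀ q v =
      (timePart v, chartDeriv (cotModel n) q₀.2 q.2 (spacePart v)) := by
  have h1 : HasMFDerivAt (extModel n) 𝓘(ℝ, PhaseSpace n)
      (fun q : ℝ × Cotangent n M => extChartAt (cotModel n) q₀.2 q.2) q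
      (chartDeriv (cotModel n) q₀.2 q.2 ∘L mfderiv (extModel n) (cotModel n) Prod.snd q) :=
    (hasMFDerivAt_chart (mem_ext_chart_source.1 hq)).comp q mdifferentiableAt_snd.hasMFDerivAt
  have h2 : HasMFDerivAt (extModel n) 𝓘(ℝ, ℝ) (Prod.fst : ℝ × Cotangent n M → ℝ) q
      (mfderiv (extModel n) 𝓘(ℝ, ℝ) Prod.fst q) := mdifferentiableAt_fst.hasMFDerivAt
  have h3 := HasMFDerivAt.prodMk_normedSpace h2 h1
  have h4 : (extChartAt (extModel n) q₀ : ℝ × Cotangent n M → ℝ × PhaseSpace n) =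
      fun q => (q.1, extChartAt (cotModel n) q₀.2 q.2) := funext (ext_chart_apply q₀)
  have h5 : HasMFDerivAt (extModel n) 𝓘(ℝ, ℝ × PhaseSpace n) (extChartAt (extModel n) q₀) q
      (chartDeriv (extModel n) q₀ q) := hasMFDerivAt_chart hq
  rw [h4] at h5
  exact congrArg (fun L : ℝ × PhaseSpace n →L[ℝ] ℝ × PhaseSpace n => L v) (hasMFDerivAt_unique h5 h3)

theorem actionForm_apply (H : ℝ × Cotangent n M → ℝ) {q₀ q : ℝ × Cotangent n M}
    (hq : q ∈ (extChartAt (extModel n) q₀).source) (v : TangentSpace (extModel n) q) :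
    actionForm H q v = (extChartAt (extModel n) q₀ q).2.2 (chartDeriv (extModel n) q₀ q v).2.1 -
      H q * (chartDeriv (extModel n) q₀ q v).1 := by
  rw [ext_chartDeriv hq, ext_chart_apply,
    ← tautologicalForm_apply (mem_ext_chart_source.1 hq) (spacePart v)]
  rfl

/-- A function on `ℝ × T^*M` in the preferred chart at `q₀`. -/
def hamiltonianInChart (H : ℝ × Cotangent n M → ℝ) (q₀ : ℝ × Cotangent n M) (e : ℝ × PhaseSpace n) :
    ℝ := H ((extChartAt (extModel n) q₀).symm e)

theorem contDiffOn_hamiltonianInChart {H : ℝ × Cotangent n M → ℝ}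
    (hH : ContMDiff (extModel n) 𝓘(ℝ, ℝ) ∞ H) (q₀ : ℝ × Cotangent n M) :
    ContDiffOn ℝ ∞ (hamiltonianInChart H q₀) (extChartAt (extModel n) q₀).target := by
  rw [← contMDiffOn_iff_contDiffOn]
  exact hH.comp_contMDiffOn (contMDiffOn_extChartAt_symm q₀)

theorem covectorInChart_actionForm_eqOn (H : ℝ × Cotangent n M → ℝ) (q₀ : ℝ × Cotangent n M) :
    EqOn (covectorInChart (extModel n) (actionForm H) q₀)
      (modelActionForm (canonicalPairing (EuclideanSpace ℝ (Fin n))) (hamiltonianInChart H q₀)) (extChartAt (extModel n) q₀).target := fun e he => by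
  have key : ∀ v, covectorInChart (extModel n) (actionForm H) q₀ e v =
      modelActionForm (canonicalPairing (EuclideanSpace ℝ (Fin n))) (hamiltonianInChart H q₀) e v := by
    intro v
    rw [covectorInChart, ContinuousLinearMap.comp_apply,
      actionForm_apply H ((extChartAt (extModel n) q₀).map_target he),
      chartDeriv_chartSymmDeriv he, (extChartAt (extModel n) q₀).right_inv he]
    rfl
  exact ContinuousLinearMap.ext key

theorem isSmoothCovectorField_actionForm {H : ℝ × Cotangent n M → ℝ}
    (hH : ContMDiff (extModel n) 𝓘(ℝ, ℝ) ∞ H) :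
    IsSmoothCovectorField (extModel n) (actionForm H) := fun q₀ =>
  (((contDiffOn_hamiltonianInChart hH q₀).of_le (by norm_cast)).modelActionForm _).congr
    (covectorInChart_actionForm_eqOn H q₀)

theorem actionTwoForm_apply {H : ℝ × Cotangent n M → ℝ}
    (hH : ContMDiff (extModel n) 𝓘(ℝ, ℝ) ∞ H) {q₀ q : ℝ × Cotangent n M}
    (hq : q ∈ (extChartAt (extModel n) q₀).source) (v w : TangentSpace (extModel n) q) :
    actionTwoForm H q ![v, w] = -curl (modelActionForm (canonicalPairing (EuclideanSpace ℝ (Fin n))) (hamiltonianInChart H q₀))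
      (extChartAt (extModel n) q₀ q) (chartDeriv (extModel n) q₀ q v)
        (chartDeriv (extModel n) q₀ q w) := by
  have h := bilinOfCovector_eq_curl (isSmoothCovectorField_actionForm hH) hq v w
  have heq : covectorInChart (extModel n) (actionForm H) q₀ =ᶠ[𝓝 (extChartAt (extModel n) q₀ q)]
      modelActionForm (canonicalPairing (EuclideanSpace ℝ (Fin n))) (hamiltonianInChart H q₀) :=
    (covectorInChart_actionForm_eqOn H q₀).eventuallyEq_of_mem
      ((isOpen_extChartAt_target q₀).mem_nhds ((extChartAt (extModel n) q₀).map_source hq))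
  rw [heq.curl_eq] at h
  exact congrArg (fun r : ℝ => -r) h

end ActionForm

/-! ### Differentials of functions in charts. -/

section ChartDifferential

open Set Filter Topology

variable {F : Type*} [NormedAddCommGroup F] [NormedSpace ℝ F] {K : Type*} [TopologicalSpace K]
  {J : ModelWithCorners ℝ F K} {N : Type*} [TopologicalSpace N] [ChartedSpace K N]
  [J.Boundaryless] [IsManifold J 1 N]

theorem MDifferentiableAt.differentiableAt_chart {f : N → ℝ} {z₀ z : N}
    (hf : MDifferentiableAt J 𝓘(ℝ, ℝ) f z) (hz : z ∈ (extChartAt J z₀).source) :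
    DifferentiableAt ℝ (fun e => f ((extChartAt J z₀).symm e)) (extChartAt J z₀ z) := by
  have h := hasMFDerivAt_chart_symm ((extChartAt J z₀).map_source hz)
  have hf' : MDifferentiableAt J 𝓘(ℝ, ℝ) f ((extChartAt J z₀).symm (extChartAt J z₀ z)) := by
    rwa [(extChartAt J z₀).left_inv hz]
  exact (hf'.comp _ h.mdifferentiableAt).differentiableAt

theorem MDifferentiableAt.mvfderiv_apply_eq_fderiv_chart {f : N → ℝ} {z₀ z : N}
    (hf : MDifferentiableAt J 𝓘(ℝ, ℝ) f z) (hz : z ∈ (extChartAt J z₀).source)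
    (w : TangentSpace J z) :
    mvfderiv J f z w =
      fderiv ℝ (fun e => f ((extChartAt J z₀).symm e)) (extChartAt J z₀ z) (chartDeriv J z₀ z w) := by
  have h1 := (hf.differentiableAt_chart hz).hasFDerivAt.hasMFDerivAt.comp z (hasMFDerivAt_chart hz)
  have h2 : HasMFDerivAt J 𝓘(ℝ, ℝ) f z
      (fderiv ℝ (fun e => f ((extChartAt J z₀).symm e)) (extChartAt J z₀ z) ∘L chartDeriv J z₀ z) := by
    refine h1.congr_of_eventuallyEq ?_
    filter_upwards [(isOpen_extChartAt_source z₀).mem_nhds hz] with y hy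
    simp only [Function.comp_apply, (extChartAt J z₀).left_inv hy]
  exact congrArg (fun L : F →L[ℝ] ℝ => L w) h2.mfderiv

end ChartDifferential

/-! ### The Hamiltonian vector field in charts. -/

section HamiltonianField

open Set Filter Topology

variable {n : ℕ} {M : Type*} [TopologicalSpace M] [ChartedSpace (EuclideanSpace ℝ (Fin n)) M]
  [IsManifold (𝓡 n) ∞ M]

/-- The vector of the phase space that corresponds to a covector under the symplectic form. -/
abbrev phaseHamiltonianVector (L : PhaseSpace n →L[ℝ] ℝ) : PhaseSpace n :=
  modelHamiltonianVector (predual (EuclideanSpace ℝ (Fin n)))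
    (ContinuousLinearMap.id ℝ (EuclideanSpace ℝ (Fin n) →L[ℝ] ℝ)) L

/-- The suspended Hamiltonian vector field on the model space. -/
abbrev phaseSuspendedField (H : ℝ × PhaseSpace n → ℝ) : ℝ × PhaseSpace n → ℝ × PhaseSpace n :=
  modelSuspendedField (predual (EuclideanSpace ℝ (Fin n)))
    (ContinuousLinearMap.id ℝ (EuclideanSpace ℝ (Fin n) →L[ℝ] ℝ)) H

/-- The choice in `hamiltonianField` is meaningful once a solution exists; nondegeneracy of `ω` in
canonical coordinates provides one. -/
theorem hamiltonianField_spec {H : Cotangent n M → ℝ} {z : Cotangent n M}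
    (hH : MDifferentiableAt (cotModel n) 𝓘(ℝ, ℝ) H z) (w : TangentSpace (cotModel n) z) :
    symplecticForm z ![hamiltonianField H z, w] = mvfderiv (cotModel n) H z w := by
  have hz : z ∈ (extChartAt (cotModel n) z).source := mem_extChartAt_source z
  have hex : ∃ v, ∀ w, symplecticForm z ![v, w] = mvfderiv (cotModel n) H z w := by
    obtain ⟨v, hv⟩ := chartDeriv_surjective hz (phaseHamiltonianVector
      (fderiv ℝ (fun e => H ((extChartAt (cotModel n) z).symm e)) (extChartAt (cotModel n) z z)))
    refine ⟨v, fun w => ?_⟩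
    rw [symplecticForm_apply hz, hH.mvfderiv_apply_eq_fderiv_chart hz, hv]
    exact (isPerfectPairing_canonicalPairing _).modelHamiltonianVector_spec _ _
  exact Classical.epsilon_spec hex w

/-- Nondegeneracy also gives uniqueness, so the chosen vector follows Hamilton's equations in every
chart. Smoothness of the field comes from this formula. -/
theorem chartDeriv_hamiltonianField {H : Cotangent n M → ℝ} {z₀ z : Cotangent n M}
    (hH : MDifferentiableAt (cotModel n) 𝓘(ℝ, ℝ) H z)
    (hz : z ∈ (extChartAt (cotModel n) z₀).source) :
    chartDeriv (cotModel n) z₀ z (hamiltonianField H z) = phaseHamiltonianVector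
      (fderiv ℝ (fun e => H ((extChartAt (cotModel n) z₀).symm e)) (extChartAt (cotModel n) z₀ z)) := by
  refine (isPerfectPairing_canonicalPairing _).eq_modelHamiltonianVector fun w => ?_
  obtain ⟨w, rfl⟩ := chartDeriv_surjective hz w
  rw [← hH.mvfderiv_apply_eq_fderiv_chart hz, ← hamiltonianField_spec hH, symplecticForm_apply hz]
  rfl

variable {H : ℝ × Cotangent n M → ℝ}

theorem ContMDiff.mdifferentiableAt_slice (hH : ContMDiff (extModel n) 𝓘(ℝ, ℝ) ∞ H) (t : ℝ)
    (z : Cotangent n M) : MDifferentiableAt (cotModel n) 𝓘(ℝ, ℝ) (fun z => H (t, z)) z :=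
  ((hH (t, z)).comp z (contMDiffAt_const.prodMk contMDiffAt_id)).mdifferentiableAt (by simp)

theorem differentiableAt_hamiltonianInChart (hH : ContMDiff (extModel n) 𝓘(ℝ, ℝ) ∞ H)
    {q₀ : ℝ × Cotangent n M} {e : ℝ × PhaseSpace n} (he : e ∈ (extChartAt (extModel n) q₀).target) :
    DifferentiableAt ℝ (hamiltonianInChart H q₀) e :=
  ((contDiffOn_hamiltonianInChart hH q₀).contDiffAt
    ((isOpen_extChartAt_target q₀).mem_nhds he)).differentiableAt (by simp)

theorem fderiv_slice {A : Type*} [NormedAddCommGroup A] [NormedSpace ℝ A] {f : ℝ × A → ℝ}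
    {e : ℝ × A} (hf : DifferentiableAt ℝ f e) :
    fderiv ℝ (fun a => f (e.1, a)) e.2 = fderiv ℝ f e ∘L ContinuousLinearMap.inr ℝ ℝ A :=
  (HasFDerivAt.comp e.2 (g := f) (f := fun a => (e.1, a)) hf.hasFDerivAt
    (hasFDerivAt_prodMk_right e.1 e.2)).fderiv

theorem chartDeriv_extHamiltonianField (hH : ContMDiff (extModel n) 𝓘(ℝ, ℝ) ∞ H)
    {q₀ q : ℝ × Cotangent n M} (hq : q ∈ (extChartAt (extModel n) q₀).source) :
    chartDeriv (extModel n) q₀ q (extHamiltonianField H q) =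
      phaseSuspendedField (hamiltonianInChart H q₀) (extChartAt (extModel n) q₀ q) := by
  have hs : (fun e => H (q.1, (extChartAt (cotModel n) q₀.2).symm e)) =
      fun e => hamiltonianInChart H q₀ (q.1, e) :=
    funext fun e => congrArg H (ext_chart_symm_apply q₀ (q.1, e)).symm
  have hd := differentiableAt_hamiltonianInChart hH ((extChartAt (extModel n) q₀).map_source hq)
  rw [ext_chart_apply] at hd
  rw [ext_chartDeriv hq, extHamiltonianField, timePart_mk, spacePart_mk,
    chartDeriv_hamiltonianField (hH.mdifferentiableAt_slice _ _) (mem_ext_chart_source.1 hq), hs,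
    ext_chart_apply]
  exact congrArg (fun L => ((1 : ℝ), phaseHamiltonianVector L)) (fderiv_slice hd)

theorem isCharacteristic_actionForm (hH : ContMDiff (extModel n) 𝓘(ℝ, ℝ) ∞ H) :
    IsCharacteristic (extModel n) (actionForm H) (extHamiltonianField H) where
  smooth_form := isSmoothCovectorField_actionForm hH
  smooth_field q₀ := by
    refine (ContDiffOn.modelSuspendedField (isOpen_extChartAt_target q₀)
      (contDiffOn_hamiltonianInChart hH q₀)).congr (f₁ := fieldInChart (extModel n)
        (extHamiltonianField H) q₀) (f := phaseSuspendedField (hamiltonianInChart H q₀)) fun e he => ?_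
    rw [fieldInChart, chartDeriv_extHamiltonianField hH ((extChartAt (extModel n) q₀).map_target he),
      (extChartAt (extModel n) q₀).right_inv he]
  ker q w := by
    have hq : q ∈ (extChartAt (extModel n) q).source := mem_extChartAt_source q
    have h := actionTwoForm_apply hH hq (extHamiltonianField H q) w
    rw [chartDeriv_extHamiltonianField hH hq] at h
    have h2 := (isPerfectPairing_canonicalPairing (EuclideanSpace ℝ (Fin n))).curl_modelSuspendedField
      (differentiableAt_hamiltonianInChart hH (mem_extChartAt_target q))
      (chartDeriv (extModel n) q q w)
    have h3 : bilinOfCovector (extModel n) (actionForm H) q (extHamiltonianField H q) w =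
        -actionTwoForm H q ![extHamiltonianField H q, w] := (neg_neg _).symm
    rw [h3, h, neg_neg]
    exact h2

end HamiltonianField

/-! ### The Liouville forms vanish nowhere. -/

section Volume

open Set

variable {n : ℕ}

theorem wedge_zero_right {V : Type*} [AddCommGroup V] [Module ℝ V] {k l : ℕ}
    (a : V [⋀^Fin k]→ₗ[ℝ] ℝ) : wedge a (0 : V [⋀^Fin l]→ₗ[ℝ] ℝ) = 0 := by
  have h : a.domCoprod (0 : V [⋀^Fin l]→ₗ[ℝ] ℝ) = 0 := by
    rw [← AlternatingMap.domCoprod'_apply, TensorProduct.tmul_zero, map_zero]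
  rw [wedge, h]
  ext v
  simp

variable (n) in
/-- The bilinear form `(v, w) ↦ w_p v_q + L v w_t` on the extended phase space. -/
def phaseBilin (L : ℝ × PhaseSpace n →ₗ[ℝ] ℝ) :
    (ℝ × PhaseSpace n) →ₗ[ℝ] (ℝ × PhaseSpace n) →ₗ[ℝ] ℝ :=
  LinearMap.mk₂ ℝ (fun v w => w.2.2 v.2.1 + L v * w.1)
    (fun v v' w => by simp only [Prod.fst_add, Prod.snd_add, map_add]; ring)
    (fun c v w => by
      simp only [Prod.smul_fst, Prod.smul_snd, map_smul, smul_eq_mul]; ring)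
    (fun v w w' => by
      simp only [Prod.fst_add, Prod.snd_add, add_apply]; ring)
    (fun c v w => by
      simp only [Prod.smul_fst, Prod.smul_snd, smul_apply, smul_eq_mul]; ring)

theorem phaseBilin_apply (L : ℝ × PhaseSpace n →ₗ[ℝ] ℝ) (v w : ℝ × PhaseSpace n) :
    phaseBilin n L v w = w.2.2 v.2.1 + L v * w.1 := rfl

theorem phaseBilin_zero_apply (v w : ℝ × PhaseSpace n) : phaseBilin n 0 v w = w.2.2 v.2.1 := by
  rw [phaseBilin_apply, LinearMap.zero_apply, zero_mul, add_zero]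

theorem wedge_wedgePow_ne_zero_of_phase {V : Type*} [AddCommGroup V] [Module ℝ V]
    (Ψ : V →ₗ[ℝ] ℝ × PhaseSpace n) (hΨ : Function.Surjective Ψ) (L : ℝ × PhaseSpace n →ₗ[ℝ] ℝ)
    (a : V →ₗ[ℝ] ℝ) (ha : ∀ v, a v = (Ψ v).1) (W : V [⋀^Fin 2]→ₗ[ℝ] ℝ)
    (hW : ∀ v w, W ![v, w] = phaseBilin n L (Ψ v) (Ψ w) - phaseBilin n L (Ψ w) (Ψ v)) :
    wedge (AlternatingMap.ofSubsingleton ℝ V ℝ (0 : Fin 1) a) (wedgePow W n) ≠ 0 := by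
  choose Ψ' hΨ' using hΨ
  -- The Darboux basis `∂_t`, `∂_{x_i}`, `∂_{p_i}`. The term with `L`, which comes from `dH ∧ dt`,
  -- drops out on the last two families because their time component is zero.
  refine wedge_wedgePow_ne_zero a W ((phaseBilin n L).compl₁₂ Ψ Ψ) hW
    (Ψ' (1, 0)) (fun i => Ψ' (0, EuclideanSpace.single i 1, 0))
    (fun i => Ψ' (0, 0, EuclideanSpace.proj i)) ?_ ?_ ?_ ?_ ?_ ?_ ?_
  · rw [ha, hΨ']
  · intro i
    rw [ha, hΨ']
  · intro i
    rw [ha, hΨ']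
  all_goals
    intro i j
    rw [LinearMap.compl₁₂_apply, hΨ', hΨ', phaseBilin_apply]
    simp [eq_comm]

/-- Reduces to the odd-dimensional case: on `ℝ × V`, if `W ^ n` vanished then so would `dt ∧ W ^ n`.
-/
theorem wedgePow_ne_zero_of_phase {V : Type*} [AddCommGroup V] [Module ℝ V]
    (Ψ : V →ₗ[ℝ] PhaseSpace n) (hΨ : Function.Surjective Ψ) (W : V [⋀^Fin 2]→ₗ[ℝ] ℝ)
    (hW : ∀ v w, W ![v, w] = (Ψ w).2 (Ψ v).1 - (Ψ v).2 (Ψ w).1) : wedgePow W n ≠ 0 := by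
  intro h0
  have h := wedge_wedgePow_ne_zero_of_phase (LinearMap.prodMap (LinearMap.id : ℝ →ₗ[ℝ] ℝ) Ψ)
    (Function.Surjective.prodMap Function.surjective_id hΨ) 0 (LinearMap.fst ℝ ℝ V)
    (fun _ => rfl) (W.compLinearMap (LinearMap.snd ℝ ℝ V)) (fun v w => by
      rw [phaseBilin_zero_apply, phaseBilin_zero_apply]
      refine Eq.trans ?_ (hW v.2 w.2)
      rw [AlternatingMap.compLinearMap_apply]
      congr 1
      funext i
      fin_cases i <;> rfl)
  rw [← wedgePow_compLinearMap, h0] at h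
  exact h (by rw [AlternatingMap.zero_compLinearMap, wedge_zero_right])

theorem finrank_phaseSpace : Module.finrank ℝ (PhaseSpace n) = 2 * n := by
  have h : Module.finrank ℝ (EuclideanSpace ℝ (Fin n) →L[ℝ] ℝ) = n := by
    rw [← (LinearMap.toContinuousLinearMap : (EuclideanSpace ℝ (Fin n) →ₗ[ℝ] ℝ) ≃ₗ[ℝ] _).finrank_eq]
    exact (Subspace.dual_finrank_eq).trans finrank_euclideanSpace_fin
  rw [Module.finrank_prod, h, finrank_euclideanSpace_fin, two_mul]

variable {M : Type*} [TopologicalSpace M] [ChartedSpace (EuclideanSpace ℝ (Fin n)) M]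
  [IsManifold (𝓡 n) ∞ M]

variable (n M) in
theorem isVolumeForm_liouvilleForm :
    IsVolumeForm (cotModel n) (liouvilleForm (n := n) (M := M)) := by
  refine ⟨finrank_phaseSpace, fun z => ?_⟩
  have hz : z ∈ (extChartAt (cotModel n) z).source := mem_extChartAt_source z
  exact wedgePow_ne_zero_of_phase (chartDeriv (cotModel n) z z).toLinearMap
    (chartDeriv_surjective hz) _ fun v w => symplecticForm_apply hz v w

theorem isVolumeForm_extLiouvilleForm {H : ℝ × Cotangent n M → ℝ}
    (hH : ContMDiff (extModel n) 𝓘(ℝ, ℝ) ∞ H) :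
    IsVolumeForm (extModel n) (extLiouvilleForm H) := by
  refine ⟨?_, fun q => ?_⟩
  · rw [Module.finrank_prod, finrank_phaseSpace, Module.finrank_self]
  · have hq : q ∈ (extChartAt (extModel n) q).source := mem_extChartAt_source q
    refine wedge_wedgePow_ne_zero_of_phase (chartDeriv (extModel n) q q).toLinearMap
      (chartDeriv_surjective hq)
      (fderiv ℝ (hamiltonianInChart H q) (extChartAt (extModel n) q q)).toLinearMap _
      (fun v => ?_) _ (fun v w => ?_)
    · exact (congrArg Prod.fst (ext_chartDeriv hq v)).symm
    · refine (actionTwoForm_apply hH hq v w).trans ?_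
      rw [curl_modelActionForm _ (differentiableAt_hamiltonianInChart hH (mem_extChartAt_target q))]
      simp only [phaseBilin_apply, canonicalPairing_apply, ContinuousLinearMap.coe_coe]
      ring

end Volume

/-! ### The time-dependent problem. -/

section TimeDependent

open Set Filter Topology

variable {n m : ℕ} {M : Type*} [TopologicalSpace M] [ChartedSpace (EuclideanSpace ℝ (Fin n)) M]
  [IsManifold (𝓡 n) ∞ M]

theorem PullsBackAt.compLinearMap_actionTwoForm {H : ℝ × Cotangent n M → ℝ}
    {Φ : ℝ × Cotangent n M → ℝ × Cotangent n M} {x : ℝ × Cotangent n M}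
    (h : PullsBackAt (extModel n) (extModel n) Φ (bilinOfCovector (extModel n) (actionForm H))
      (bilinOfCovector (extModel n) (actionForm H)) x) :
    (actionTwoForm H (Φ x)).toAlternatingMap.compLinearMap
      (mfderiv (extModel n) (extModel n) Φ x).toLinearMap =
        (actionTwoForm H x).toAlternatingMap := by
  ext v
  have h1 := congrArg (fun r : ℝ => -r) (h.apply_mfderiv (v 0) (v 1))
  have h2 : v = ![v 0, v 1] := by ext i; fin_cases i <;> rfl
  have h3 : (fun i => mfderiv (extModel n) (extModel n) Φ x (v i)) =
      ![mfderiv (extModel n) (extModel n) Φ x (v 0), mfderiv (extModel n) (extModel n) Φ x (v 1)] := by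
    ext i; fin_cases i <;> rfl
  change actionTwoForm H (Φ x) (fun i => mfderiv (extModel n) (extModel n) Φ x (v i)) =
    actionTwoForm H x v
  rw [h3, h2]
  exact h1

theorem IsMIntegralCurveOn.fst_extHamiltonianField {H : ℝ × Cotangent n M → ℝ}
    {γ : ℝ → ℝ × Cotangent n M} {t : ℝ} (ht : 0 ≤ t)
    (hγ : IsMIntegralCurveOn γ (extHamiltonianField H) (Icc 0 t)) : (γ t).1 = (γ 0).1 + t := by
  have hd : ∀ s ∈ Icc 0 t, HasDerivWithinAt (fun s => (γ s).1 - s) 0 (Icc 0 t) s := by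
    intro s hs
    have h1 := (mdifferentiableAt_fst (I := 𝓘(ℝ, ℝ)) (I' := cotModel n)
      (x := γ s)).hasMFDerivAt.comp_hasMFDerivWithinAt s (hγ s hs)
    have h2 : ∃ L : ℝ →L[ℝ] ℝ, HasFDerivWithinAt (fun s => (γ s).1) L (Icc 0 t) s ∧
        L 1 = timePart (q := γ s) ((1 : ℝ) • extHamiltonianField H (γ s)) :=
      ⟨_, h1.hasFDerivWithinAt, rfl⟩
    obtain ⟨L, hL, hL1⟩ := h2
    refine (hL.hasDerivWithinAt.sub (hasDerivWithinAt_id s (Icc 0 t))).congr_deriv ?_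
    rw [sub_eq_zero, hL1, one_smul]
    exact timePart_mk 1 _
  have hc : ContinuousOn (fun s => (γ s).1 - s) (Icc 0 t) := fun s hs => (hd s hs).continuousWithinAt
  have h := constant_of_has_deriv_right_zero hc (fun s hs =>
    (hd s ⟨hs.1, hs.2.le⟩).mono_of_mem_nhdsWithin (Icc_mem_nhdsGE_of_mem hs)) t ⟨ht, le_rfl⟩
  simp only [sub_zero] at h
  linarith

theorem HybridSystem.Reaches.fst_eq {H : ℝ × Cotangent n M → ℝ}
    {Y : HybridSystem (extModel n) (ℝ × Cotangent n M)} (hY : Y.field = extHamiltonianField H)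
    (hr : ∀ q, (Y.reset q).1 = q.1) {t : ℝ} {q q' : ℝ × Cotangent n M} (h : Y.Reaches t q q') :
    q'.1 = q.1 + t := by
  induction h with
  | flow t γ ht hγ hS => exact (hY ▸ hγ).fst_extHamiltonianField ht
  | reset τ t γ w hτ ht hγ hS hτS hw ih =>
    rw [ih, hr, (hY ▸ hγ : IsMIntegralCurveOn γ (extHamiltonianField H) _).fst_extHamiltonianField hτ]
    ring

theorem HybridSystem.IsFlowMapOn.fst_eq {H : ℝ × Cotangent n M → ℝ}
    {Y : HybridSystem (extModel n) (ℝ × Cotangent n M)} (hY : Y.field = extHamiltonianField H)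
    (hr : ∀ q, (Y.reset q).1 = q.1) {t : ℝ} {Φ : ℝ × Cotangent n M → ℝ × Cotangent n M}
    {U : Set (ℝ × Cotangent n M)} (hΦ : Y.IsFlowMapOn t Φ U) {q : ℝ × Cotangent n M} (hq : q ∈ U) :
    (Φ q).1 = q.1 + t := by
  rcases le_or_gt 0 t with ht | ht
  · exact ((hΦ q hq).1 ht).fst_eq hY hr
  · have := ((hΦ q hq).2 ht).fst_eq hY hr
    linarith

/-- The hybrid flow translates time by the constant `t`, hence preserves `dt`, the remaining factor
of the volume form. -/
theorem timePart_mfderiv {Φ : ℝ × Cotangent n M → ℝ × Cotangent n M} {x : ℝ × Cotangent n M} {t : ℝ}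
    (hΦ : MDifferentiableAt (extModel n) (extModel n) Φ x) (h : ∀ᶠ q in 𝓝 x, (Φ q).1 = q.1 + t)
    (v : TangentSpace (extModel n) x) :
    timePart (mfderiv (extModel n) (extModel n) Φ x v) = timePart v := by
  have h1 := (mdifferentiableAt_fst (I := 𝓘(ℝ, ℝ)) (I' := cotModel n)
    (x := Φ x)).hasMFDerivAt.comp x hΦ.hasMFDerivAt
  have h0 : HasFDerivAt (fun s : ℝ => s + t) (ContinuousLinearMap.id ℝ ℝ) x.1 :=
    (hasFDerivAt_id x.1).add_const t
  have h2 := h0.hasMFDerivAt.comp x (mdifferentiableAt_fst (I := 𝓘(ℝ, ℝ)) (I' := cotModel n)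
    (x := x)).hasMFDerivAt
  exact congrArg (fun L : ℝ × PhaseSpace n →L[ℝ] ℝ => L v)
    (hasMFDerivAt_unique h1 (h2.congr_of_eventuallyEq h))

theorem compLinearMap_extLiouvilleForm {H : ℝ × Cotangent n M → ℝ}
    {Φ : ℝ × Cotangent n M → ℝ × Cotangent n M} {x : ℝ × Cotangent n M}
    (h2 : (actionTwoForm H (Φ x)).toAlternatingMap.compLinearMap
      (mfderiv (extModel n) (extModel n) Φ x).toLinearMap = (actionTwoForm H x).toAlternatingMap)
    (h1 : ∀ v, timePart (mfderiv (extModel n) (extModel n) Φ x v) = timePart v) :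
    (extLiouvilleForm H (Φ x)).compLinearMap (mfderiv (extModel n) (extModel n) Φ x).toLinearMap =
      extLiouvilleForm H x := by
  have h3 : (AlternatingMap.ofSubsingleton ℝ (TangentSpace (extModel n) (Φ x)) ℝ (0 : Fin 1)
      (dtForm (Φ x)).toLinearMap).compLinearMap (mfderiv (extModel n) (extModel n) Φ x).toLinearMap =
      AlternatingMap.ofSubsingleton ℝ (TangentSpace (extModel n) x) ℝ (0 : Fin 1)
      (dtForm x).toLinearMap := by
    ext v
    exact h1 (v 0)
  rw [extLiouvilleForm, wedge_compLinearMap, wedgePow_compLinearMap, h2, h3]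
  rfl

theorem contMDiff_extProj :
    ContMDiff (extModel n) (𝓘(ℝ, ℝ).prod (𝓡 n)) ∞ (extProj : ℝ × Cotangent n M → ℝ × M) :=
  contMDiff_fst.prodMk ((contMDiff_cotProj M).comp contMDiff_snd)

namespace TimeHybridControlSystem

variable (C : TimeHybridControlSystem n m M)

theorem mvfderiv_h_comp_extProj {q : ℝ × Cotangent n M} (hq : extProj q ∈ C.W) :
    mvfderiv (extModel n) (C.h ∘ extProj) q = C.dhPull q := by
  have h1 : MDifferentiableAt (𝓘(ℝ, ℝ).prod (𝓡 n)) 𝓘(ℝ, ℝ) C.h (extProj q) :=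
    (C.smooth_h.contMDiffAt (C.isOpen_W.mem_nhds hq)).mdifferentiableAt (by simp)
  exact (h1.hasMFDerivAt.comp q
    (contMDiff_extProj.mdifferentiableAt (by simp)).hasMFDerivAt).mfderiv

theorem extendedGuard_eq_crossingSet : C.extendedGuard =
    crossingSet (extModel n) (extHamiltonianField C.H) (extProj ⁻¹' C.W) (C.h ∘ extProj) := by
  ext q
  constructor
  · rintro ⟨⟨h1, h2⟩, h3⟩
    exact ⟨h1, h2, by rwa [C.mvfderiv_h_comp_extProj h1]⟩
  · rintro ⟨h1, h2, h3⟩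
    exact ⟨⟨h1, h2⟩, by rwa [C.mvfderiv_h_comp_extProj h1] at h3⟩

variable {C} {R : ℝ × Cotangent n M → Cotangent n M}

/-- Puts the control problem into the abstract setting, with the guard cut out by `h ∘ (id × π)`. -/
theorem IsExtendedReset.isActionReset (hR : C.IsExtendedReset R) :
    IsActionReset (extModel n) (actionForm C.H) (extHamiltonianField C.H) (extProj ⁻¹' C.W)
      (C.h ∘ extProj) (timeReset R) where
  isOpen := C.isOpen_W.preimage contMDiff_extProj.continuous
  smooth_defining := (C.smooth_h.comp contMDiff_extProj.contMDiffOn subset_rfl).of_le (by norm_cast)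
  smooth_reset := by
    rw [← C.extendedGuard_eq_crossingSet]
    exact (contMDiff_fst.contMDiffOn.prodMk hR.smooth).of_le (by norm_cast)
  action q hq v hv := by
    rw [C.mvfderiv_h_comp_extProj hq.1] at hv
    rw [← C.extendedGuard_eq_crossingSet] at hq ⊢
    exact hR.action q hq v hv

variable [T2Space M] [SecondCountableTopology M]

theorem IsExtendedReset.preserves_actionTwoForm (hC : C.IsRegular) (hR : C.IsExtendedReset R) :
    (C.lift R).Preserves (fun q => (actionTwoForm C.H q).toAlternatingMap) :=
  fun _ _ _ hU _ hflow hΦ _ hx _ => PullsBackAt.compLinearMap_actionTwoForm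
    (hflow.pullsBackAt (isCharacteristic_actionForm hC.smooth_H) hR.isActionReset
      C.extendedGuard_eq_crossingSet hU (hΦ.of_le (by norm_cast)) hx)

theorem IsExtendedReset.preserves_extLiouvilleForm (hC : C.IsRegular) (hR : C.IsExtendedReset R) :
    (C.lift R).Preserves (extLiouvilleForm C.H) :=
  fun t U Φ hU hd hflow hΦ x hx hΦx => compLinearMap_extLiouvilleForm
    (hR.preserves_actionTwoForm hC t U Φ hU hd hflow hΦ x hx hΦx)
    (timePart_mfderiv ((hΦ.contMDiffAt (hU.mem_nhds hx)).mdifferentiableAt (by simp))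
      (eventually_of_mem (hU.mem_nhds hx) fun _ hq => hflow.fst_eq (t := t) rfl (fun _ => rfl) hq))

end TimeHybridControlSystem

end TimeDependent

/-! ### The time-independent problem via suspension. -/

section TimeIndependent

open Set Filter Topology

variable {n m : ℕ} {M : Type*} [TopologicalSpace M] [ChartedSpace (EuclideanSpace ℝ (Fin n)) M]
  [IsManifold (𝓡 n) ∞ M]

/-- On vectors without time component `ω_H` is the canonical symplectic form. -/
theorem actionTwoForm_apply_of_timePart_eq_zero {H : ℝ × Cotangent n M → ℝ}
    (hH : ContMDiff (extModel n) 𝓘(ℝ, ℝ) ∞ H) {q : ℝ × Cotangent n M}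
    {v w : TangentSpace (extModel n) q} (hv : timePart v = 0) (hw : timePart w = 0) :
    actionTwoForm H q ![v, w] = symplecticForm q.2 ![spacePart v, spacePart w] := by
  have hq : q ∈ (extChartAt (extModel n) q).source := mem_extChartAt_source q
  rw [actionTwoForm_apply hH hq, curl_modelActionForm _
    (differentiableAt_hamiltonianInChart hH (mem_extChartAt_target q)),
    symplecticForm_apply (mem_extChartAt_source q.2), ext_chartDeriv hq, ext_chartDeriv hq, hv, hw]
  simp only [canonicalPairing_apply]
  ring

/-- The suspension of a time-independent hybrid system. -/
def HybridSystem.suspension (Y : HybridSystem (cotModel n) (Cotangent n M)) :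
    HybridSystem (extModel n) (ℝ × Cotangent n M) where
  guard := univ ×ˢ Y.guard
  field := fun q => (((1 : ℝ), Y.field q.2) : ℝ × PhaseSpace n)
  reset := Prod.map id Y.reset

theorem ContinuousLinearMap.id_prod_smulRight_one {A : Type*} [NormedAddCommGroup A]
    [NormedSpace ℝ A] (a : A) :
    (ContinuousLinearMap.id ℝ ℝ).prod (ContinuousLinearMap.smulRight (1 : ℝ →L[ℝ] ℝ) a) =
      ContinuousLinearMap.smulRight (1 : ℝ →L[ℝ] ℝ) ((1 : ℝ), a) := by
  ext <;> simp

theorem IsMIntegralCurveOn.suspension {X : (z : Cotangent n M) → TangentSpace (cotModel n) z}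
    {γ : ℝ → Cotangent n M} {A : Set ℝ} (hγ : IsMIntegralCurveOn γ X A) (s : ℝ) :
    IsMIntegralCurveOn (I := extModel n) (fun r => (s + r, γ r))
      (fun q => (((1 : ℝ), X q.2) : ℝ × PhaseSpace n)) A := by
  intro r hr
  have h0 : HasFDerivWithinAt (fun r : ℝ => s + r) (ContinuousLinearMap.id ℝ ℝ) A r :=
    (hasFDerivWithinAt_id r A).const_add s
  have h1 := h0.hasMFDerivWithinAt.prodMk (hγ r hr)
  exact h1.congr_mfderiv (ContinuousLinearMap.id_prod_smulRight_one (A := PhaseSpace n) (X (γ r)))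

/-- The field `X_H` is generally not in the kernel of `dϑ`, whereas `∂_t + X_H` is in the kernel of
`dϑ_H`. Executions are therefore lifted with a clock that resets leave unchanged. -/
theorem HybridSystem.Reaches.suspension {Y : HybridSystem (cotModel n) (Cotangent n M)} {t : ℝ}
    {z w : Cotangent n M} (h : Y.Reaches t z w) (s : ℝ) :
    Y.suspension.Reaches t (s, z) (s + t, w) := by
  induction h generalizing s with
  | flow t γ ht hγ hS =>
    have := HybridSystem.Reaches.flow (Y := Y.suspension) t (fun r => (s + r, γ r)) ht
      (hγ.suspension s) fun r hr hm => hS r hr hm.2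
    simpa using this
  | reset τ t γ w hτ ht hγ hS hτS hw ih =>
    have := HybridSystem.Reaches.reset (Y := Y.suspension) τ t (fun r => (s + r, γ r))
      (s + τ + t, w) hτ ht (hγ.suspension s) (fun r hr hm => hS r hr hm.2) ⟨mem_univ _, hτS⟩
      (ih (s + τ))
    simpa [add_assoc] using this

theorem HybridSystem.IsFlowMapOn.suspension {Y : HybridSystem (cotModel n) (Cotangent n M)} {t : ℝ}
    {Φ : Cotangent n M → Cotangent n M} {U : Set (Cotangent n M)} (h : Y.IsFlowMapOn t Φ U) :
    Y.suspension.IsFlowMapOn t (fun q => (q.1 + t, Φ q.2)) (univ ×ˢ U) := fun q hq =>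
  ⟨fun ht => ((h q.2 hq.2).1 ht).suspension q.1, fun ht => by
    simpa using ((h q.2 hq.2).2 ht).suspension (q.1 + t)⟩

theorem spacePart_mfderiv {Φ : Cotangent n M → Cotangent n M} {x : ℝ × Cotangent n M} {t : ℝ}
    (hΦ : MDifferentiableAt (cotModel n) (cotModel n) Φ x.2)
    (hΦ' : MDifferentiableAt (extModel n) (extModel n)
      (fun q : ℝ × Cotangent n M => (q.1 + t, Φ q.2)) x) (v : TangentSpace (extModel n) x) :
    spacePart (mfderiv (extModel n) (extModel n)
      (fun q : ℝ × Cotangent n M => (q.1 + t, Φ q.2)) x v) =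
      mfderiv (cotModel n) (cotModel n) Φ x.2 (spacePart v) := by
  have h1 := (mdifferentiableAt_snd (I := 𝓘(ℝ, ℝ)) (I' := cotModel n)
    (x := ((x.1 + t, Φ x.2) : ℝ × Cotangent n M))).hasMFDerivAt.comp x hΦ'.hasMFDerivAt
  have h2 := hΦ.hasMFDerivAt.comp x (mdifferentiableAt_snd (I := 𝓘(ℝ, ℝ)) (I' := cotModel n)
    (x := x)).hasMFDerivAt
  exact congrArg (fun L : ℝ × PhaseSpace n →L[ℝ] PhaseSpace n => L v) (hasMFDerivAt_unique h1 h2)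

namespace HybridControlSystem

variable (C : HybridControlSystem n m M)

/-- The defining function of the guard on `ℝ × T^*M`. -/
def guardFunction (q : ℝ × Cotangent n M) : ℝ := C.h (cotProj q.2)

theorem mvfderiv_guardFunction {q : ℝ × Cotangent n M} (hq : cotProj q.2 ∈ C.W)
    (v : TangentSpace (extModel n) q) :
    mvfderiv (extModel n) C.guardFunction q v = C.dhPull q.2 (spacePart v) := by
  have h1 : MDifferentiableAt (𝓡 n) 𝓘(ℝ, ℝ) C.h (cotProj q.2) :=
    (C.smooth_h.contMDiffAt (C.isOpen_W.mem_nhds hq)).mdifferentiableAt (by simp)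
  have h2 := (h1.hasMFDerivAt.comp q.2 (mdifferentiableAt_cotProj q.2).hasMFDerivAt).comp q
    (mdifferentiableAt_snd (I := 𝓘(ℝ, ℝ)) (I' := cotModel n) (x := q)).hasMFDerivAt
  exact congrArg (fun L : ℝ × PhaseSpace n →L[ℝ] ℝ => L v) h2.mfderiv

theorem prod_extendedGuard_eq_crossingSet : (univ : Set ℝ) ×ˢ C.extendedGuard =
    crossingSet (extModel n) (extHamiltonianField fun q => C.H q.2)
      {q : ℝ × Cotangent n M | cotProj q.2 ∈ C.W} C.guardFunction := by
  have key : ∀ q : ℝ × Cotangent n M, cotProj q.2 ∈ C.W →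
      mvfderiv (extModel n) C.guardFunction q (extHamiltonianField (fun q => C.H q.2) q) =
        C.dhPull q.2 (hamiltonianField C.H q.2) := fun q hq => by
    rw [C.mvfderiv_guardFunction hq, extHamiltonianField, spacePart_mk]
  ext q
  constructor
  · rintro ⟨-, ⟨h1, h2⟩, h3⟩
    exact ⟨h1, h2, by rwa [key q h1]⟩
  · rintro ⟨h1, h2, h3⟩
    exact ⟨mem_univ _, ⟨h1, h2⟩, by rwa [key q h1] at h3⟩

variable {C} {R : Cotangent n M → Cotangent n M}

theorem IsExtendedReset.isActionReset (hR : C.IsExtendedReset R) :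
    IsActionReset (extModel n) (actionForm fun q => C.H q.2) (extHamiltonianField fun q => C.H q.2)
      {q : ℝ × Cotangent n M | cotProj q.2 ∈ C.W} C.guardFunction (Prod.map id R) where
  isOpen := C.isOpen_W.preimage ((contMDiff_cotProj M).continuous.comp continuous_snd)
  smooth_defining := (C.smooth_h.comp ((contMDiff_cotProj M).comp contMDiff_snd).contMDiffOn
    subset_rfl).of_le (by norm_cast)
  smooth_reset := by
    rw [← C.prod_extendedGuard_eq_crossingSet]
    exact (contMDiff_fst.contMDiffOn.prodMk
      (hR.smooth.comp contMDiff_snd.contMDiffOn fun q hq => hq.2)).of_le (by norm_cast)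
  action q hq v hv := by
    rw [C.mvfderiv_guardFunction hq.1] at hv
    rw [← C.prod_extendedGuard_eq_crossingSet] at hq ⊢
    exact hR.action q.1 q.2 hq.2 v hv

variable [T2Space M] [SecondCountableTopology M]

theorem IsExtendedReset.preserves_symplecticForm (hC : C.IsRegular) (hR : C.IsExtendedReset R) :
    (C.lift R).Preserves (fun z => (symplecticForm z).toAlternatingMap) := by
  intro t U Φ hU _ hflow hΦ x hx _
  have hH : ContMDiff (extModel n) 𝓘(ℝ, ℝ) ∞ fun q : ℝ × Cotangent n M => C.H q.2 :=
    hC.smooth_H.comp contMDiff_snd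
  have hU' : IsOpen ((univ : Set ℝ) ×ˢ U) := isOpen_univ.prod hU
  have hΦ' : ContMDiffOn (extModel n) (extModel n) ∞
      (fun q : ℝ × Cotangent n M => (q.1 + t, Φ q.2)) (univ ×ˢ U) :=
    ((contMDiff_id.add contMDiff_const).comp contMDiff_fst).contMDiffOn.prodMk
      (hΦ.comp contMDiff_snd.contMDiffOn fun q hq => hq.2)
  have hx' : ((0 : ℝ), x) ∈ (univ : Set ℝ) ×ˢ U := ⟨mem_univ _, hx⟩
  have hpull := hflow.suspension.pullsBackAt (θ := actionForm fun q => C.H q.2)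
    (isCharacteristic_actionForm hH) hR.isActionReset C.prod_extendedGuard_eq_crossingSet hU'
    (hΦ'.of_le (by norm_cast)) hx'
  have hd := (hΦ.contMDiffAt (hU.mem_nhds hx)).mdifferentiableAt (by simp)
  have hd' := (hΦ'.contMDiffAt (hU'.mem_nhds hx')).mdifferentiableAt (by simp)
  -- Apply the suspended result to vectors `(0, v)`. The suspended map sends them to vectors with
  -- time component zero, and on these `ω_H` reduces to `ω`.
  have key : ∀ v w : TangentSpace (cotModel n) x, symplecticForm (Φ x)
      ![mfderiv (cotModel n) (cotModel n) Φ x v, mfderiv (cotModel n) (cotModel n) Φ x w] =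
      symplecticForm x ![v, w] := by
    intro v w
    have h1 : ∀ u : TangentSpace (cotModel n) x,
        timePart (q := ((0 : ℝ), x)) (((0 : ℝ), u) : ℝ × PhaseSpace n) = 0 := fun u =>
      timePart_mk (q := ((0 : ℝ), x)) 0 u
    have h2 : ∀ u : TangentSpace (cotModel n) x,
        spacePart (q := ((0 : ℝ), x)) (((0 : ℝ), u) : ℝ × PhaseSpace n) = u := fun u =>
      spacePart_mk (q := ((0 : ℝ), x)) 0 u
    have h3 := timePart_mfderiv (t := t) hd' (Eventually.of_forall fun _ => rfl)
    have h4 : ∀ u : TangentSpace (cotModel n) x,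
        spacePart (mfderiv (extModel n) (extModel n)
          (fun q : ℝ × Cotangent n M => (q.1 + t, Φ q.2)) (0, x) (((0 : ℝ), u) : ℝ × PhaseSpace n)) =
          mfderiv (cotModel n) (cotModel n) Φ x u := fun u =>
      (spacePart_mfderiv hd hd' _).trans
        (congrArg (fun u => mfderiv (cotModel n) (cotModel n) Φ x u) (h2 u))
    have h5 := congrArg (fun r : ℝ => -r) (hpull.apply_mfderiv (((0 : ℝ), v) : ℝ × PhaseSpace n)
      (((0 : ℝ), w) : ℝ × PhaseSpace n))
    have h6 := (actionTwoForm_apply_of_timePart_eq_zero hH ((h3 _).trans (h1 v))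
      ((h3 _).trans (h1 w))).symm.trans
      (h5.trans (actionTwoForm_apply_of_timePart_eq_zero hH (h1 v) (h1 w)))
    exact (congrArg₂ (fun a b : TangentSpace (cotModel n) (Φ x) => symplecticForm (Φ x) ![a, b])
      (h4 v) (h4 w)).symm.trans (h6.trans (congrArg₂
        (fun a b : TangentSpace (cotModel n) x => symplecticForm x ![a, b]) (h2 v) (h2 w)))
  ext v
  have h2 : v = ![v 0, v 1] := by ext i; fin_cases i <;> rfl
  have h3 : (fun i => mfderiv (cotModel n) (cotModel n) Φ x (v i)) =
      ![mfderiv (cotModel n) (cotModel n) Φ x (v 0), mfderiv (cotModel n) (cotModel n) Φ x (v 1)] := by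
    ext i; fin_cases i <;> rfl
  change symplecticForm (Φ x) (fun i => mfderiv (cotModel n) (cotModel n) Φ x (v i)) =
    symplecticForm x v
  rw [h3, h2]
  exact key _ _

theorem IsExtendedReset.preserves_liouvilleForm (hC : C.IsRegular) (hR : C.IsExtendedReset R) :
    (C.lift R).Preserves (liouvilleForm (n := n) (M := M)) := by
  intro t U Φ hU hd hflow hΦ x hx hΦx
  rw [liouvilleForm, wedgePow_compLinearMap]
  exact congrArg (fun a => wedgePow a n)
    (hR.preserves_symplecticForm hC t U Φ hU hd hflow hΦ x hx hΦx)

end HybridControlSystem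

end TimeIndependent

end

theorem mainTheorem1 {n m : ℕ} {M : Type*} [TopologicalSpace M] [T2Space M]
    [SecondCountableTopology M] [ChartedSpace (EuclideanSpace ℝ (Fin n)) M]
    [IsManifold (𝓡 n) ∞ M] :
    (∀ (C : HybridControlSystem n m M) (R : Cotangent n M → Cotangent n M),
      C.IsRegular → C.IsExtendedReset R →
        (C.lift R).Preserves (fun z => (symplecticForm z).toAlternatingMap) ∧
        IsVolumeForm (cotModel n) (liouvilleForm (n := n) (M := M)) ∧
        (C.lift R).Preserves (liouvilleForm (n := n) (M := M))) ∧
    (∀ (C : TimeHybridControlSystem n m M) (R : ℝ × Cotangent n M → Cotangent n M),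
      C.IsRegular → C.IsExtendedReset R →
        (C.lift R).Preserves (fun q => (actionTwoForm C.H q).toAlternatingMap) ∧
        IsVolumeForm (extModel n) (extLiouvilleForm C.H) ∧
        (C.lift R).Preserves (extLiouvilleForm C.H)) := by
  exact ⟨fun C R hC hR => ⟨hR.preserves_symplecticForm hC, isVolumeForm_liouvilleForm n M,
      hR.preserves_liouvilleForm hC⟩,
    fun C R hC hR => ⟨hR.preserves_actionTwoForm hC, isVolumeForm_extLiouvilleForm hC.smooth_H,
      hR.preserves_extLiouvilleForm hC⟩⟩
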